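/- Let $1<p<\infty$ and let $(X,d,\mu)$ be a complete metric space with at least two points, equipped with a Borel measure $\mu$ that is doubling (for some $C_d\ge 1$, $0<\mu(2B)\le C_d\,\mu(B)<\infty$ for every open ball $B$) and supporting a $1$-Poincaré inequality: there are $C_P>0$, $\lambda\ge1$ with $\frac1{\mu(B)}\int_B|u-u_B|\,d\mu\le C_P\,\mathrm{rad}(B)\,\frac1{\mu(\lambda B)}\int_{\lambda B}g\,d\mu$ for every ball $B$, every $\mu$-measurable $u:X\to\mathbb R$ that is integrable on $B$ (with mean value $u_B$ on $B$), and every upper gradient $g$ of $u$. For a family $\mathcal M$ of Borel measures on $X$ let $\mathrm{Mod}_q(\mathcal M)=\inf\int_X\rho^q\,d\mu$, the infimum over all Borel $\rho:X\to[0,\infty]$ with $\int_X\rho\,d\nu\ge1$ for all $\nu\in\mathcal M$; for a family of curves (continuous maps from compact intervals) the condition is instead $\int_\gamma\rho\,ds\ge1$ for every rectifiable $\gamma$ in the family. An upper gradient of $u$ is a Borel function $g:X\to[0,\infty]$ with $|u(x)-u(y)|\le\int_\gamma g\,ds$ for every rectifiable curve $\gamma$ with endpoints $x,y$; a $1$-weak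 upper gradient in an open set $V$ is a $\mu$-measurable $g\ge 0$ for which this holds for all rectifiable curves in $V$ outside a family of zero $1$-modulus. For open $V\subset X$ put $P(U,V)=\inf\liminf_{n\to\infty}\int_V g_{u_n}\,d\mu$, the infimum over sequences $u_n\in\mathrm{Lip}_{loc}(V)$ with $u_n\to\chi_U$ in $L^1_{loc}(V)$, where $g_{u_n}$ is the minimal $1$-weak upper gradient of $u_n$ in $V$ and "loc" refers to open sets $V'$ with $\overline{V'}$ a compact subset of $V$. For arbitrary $A\subset X$ put $P(U,A)=\inf\{P(U,V):V\supset A\text{ open}\}$. A $\mu$-measurable set $U$ has finite perimeter in $V$ if $P(U,V)<\infty$. Let $\Omega\subset X$ be a nonempty bounded domain (open connected set) and let $E,F\subset\Omega$ be disjoint nonempty compact sets. Let $\Gamma$ be the family of curves in $\Omega$ joining $E$ and $F$, and let $$\mathcal L^*=\{P(U,\Omega\cap\cdot):\ U\subset X\ \text{of finite perimeter in }\Omega,\ E\subset\mathrm{int}(U),\ F\subset\mathrm{ext}(U)=\mathrm{int}(X\setminus U)\},$$ a family of Borel measures on $X$. If $\mathrm{Mod}_{p/(p-1)}(\mathcal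 L^*)<\infty$, then $$1\le \mathrm{Mod}_{\frac p{p-1}}(\mathcal L^*)^{\frac{p-1}p}\,\mathrm{Mod}_p(\Gamma)^{\frac1p}.$$ -/

import Mathlib

open Set Filter Topology MeasureTheory
open scoped ENNReal NNReal

namespace MetricBV

/-- A curve: a continuous map from a compact interval `[a, b]` into `X`.  The values of `toFun`
outside `[a, b]` play no role. -/
structure Curve (X : Type*) [TopologicalSpace X] where
  a : ℝ
  b : ℝ
  le : a ≤ b
  toFun : ℝ → X
  continuousOn : ContinuousOn toFun (Icc a b)

section Curves

variable {X : Type*} [MetricSpace X]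

/-- The length of a curve, as an extended nonnegative real. -/
noncomputable def Curve.length (γ : Curve X) : ℝ≥0∞ := eVariationOn γ.toFun (Icc γ.a γ.b)

/-- A curve is rectifiable if its length is finite. -/
def Curve.Rectifiable (γ : Curve X) : Prop := γ.length ≠ ⊤

/-- The curve is contained in the set `Ω`. -/
def Curve.In (γ : Curve X) (Ω : Set X) : Prop := ∀ t ∈ Icc γ.a γ.b, γ.toFun t ∈ Ω

/-- The arc-length parametrization of a (rectifiable) curve, to be used on `[0, length γ]`. -/
noncomputable def Curve.arcLength (γ : Curve X) : ℝ → X :=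
  naturalParameterization γ.toFun (Icc γ.a γ.b) γ.a

/-- The curve integral `∫_γ ρ ds = ∫_0^{ℓ_γ} ρ(γ(s)) ds` of a nonnegative function over a
rectifiable curve, where on the right `γ` is parametrized by arc length. -/
noncomputable def Curve.integral (γ : Curve X) (ρ : X → ℝ≥0∞) : ℝ≥0∞ :=
  ∫⁻ s in Icc (0 : ℝ) γ.length.toReal, ρ (γ.arcLength s)

/-- The family of curves in `Ω` joining `E ∩ Ω` and `F ∩ Ω`. -/
def joiningCurves (E F Ω : Set X) : Set (Curve X) :=
  {γ | γ.In Ω ∧ ((γ.toFun γ.a ∈ E ∩ Ω ∧ γ.toFun γ.b ∈ F ∩ Ω) ∨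
    (γ.toFun γ.a ∈ F ∩ Ω ∧ γ.toFun γ.b ∈ E ∩ Ω))}

end Curves

section Spaces

variable {X : Type*} [MetricSpace X] [MeasurableSpace X]

/-- The `q`-modulus of a family of Borel measures: the infimum of `∫ ρ^q dμ` over all Borel
`ρ : X → [0,∞]` with `∫ ρ dν ≥ 1` for every `ν` in the family. -/
noncomputable def modulus (μ : Measure X) (q : ℝ) (M : Set (Measure X)) : ℝ≥0∞ :=
  ⨅ (ρ : X → ℝ≥0∞) (_ : Measurable ρ) (_ : ∀ ν ∈ M, 1 ≤ ∫⁻ x, ρ x ∂ν), ∫⁻ x, ρ x ^ q ∂μ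

/-- The `q`-modulus of a family of curves: admissibility means `∫_γ ρ ds ≥ 1` for every
rectifiable curve `γ` of the family. -/
noncomputable def curveModulus (μ : Measure X) (q : ℝ) (Γ : Set (Curve X)) : ℝ≥0∞ :=
  ⨅ (ρ : X → ℝ≥0∞) (_ : Measurable ρ) (_ : ∀ γ ∈ Γ, γ.Rectifiable → 1 ≤ γ.integral ρ),
    ∫⁻ x, ρ x ^ q ∂μ

/-- The measure is doubling: `0 < μ(2B) ≤ C_d μ(B) < ∞` for every ball `B`. -/
def IsDoubling (μ : Measure X) : Prop :=
  ∃ C : ℝ, 1 ≤ C ∧ ∀ (x : X) (r : ℝ), 0 < r →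
    0 < μ (Metric.ball x (2 * r)) ∧
    μ (Metric.ball x (2 * r)) ≤ ENNReal.ofReal C * μ (Metric.ball x r) ∧
    μ (Metric.ball x r) < ⊤

/-- `g` is an upper gradient of `u` in the whole space: `g` is a Borel function with
`|u(x) - u(y)| ≤ ∫_γ g ds` for every rectifiable curve `γ` with endpoints `x`, `y`
(for constant curves the inequality is trivial). -/
def IsUpperGradient (u : X → ℝ) (g : X → ℝ≥0∞) : Prop :=
  Measurable g ∧ ∀ γ : Curve X, γ.Rectifiable →
    edist (u (γ.toFun γ.a)) (u (γ.toFun γ.b)) ≤ γ.integral g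

/-- The family of rectifiable curves in `Ω` along which the upper gradient inequality for the
pair `(u, g)` fails. -/
def exceptionalCurves (Ω : Set X) (u : X → ℝ) (g : X → ℝ≥0∞) : Set (Curve X) :=
  {γ | γ.Rectifiable ∧ γ.In Ω ∧ ¬ edist (u (γ.toFun γ.a)) (u (γ.toFun γ.b)) ≤ γ.integral g}

/-- `g` is a `1`-weak upper gradient of `u` in `Ω`: it is `μ`-measurable in `Ω` and the upper
gradient inequality holds for all curves in `Ω` outside a family of zero `1`-modulus. -/
def IsWeakUpperGradient (μ : Measure X) (Ω : Set X) (u : X → ℝ) (g : X → ℝ≥0∞) : Prop :=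
  AEMeasurable g (μ.restrict Ω) ∧ curveModulus μ 1 (exceptionalCurves Ω u g) = 0

/-- The space supports a `1`-Poincaré inequality.  The inequality is required for all
`μ`-measurable `u` and all balls on which `u` is integrable, so that the mean value exists. -/
def SupportsPoincare (μ : Measure X) : Prop :=
  ∃ C lam : ℝ, 0 < C ∧ 1 ≤ lam ∧ ∀ (x : X) (r : ℝ), 0 < r →
    ∀ (u : X → ℝ) (g : X → ℝ≥0∞), AEMeasurable u μ → IntegrableOn u (Metric.ball x r) μ →
      IsUpperGradient u g →
      ⨍⁻ y in Metric.ball x r, ‖u y - ⨍ z in Metric.ball x r, u z ∂μ‖ₑ ∂μ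
        ≤ ENNReal.ofReal (C * r) * ⨍⁻ y in Metric.ball x (lam * r), g y ∂μ

/-- `V ⋐ Ω`, with `V` open: the closure of `V` is a compact subset of `Ω`. -/
def CompactlyInside (V Ω : Set X) : Prop :=
  IsOpen V ∧ IsCompact (closure V) ∧ closure V ⊆ Ω

/-- `u ∈ Lip_loc(Ω)`: `u` is Lipschitz on every open `V ⋐ Ω`. -/
def LipLoc (Ω : Set X) (u : X → ℝ) : Prop :=
  ∀ V : Set X, CompactlyInside V Ω → ∃ K : ℝ≥0, LipschitzOnWith K u V

/-- `v n → u` in `L¹_loc(Ω)`: convergence in `L¹(V)` for every open `V ⋐ Ω`. -/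
def TendstoL1Loc (μ : Measure X) (Ω : Set X) (v : ℕ → X → ℝ) (u : X → ℝ) : Prop :=
  ∀ V : Set X, CompactlyInside V Ω →
    Tendsto (fun n => ∫⁻ x in V, ‖v n x - u x‖ₑ ∂μ) atTop (𝓝 0)

/-- The total variation `‖Du‖(Ω)` of `u` in the open set `Ω`, by relaxation of `∫_Ω g_v dμ`
over locally Lipschitz `v`.  Since the minimal `1`-weak upper gradient `g_v` is a.e. the smallest
`1`-weak upper gradient of `v`, the infimum is taken over all `1`-weak upper gradients. -/
noncomputable def totalVariation (μ : Measure X) (u : X → ℝ) (Ω : Set X) : ℝ≥0∞ :=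
  ⨅ (v : ℕ → X → ℝ) (g : ℕ → X → ℝ≥0∞) (_ : ∀ n, LipLoc Ω (v n))
    (_ : TendstoL1Loc μ Ω v u) (_ : ∀ n, IsWeakUpperGradient μ Ω (v n) (g n)),
    liminf (fun n => ∫⁻ x in Ω, g n x ∂μ) atTop

/-- The perimeter `P(U, A) = ‖Dχ_U‖(A)` of `U` in an arbitrary set `A`: the infimum of
`‖Dχ_U‖(V)` over all open `V ⊇ A`. -/
noncomputable def perimeter (μ : Measure X) (U A : Set X) : ℝ≥0∞ :=
  ⨅ (V : Set X) (_ : IsOpen V) (_ : A ⊆ V), totalVariation μ (U.indicator fun _ => (1 : ℝ)) V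

/-- `U` is a `μ`-measurable set of finite perimeter in the open set `Ω`. -/
def HasFinitePerimeter (μ : Measure X) (U Ω : Set X) : Prop :=
  NullMeasurableSet U μ ∧ totalVariation μ (U.indicator fun _ => (1 : ℝ)) Ω < ⊤

/-- The family of the measures `P(U, Ω ∩ ·)`, where `U` runs over the sets of finite perimeter
in `Ω` with `E ⊆ int U` and `F ⊆ ext U`.  (A Borel measure is determined by its values on Borel
sets.) -/
def separatingPerimeters (μ : Measure X) (E F Ω : Set X) : Set (Measure X) :=
  {ν | ∃ U : Set X, HasFinitePerimeter μ U Ω ∧ E ⊆ interior U ∧ F ⊆ interior Uᶜ ∧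
    ∀ A : Set X, MeasurableSet A → ν A = perimeter μ U (Ω ∩ A)}

end Spaces

end MetricBV

/-! By Hölder it is enough that `∫_Ω ρ σ dμ ≥ 1` whenever `ρ` is admissible for the curves and `σ`
for the perimeter measures; minimizing over both then gives the inequality. By Vitali–Carathéodory
both functions may be taken lower semicontinuous and bounded away from zero, at arbitrarily small
cost.

The link between the two families is a function `v` that is `0` on `E`, at least `s` on `F` (with `s
< 1` arbitrary), locally Lipschitz in `Ω`, and has `ρ` plus a small error as upper gradient. For `0
< t < s` the set `{v < t}` separates `E` from `F`, and its perimeter measure is bounded on open sets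
by the liminf of the densities of slabs `{t - 1/n ≤ v ≤ t}`, weighted by `n` times the gradient.
Testing with `σ` and integrating over `t` with Fatou and Tonelli gives `s ≤ ∫ ρ σ` up to the error
(`ofReal_le_lintegral_of_separating`).

The natural `v` is the least `ρ`-cost of a path from `E`, which need not be continuous. It is
replaced by the least cost of coarse paths, with small jumps allowed and `ρ` replaced by bounded
lower regularizations. These potentials are Lipschitz on compact sets and have upper gradient `ρ`
(`upperGradientOn_potential`). Compactness of coarse paths shows that they are almost `1` on `F`
(`exists_le_potential`). Each lives only on a compact part of `Ω`, so infinitely many are glued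
along an exhaustion; the gluing errors are small because the potentials converge in `L¹(σ μ)`
(`one_le_lintegral_mul`).

The argument also needs `P(U, ·)` to be a Borel measure (`exists_perimeterMeasure`). Subadditivity
on open sets comes from the same gluing, applied to approximating sequences, and Carathéodory's
criterion for metric outer measures does the rest. -/

namespace MetricBV
-- Arc length and reparametrization of curves
section ArcLength
variable {X : Type*} [MetricSpace X]

/-- The one-sided jumps of the variation function have the size of the jumps of `f`, and these
vanish by continuity. -/
theorem continuousOn_variationOnFromTo {f : ℝ → X} {a b : ℝ} (hab : a ≤ b)
    (hf : ContinuousOn f (Icc a b)) (hv : BoundedVariationOn f (Icc a b)) :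
    ContinuousOn (variationOnFromTo f (Icc a b) a) (Icc a b) := by
  intro x hx
  have ha : a ∈ Icc a b := left_mem_Icc.2 hab
  have hl := variationOnFromTo.tendsto_left ha hx hv.locallyBoundedVariationOn
    ((hf x hx).mono inter_subset_left : ContinuousWithinAt f (Icc a b ∩ Iio x) x)
  have hr := variationOnFromTo.tendsto_right ha hx hv.locallyBoundedVariationOn
    ((hf x hx).mono inter_subset_left : ContinuousWithinAt f (Icc a b ∩ Ioi x) x)
  rw [dist_self, sub_zero] at hl
  rw [dist_self, add_zero] at hr
  have h : ContinuousWithinAt (variationOnFromTo f (Icc a b) a)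
      (Icc a b ∩ Iio x ∪ Icc a b ∩ Ioi x) x := by
    rw [continuousWithinAt_union]; exact ⟨hl, hr⟩
  rw [← continuousWithinAt_insert_self] at h
  refine h.mono fun y hy => ?_
  rcases lt_trichotomy y x with h1 | h1 | h1
  · exact Or.inr (Or.inl ⟨hy, h1⟩)
  · exact Or.inl h1
  · exact Or.inr (Or.inr ⟨hy, h1⟩)

theorem image_variationOnFromTo_Icc {f : ℝ → X} {a b : ℝ} (hab : a ≤ b)
    (hf : ContinuousOn f (Icc a b)) (hv : BoundedVariationOn f (Icc a b)) :
    variationOnFromTo f (Icc a b) a '' Icc a b =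
      Icc 0 (eVariationOn f (Icc a b)).toReal := by
  have hb : variationOnFromTo f (Icc a b) a b = (eVariationOn f (Icc a b)).toReal := by
    rw [variationOnFromTo.eq_of_le _ _ hab, inter_self]
  apply Subset.antisymm
  · rintro _ ⟨x, hx, rfl⟩
    refine ⟨variationOnFromTo.nonneg_of_le _ _ hx.1, ?_⟩
    rw [← hb]
    exact variationOnFromTo.monotoneOn hv.locallyBoundedVariationOn (left_mem_Icc.2 hab) hx
      (right_mem_Icc.2 hab) hx.2
  · have := intermediate_value_Icc hab (continuousOn_variationOnFromTo hab hf hv)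
    rwa [hb, variationOnFromTo.self] at this

theorem naturalParameterization_variationOnFromTo {f : ℝ → X} {s : Set ℝ} {a t : ℝ}
    (hv : LocallyBoundedVariationOn f s) (ha : a ∈ s) (ht : t ∈ s) :
    naturalParameterization f s a (variationOnFromTo f s a t) = f t :=
  edist_eq_zero.1 (edist_naturalParameterization_eq_zero hv ha ht)

theorem Curve.lipschitzOnWith_arcLength (γ : Curve X) (hγ : γ.Rectifiable) :
    LipschitzOnWith 1 γ.arcLength (Icc 0 γ.length.toReal) := by
  have hu := has_unit_speed_naturalParameterization γ.toFun
    (BoundedVariationOn.locallyBoundedVariationOn hγ) (left_mem_Icc.2 γ.le)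
  rw [image_variationOnFromTo_Icc γ.le γ.continuousOn hγ] at hu
  have key : ∀ x ∈ Icc 0 γ.length.toReal, ∀ y ∈ Icc 0 γ.length.toReal, x ≤ y →
      edist (γ.arcLength x) (γ.arcLength y) ≤ edist x y := by
    intro x hx y hy hxy
    refine (eVariationOn.edist_le _ (s := Icc 0 γ.length.toReal ∩ Icc x y)
      ⟨hx, left_mem_Icc.2 hxy⟩ ⟨hy, right_mem_Icc.2 hxy⟩).trans (le_of_eq ?_)
    refine (hu hx hy).trans ?_
    rw [NNReal.coe_one, one_mul, edist_comm, edist_dist, Real.dist_eq, abs_of_nonneg (by linarith)]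
  intro x hx y hy
  rw [ENNReal.coe_one, one_mul]
  rcases le_total x y with h | h
  · exact key x hx y hy h
  · rw [edist_comm, edist_comm x]; exact key y hy x hx h

theorem Curve.arcLength_zero (γ : Curve X) (hγ : γ.Rectifiable) :
    γ.arcLength 0 = γ.toFun γ.a := by
  have := naturalParameterization_variationOnFromTo
    (BoundedVariationOn.locallyBoundedVariationOn hγ) (left_mem_Icc.2 γ.le) (left_mem_Icc.2 γ.le)
  rwa [variationOnFromTo.self] at this

theorem Curve.arcLength_length (γ : Curve X) (hγ : γ.Rectifiable) :
    γ.arcLength γ.length.toReal = γ.toFun γ.b := by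
  have := naturalParameterization_variationOnFromTo
    (BoundedVariationOn.locallyBoundedVariationOn hγ) (left_mem_Icc.2 γ.le) (right_mem_Icc.2 γ.le)
  rwa [variationOnFromTo.eq_of_le _ _ γ.le, inter_self] at this

theorem Curve.mapsTo_arcLength (γ : Curve X) (hγ : γ.Rectifiable) {V : Set X} (hV : γ.In V) :
    MapsTo γ.arcLength (Icc 0 γ.length.toReal) V := by
  intro x hx
  have hx' : x ∈ Icc 0 (eVariationOn γ.toFun (Icc γ.a γ.b)).toReal := hx
  rw [← image_variationOnFromTo_Icc γ.le γ.continuousOn hγ] at hx'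
  obtain ⟨t, ht, rfl⟩ := hx'
  have := naturalParameterization_variationOnFromTo
    (BoundedVariationOn.locallyBoundedVariationOn hγ) (left_mem_Icc.2 γ.le) ht
  rw [Curve.arcLength, this]
  exact hV t ht

theorem eVariationOn_le_of_lipschitzOnWith {c : ℝ → X} {a b : ℝ} {s : Set ℝ}
    (hc : LipschitzOnWith 1 c s) (hs : s = Icc a b) :
    eVariationOn c s ≤ ENNReal.ofReal (b - a) := by
  subst hs
  have := hc.comp_eVariationOn_le (f := c) (g := id) (s := Icc a b) (fun x hx => hx)
  rwa [Function.comp_id, eVariationOn_id_Icc, ENNReal.coe_one, one_mul] at this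

/-- A `1`-Lipschitz path, regarded as a curve. -/
def lipCurve {c : ℝ → X} {a b : ℝ} (hab : a ≤ b) (hc : LipschitzOnWith 1 c (Icc a b)) : Curve X :=
  ⟨a, b, hab, c, hc.continuousOn⟩

theorem rectifiable_lipCurve {c : ℝ → X} {a b : ℝ} (hab : a ≤ b)
    (hc : LipschitzOnWith 1 c (Icc a b)) : (lipCurve hab hc).Rectifiable :=
  ((eVariationOn_le_of_lipschitzOnWith hc rfl).trans_lt ENNReal.ofReal_lt_top).ne

/-- The arc-length function `ℓ` of a `1`-Lipschitz path is itself `1`-Lipschitz, so it does not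
increase Lebesgue measure. Hence Lebesgue measure on `[0, length]` is dominated by the push-forward
under `ℓ` of Lebesgue measure on `[a, b]`. This lets curves be handled through `1`-Lipschitz paths
that need not have unit speed. -/
theorem integral_lipCurve_le {c : ℝ → X} {a b : ℝ} (hab : a ≤ b)
    (hc : LipschitzOnWith 1 c (Icc a b)) (g : X → ℝ≥0∞) :
    (lipCurve hab hc).integral g ≤ ∫⁻ s in Icc a b, g (c s) := by
  have hv : BoundedVariationOn c (Icc a b) := rectifiable_lipCurve hab hc
  have hl := hv.locallyBoundedVariationOn
  have ha : a ∈ Icc a b := left_mem_Icc.2 hab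
  set ℓ := variationOnFromTo c (Icc a b) a with hℓ
  have hcont : ContinuousOn ℓ (Icc a b) := continuousOn_variationOnFromTo hab hc.continuousOn hv
  have hmeas : AEMeasurable ℓ (volume.restrict (Icc a b)) := hcont.aemeasurable measurableSet_Icc
  have himg : ℓ '' Icc a b = Icc 0 (eVariationOn c (Icc a b)).toReal :=
    image_variationOnFromTo_Icc hab hc.continuousOn hv
  have hlip : LipschitzOnWith 1 ℓ (Icc a b) := by
    refine LipschitzOnWith.of_le_add_mul 1 fun x hx y hy => ?_
    rw [NNReal.coe_one, one_mul, Real.dist_eq]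
    rcases le_total x y with h | h
    · have := variationOnFromTo.monotoneOn hl ha hx hy h
      have h2 := abs_nonneg (x - y)
      simp only [← hℓ] at this; linarith
    · have h1 : ℓ x - ℓ y = variationOnFromTo c (Icc a b) y x :=
        variationOnFromTo.sub_right hl ha hx hy
      rw [variationOnFromTo.eq_of_le _ _ h] at h1
      have hI : Icc a b ∩ Icc y x = Icc y x := inter_eq_right.2 (Icc_subset_Icc hy.1 hx.2)
      have h2 : (eVariationOn c (Icc a b ∩ Icc y x)).toReal ≤ x - y := by
        refine ENNReal.toReal_le_of_le_ofReal (by linarith) ?_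
        exact eVariationOn_le_of_lipschitzOnWith (hc.mono inter_subset_left) hI
      rw [abs_of_nonneg (by linarith)]; linarith
  -- Lebesgue measure on the line is one-dimensional Hausdorff measure, which does not grow under
  -- `1`-Lipschitz maps.
  have hle : volume.restrict (Icc (0:ℝ) (eVariationOn c (Icc a b)).toReal) ≤
      (volume.restrict (Icc a b)).map ℓ := by
    refine Measure.le_iff.2 fun S hS => ?_
    rw [Measure.map_apply_of_aemeasurable hmeas hS, Measure.restrict_apply hS,
      Measure.restrict_apply' measurableSet_Icc, ← himg]
    have h1 : S ∩ ℓ '' Icc a b ⊆ ℓ '' (ℓ ⁻¹' S ∩ Icc a b) := by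
      rintro _ ⟨hs, t, ht, rfl⟩
      exact ⟨t, ⟨hs, ht⟩, rfl⟩
    refine (measure_mono h1).trans ?_
    have := (hlip.mono (inter_subset_right : ℓ ⁻¹' S ∩ Icc a b ⊆ _)).hausdorffMeasure_image_le
      (zero_le_one : (0:ℝ) ≤ 1)
    simpa [hausdorffMeasure_real] using this
  calc (lipCurve hab hc).integral g
      = ∫⁻ s in Icc (0:ℝ) (eVariationOn c (Icc a b)).toReal,
          g (naturalParameterization c (Icc a b) a s) := rfl
    _ ≤ ∫⁻ s, g (naturalParameterization c (Icc a b) a s)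
          ∂((volume.restrict (Icc a b)).map ℓ) := lintegral_mono' hle le_rfl
    _ ≤ ∫⁻ s in Icc a b, g (naturalParameterization c (Icc a b) a (ℓ s)) := lintegral_map_le _ _
    _ = ∫⁻ s in Icc a b, g (c s) := by
        refine setLIntegral_congr_fun measurableSet_Icc fun s hs => ?_
        simp only [hℓ]
        rw [naturalParameterization_variationOnFromTo hl ha hs]

end ArcLength

/-! ### Upper gradients along Lipschitz paths -/

section UpperGradientOn
variable {X : Type*} [MetricSpace X]

/-- `g` is an upper gradient of `u` along all `1`-Lipschitz paths in `V`. -/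
def UpperGradientOn (V : Set X) (u : X → ℝ) (g : X → ℝ≥0∞) : Prop :=
  ∀ ⦃a b : ℝ⦄ ⦃c : ℝ → X⦄, a ≤ b → LipschitzOnWith 1 c (Icc a b) → MapsTo c (Icc a b) V →
    edist (u (c a)) (u (c b)) ≤ ∫⁻ s in Icc a b, g (c s)

theorem UpperGradientOn.edist_le_integral {V : Set X} {u : X → ℝ} {g : X → ℝ≥0∞}
    (h : UpperGradientOn V u g) {γ : Curve X} (hγ : γ.Rectifiable) (hV : γ.In V) :
    edist (u (γ.toFun γ.a)) (u (γ.toFun γ.b)) ≤ γ.integral g := by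
  have := h ENNReal.toReal_nonneg (γ.lipschitzOnWith_arcLength hγ) (γ.mapsTo_arcLength hγ hV)
  rwa [γ.arcLength_zero hγ, γ.arcLength_length hγ] at this

theorem UpperGradientOn.exceptionalCurves_eq_empty {V : Set X} {u : X → ℝ} {g : X → ℝ≥0∞}
    (h : UpperGradientOn V u g) : exceptionalCurves V u g = ∅ :=
  eq_empty_of_forall_notMem fun _ hγ => hγ.2.2 (h.edist_le_integral hγ.1 hγ.2.1)

theorem UpperGradientOn.mono {V W : Set X} {u : X → ℝ} {g h : X → ℝ≥0∞}
    (hu : UpperGradientOn V u g) (hWV : W ⊆ V) (hgh : ∀ x ∈ W, g x ≤ h x) :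
    UpperGradientOn W u h := fun _ _ _ hab hc hW =>
  (hu hab hc (hW.mono_right hWV)).trans <|
    setLIntegral_mono' measurableSet_Icc fun _ hs => hgh _ (hW hs)

theorem UpperGradientOn.congr {V : Set X} {u v : X → ℝ} {g : X → ℝ≥0∞}
    (hu : UpperGradientOn V u g) (h : EqOn u v V) : UpperGradientOn V v g := fun a b c hab hc hV => by
  rw [← h (hV (left_mem_Icc.2 hab)), ← h (hV (right_mem_Icc.2 hab))]
  exact hu hab hc hV

theorem UpperGradientOn.congr_of_subset {V W : Set X} {u v : X → ℝ} {g : X → ℝ≥0∞}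
    (hu : UpperGradientOn V u g) (hWV : W ⊆ V) (h : EqOn u v W) : UpperGradientOn W v g :=
  (hu.mono hWV fun _ _ => le_rfl).congr h

/-- A bound on increments over short intervals, by the integral of a fixed function, extends to
the whole interval. -/
theorem edist_le_setLIntegral_of_local {E : Type*} [PseudoEMetricSpace E] {h : ℝ → E}
    {G : ℝ → ℝ≥0∞} {a b : ℝ} (hab : a ≤ b)
    (hloc : ∀ t ∈ Icc a b, ∃ δ > 0, ∀ s s', s ≤ s' → s ∈ Icc a b → s' ∈ Icc a b →
      |s - t| < δ → |s' - t| < δ → edist (h s) (h s') ≤ ∫⁻ r in Icc s s', G r) :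
    edist (h a) (h b) ≤ ∫⁻ r in Icc a b, G r := by
  choose! δ hδ hloc using hloc
  obtain ⟨t, t0, tmono, ⟨m, hm⟩, ht⟩ := exists_monotone_Icc_subset_open_cover_Icc hab
    (c := fun i : Icc a b => {x : Icc a b | |(x : ℝ) - i| < δ i})
    (fun i => isOpen_lt (by fun_prop) continuous_const)
    (fun x _ => mem_iUnion.2 ⟨x, by simpa using hδ x x.2⟩)
  have key : ∀ n, edist (h a) (h (t n)) ≤ ∫⁻ r in Icc a (t n), G r := by
    intro n
    induction n with
    | zero => rw [t0]; simp
    | succ n ih =>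
      obtain ⟨i, hi⟩ := ht n
      have hmn : t n ≤ t (n+1) := tmono n.le_succ
      have h1 := hi (left_mem_Icc.2 hmn)
      have h2 := hi (right_mem_Icc.2 hmn)
      have h3 := hloc i i.2 (t n) (t (n+1)) hmn (t n).2 (t (n+1)).2 h1 h2
      refine (edist_triangle _ (h (t n)) _).trans ((add_le_add ih h3).trans (le_of_eq ?_))
      rw [setLIntegral_congr (Ioc_ae_eq_Icc (a := ((t n : Icc a b) : ℝ))).symm,
        ← lintegral_union measurableSet_Ioc, Icc_union_Ioc_eq_Icc (t n).2.1 hmn]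
      exact disjoint_left.2 fun x hx hx' => absurd hx.2 (not_le.2 hx'.1)
  have := key m
  rwa [hm m le_rfl] at this

/-- A path is cut into finitely many pieces, each inside one of the open sets; integrals of the same
`g` over the pieces add up. -/
theorem UpperGradientOn.of_local {V : Set X} {u : X → ℝ} {g : X → ℝ≥0∞}
    (h : ∀ x ∈ V, ∃ O, IsOpen O ∧ x ∈ O ∧ UpperGradientOn O u g) : UpperGradientOn V u g := by
  intro a b c hab hc hV
  refine edist_le_setLIntegral_of_local (h := fun s => u (c s)) (G := fun s => g (c s)) hab ?_
  intro t ht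
  obtain ⟨O, hO, htO, hu⟩ := h _ (hV ht)
  obtain ⟨δ, hδ, hball⟩ := Metric.mem_nhdsWithin_iff.1
    (hc.continuousOn t ht (hO.mem_nhds htO))
  refine ⟨δ, hδ, fun s s' hss hs hs' h1 h2 => hu hss (hc.mono (Icc_subset_Icc hs.1 hs'.2)) ?_⟩
  intro r hr
  refine hball ⟨?_, hs.1.trans hr.1, hr.2.trans hs'.2⟩
  rw [Metric.mem_ball, Real.dist_eq]
  rw [abs_lt] at *
  exact ⟨by linarith [hr.1], by linarith [hr.2]⟩

/-- The Leibniz rule for a convex combination of two functions with a common upper gradient. -/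
theorem UpperGradientOn.convex_comb {V : Set X} {w w' : X → ℝ} {g : X → ℝ≥0∞} {ζ : X → ℝ} {L : ℝ≥0}
    (hw : UpperGradientOn V w g) (hw' : UpperGradientOn V w' g) (cw : ContinuousOn w V)
    (cw' : ContinuousOn w' V) (hζ : LipschitzWith L ζ) (h0 : ∀ x, 0 ≤ ζ x) (h1 : ∀ x, ζ x ≤ 1) :
    UpperGradientOn V (fun x => ζ x * w x + (1 - ζ x) * w' x)
      (fun x => g x + L * ‖w x - w' x‖ₑ) := by
  intro a b c hab hc hV
  refine ENNReal.le_of_forall_pos_le_add fun ε hε _ => ?_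
  -- Oscillation allowed to `w - w'` on short intervals; the accumulated error `L * η * (b - a)`
  -- stays below `ε`.
  set η : ℝ≥0 := ε / (L * (b - a).toNNReal + 1) with hη
  have hηpos : 0 < η := by positivity
  have hd : ContinuousOn (fun s => w (c s) - w' (c s)) (Icc a b) :=
    (cw.comp hc.continuousOn hV).sub (cw'.comp hc.continuousOn hV)
  -- On a short interval the product rule involves `w - w'` at the left endpoint only. Comparing
  -- with its value at the running point costs `η`.
  have key : edist ((fun x => ζ x * w x + (1 - ζ x) * w' x) (c a))
      ((fun x => ζ x * w x + (1 - ζ x) * w' x) (c b)) ≤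
      ∫⁻ s in Icc a b, (g (c s) + L * ‖w (c s) - w' (c s)‖ₑ + (L * η : ℝ≥0)) := by
    refine edist_le_setLIntegral_of_local
      (h := fun s => (fun x => ζ x * w x + (1 - ζ x) * w' x) (c s)) hab fun t ht => ?_
    obtain ⟨δ, hδ, hball⟩ := Metric.continuousOn_iff.1 hd t ht (η / 2) (by positivity)
    refine ⟨δ, hδ, fun s s' hss hs hs' hst hst' => ?_⟩
    have hsub : Icc s s' ⊆ Icc a b := Icc_subset_Icc hs.1 hs'.2
    have e1 := hw hss (hc.mono hsub) (hV.mono_left hsub)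
    have e2 := hw' hss (hc.mono hsub) (hV.mono_left hsub)
    set I := ∫⁻ r in Icc s s', g (c r) with hI
    have hζd : edist (ζ (c s)) (ζ (c s')) ≤ L * edist s s' := by
      refine (hζ _ _).trans ?_
      gcongr
      simpa using hc hs hs'
    have hnear : ∀ r ∈ Icc s s', ‖w (c s) - w' (c s)‖ₑ ≤ ‖w (c r) - w' (c r)‖ₑ + η := by
      intro r hr
      have hrt : |r - t| < δ := by
        rw [abs_lt] at *
        exact ⟨by linarith [hr.1], by linarith [hr.2]⟩
      have d1 := hball s hs (by simpa [Real.dist_eq] using hst)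
      have d2 := hball r (hsub hr) (by simpa [Real.dist_eq] using hrt)
      have d3 : dist (w (c s) - w' (c s)) (w (c r) - w' (c r)) ≤ η := by
        have := dist_triangle_right (w (c s) - w' (c s)) (w (c r) - w' (c r)) (w (c t) - w' (c t))
        linarith
      have d4 : ‖w (c s) - w' (c s)‖ ≤ ‖w (c r) - w' (c r)‖ + η := by
        rw [dist_eq_norm] at d3
        have := norm_le_norm_add_norm_sub' (w (c s) - w' (c s)) (w (c r) - w' (c r))
        linarith
      rw [← ofReal_norm, ← ofReal_norm, ← ENNReal.ofReal_coe_nnreal,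
        ← ENNReal.ofReal_add (norm_nonneg _) η.coe_nonneg]
      exact ENNReal.ofReal_le_ofReal d4
    have hmain : edist (ζ (c s) * w (c s) + (1 - ζ (c s)) * w' (c s))
        (ζ (c s') * w (c s') + (1 - ζ (c s')) * w' (c s')) ≤
        I + L * edist s s' * ‖w (c s) - w' (c s)‖ₑ := by
      have hz0 := h0 (c s')
      have hz1 := h1 (c s')
      have hnorm : ‖(ζ (c s) * w (c s) + (1 - ζ (c s)) * w' (c s)) -
          (ζ (c s') * w (c s') + (1 - ζ (c s')) * w' (c s'))‖ ≤
          ζ (c s') * ‖w (c s) - w (c s')‖ + (1 - ζ (c s')) * ‖w' (c s) - w' (c s')‖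
            + ‖ζ (c s) - ζ (c s')‖ * ‖w (c s) - w' (c s)‖ := by
        have : (ζ (c s) * w (c s) + (1 - ζ (c s)) * w' (c s)) -
          (ζ (c s') * w (c s') + (1 - ζ (c s')) * w' (c s')) =
          ζ (c s') * (w (c s) - w (c s')) + (1 - ζ (c s')) * (w' (c s) - w' (c s'))
            + (ζ (c s) - ζ (c s')) * (w (c s) - w' (c s)) := by ring
        rw [this]
        refine (norm_add₃_le).trans (le_of_eq ?_)
        rw [norm_mul, norm_mul, norm_mul, Real.norm_of_nonneg hz0,
          Real.norm_of_nonneg (sub_nonneg.2 hz1)]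
      rw [edist_eq_enorm_sub, ← ofReal_norm]
      refine (ENNReal.ofReal_le_ofReal hnorm).trans ?_
      rw [ENNReal.ofReal_add (by have := sub_nonneg.2 hz1; positivity) (by positivity),
        ENNReal.ofReal_add (by positivity) (by have := sub_nonneg.2 hz1; positivity),
        ENNReal.ofReal_mul hz0, ENNReal.ofReal_mul (sub_nonneg.2 hz1),
        ENNReal.ofReal_mul (norm_nonneg _), ofReal_norm, ofReal_norm, ofReal_norm, ofReal_norm,
        ← edist_eq_enorm_sub, ← edist_eq_enorm_sub, ← edist_eq_enorm_sub (ζ _)]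
      gcongr
      calc _ ≤ ENNReal.ofReal (ζ (c s')) * I + ENNReal.ofReal (1 - ζ (c s')) * I := by gcongr
        _ = I := by
          rw [← add_mul, ← ENNReal.ofReal_add hz0 (sub_nonneg.2 hz1)]
          simp
    refine hmain.trans ?_
    calc I + L * edist s s' * ‖w (c s) - w' (c s)‖ₑ
        = I + ∫⁻ r in Icc s s', L * ‖w (c s) - w' (c s)‖ₑ := by
          rw [setLIntegral_const, Real.volume_Icc, edist_comm, edist_dist, Real.dist_eq,
            abs_of_nonneg (sub_nonneg.2 hss)]
          ring
      _ = ∫⁻ r in Icc s s', (g (c r) + L * ‖w (c s) - w' (c s)‖ₑ) := by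
          rw [lintegral_add_right _ measurable_const]
      _ ≤ _ := by
          refine setLIntegral_mono' measurableSet_Icc fun r hr => ?_
          rw [add_assoc]
          gcongr
          rw [ENNReal.coe_mul, ← mul_add]
          gcongr
          exact hnear r hr
  refine key.trans ?_
  rw [lintegral_add_right _ measurable_const, setLIntegral_const, Real.volume_Icc]
  gcongr
  rw [ENNReal.ofReal, ← ENNReal.coe_mul, ENNReal.coe_le_coe, hη]
  set q := L * (b - a).toNNReal
  calc L * (ε / (q + 1)) * (b - a).toNNReal = ε * (q / (q + 1)) := by
        simp only [q]; field_simp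
    _ ≤ ε * 1 := by
        gcongr
        exact div_le_one_of_le₀ (by simp) (by positivity)
    _ = ε := mul_one _

end UpperGradientOn

theorem liminf_add_liminf_le (a b : ℕ → ℝ≥0∞) :
    liminf a atTop + liminf b atTop ≤ liminf (fun n => a n + b n) atTop := by
  simp only [liminf_eq_iSup_iInf_of_nat]
  rw [ENNReal.iSup_add_iSup_of_monotone]
  · exact iSup_mono fun n => le_iInf₂ fun i hi =>
      add_le_add (iInf₂_le i hi) (iInf₂_le i hi)
  · exact fun m n hmn => le_iInf₂ fun i hi => iInf₂_le i (hmn.trans hi)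
  · exact fun m n hmn => le_iInf₂ fun i hi => iInf₂_le i (hmn.trans hi)

/-! ### Total variation on open sets: approximation, monotonicity, superadditivity -/

section TotalVariation
variable {X : Type*} [MetricSpace X]

theorem LipLoc.locallyLipschitzOn [ProperSpace X] {V : Set X} {u : X → ℝ} (hV : IsOpen V)
    (h : LipLoc V u) : LocallyLipschitzOn V u := by
  intro x hx
  obtain ⟨r, hr, hrV⟩ := Metric.nhds_basis_closedBall.mem_iff.1 (hV.mem_nhds hx)
  have hcl : closure (Metric.ball x r) ⊆ Metric.closedBall x r := Metric.closure_ball_subset_closedBall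
  obtain ⟨K, hK⟩ := h (Metric.ball x r)
    ⟨Metric.isOpen_ball, (isCompact_closedBall x r).of_isClosed_subset isClosed_closure hcl,
      hcl.trans hrV⟩
  exact ⟨K, _, mem_nhdsWithin_of_mem_nhds (Metric.ball_mem_nhds x hr), hK⟩

theorem _root_.LocallyLipschitzOn.lipLoc {V : Set X} {u : X → ℝ}
    (h : LocallyLipschitzOn V u) : LipLoc V u := fun _ hW =>
  let ⟨K, hK⟩ := (h.mono hW.2.2).exists_lipschitzOnWith_of_compact hW.2.1
  ⟨K, hK.mono subset_closure⟩

theorem CompactlyInside.mono {V W O : Set X} (h : CompactlyInside O W) (hWV : W ⊆ V) :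
    CompactlyInside O V := ⟨h.1, h.2.1, h.2.2.trans hWV⟩

theorem LipLoc.mono {V W : Set X} {u : X → ℝ} (h : LipLoc V u) (hWV : W ⊆ V) : LipLoc W u :=
  fun _ hO => h _ (hO.mono hWV)

variable [MeasurableSpace X] {μ : Measure X}

theorem TendstoL1Loc.mono {V W : Set X} {v : ℕ → X → ℝ} {u : X → ℝ} (h : TendstoL1Loc μ V v u)
    (hWV : W ⊆ V) : TendstoL1Loc μ W v u :=
  fun _ hO => h _ (hO.mono hWV)

theorem curveModulus_empty (q : ℝ) (hq : 0 < q) : curveModulus μ q (∅ : Set (Curve X)) = 0 := by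
  refine le_antisymm ?_ bot_le
  refine iInf_le_of_le (fun _ => 0) (iInf_le_of_le measurable_const (iInf_le_of_le (by simp) ?_))
  simp [hq]

theorem UpperGradientOn.isWeakUpperGradient {V : Set X} {u : X → ℝ} {g : X → ℝ≥0∞}
    (h : UpperGradientOn V u g) (hg : Measurable g) : IsWeakUpperGradient μ V u g :=
  ⟨hg.aemeasurable, by rw [h.exceptionalCurves_eq_empty, curveModulus_empty 1 one_pos]⟩

/-- Two corrections suffice: the sum of countably many functions admissible for the exceptional
curves, with summable small integrals, so that it integrates to `∞` along each such curve; and the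
value `∞` on a Borel null set containing the points where `g` differs from its Borel representative.
-/
theorem IsWeakUpperGradient.exists_upperGradientOn [BorelSpace X] {V : Set X} {u : X → ℝ}
    {g : X → ℝ≥0∞} (h : IsWeakUpperGradient μ V u g) {ε : ℝ≥0∞}
    (hε : ε ≠ 0) :
    ∃ g', Measurable g' ∧ UpperGradientOn V u g' ∧
      ∫⁻ x in V, g' x ∂μ ≤ ∫⁻ x in V, g x ∂μ + ε := by
  obtain ⟨hg, hmod⟩ := h
  obtain ⟨e, he, hesum⟩ := ENNReal.exists_pos_sum_of_countable' hε ℕ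
  have hρ : ∀ n, ∃ ρ : X → ℝ≥0∞, Measurable ρ ∧
      (∀ γ ∈ exceptionalCurves V u g, γ.Rectifiable → 1 ≤ γ.integral ρ) ∧ ∫⁻ x, ρ x ∂μ < e n := by
    intro n
    have := he n
    rw [← hmod] at this
    simp only [curveModulus, iInf_lt_iff, ENNReal.rpow_one] at this
    obtain ⟨ρ, h1, h2, h3⟩ := this
    exact ⟨ρ, h1, h2, h3⟩
  choose ρ hρm hρa hρi using hρ
  set N := toMeasurable (μ.restrict V) {x | g x ≠ hg.mk g x} with hN
  have hNm : MeasurableSet N := measurableSet_toMeasurable _ _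
  have hN0 : μ.restrict V N = 0 := by
    rw [hN, measure_toMeasurable]; exact hg.ae_eq_mk
  refine ⟨fun x => hg.mk g x + N.indicator (fun _ => ⊤) x + ∑' n, ρ n x,
    (hg.measurable_mk.add (measurable_const.indicator hNm)).add (.tsum hρm), ?_, ?_⟩
  · intro a b c hab hc hcV
    by_cases hex : lipCurve hab hc ∈ exceptionalCurves V u g
    · refine le_top.trans ?_
      have hcm : AEMeasurable c (volume.restrict (Icc a b)) :=
        hc.continuousOn.aemeasurable measurableSet_Icc
      calc (⊤ : ℝ≥0∞) = ∑' _ : ℕ, (1 : ℝ≥0∞) :=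
            (ENNReal.tsum_const_eq_top_of_ne_zero one_ne_zero).symm
        _ ≤ ∑' n, ∫⁻ s in Icc a b, ρ n (c s) := ENNReal.tsum_le_tsum fun n =>
            (hρa n _ hex (rectifiable_lipCurve hab hc)).trans (integral_lipCurve_le hab hc _)
        _ = ∫⁻ s in Icc a b, ∑' n, ρ n (c s) :=
            (lintegral_tsum fun n => (hρm n).comp_aemeasurable hcm).symm
        _ ≤ _ := lintegral_mono fun s => le_add_self
    · have : edist (u (c a)) (u (c b)) ≤ (lipCurve hab hc).integral g := by
        by_contra hcon
        exact hex ⟨rectifiable_lipCurve hab hc, fun t ht => hcV ht, hcon⟩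
      refine this.trans ((integral_lipCurve_le hab hc g).trans (lintegral_mono fun s => ?_))
      by_cases hs : g (c s) = hg.mk g (c s)
      · rw [hs]; exact le_self_add.trans le_self_add
      · have : c s ∈ N := subset_toMeasurable _ _ hs
        simp [this]
  · rw [lintegral_add_right _ (.tsum hρm), lintegral_add_left hg.measurable_mk,
      lintegral_indicator_const hNm, hN0, mul_zero, add_zero,
      lintegral_tsum fun n => (hρm n).aemeasurable, ← lintegral_congr_ae hg.ae_eq_mk]
    gcongr
    refine (ENNReal.tsum_le_tsum fun n => ?_).trans hesum.le
    exact (setLIntegral_le_lintegral _ _).trans (hρi n).le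

/-- A sequence of locally Lipschitz functions converging to `u`, with Borel upper gradients. -/
structure IsApproximation (μ : Measure X) (V : Set X) (u : X → ℝ) (v : ℕ → X → ℝ)
    (g : ℕ → X → ℝ≥0∞) : Prop where
  lipLoc : ∀ n, LipLoc V (v n)
  tendsto : TendstoL1Loc μ V v u
  measurable : ∀ n, Measurable (g n)
  upperGradientOn : ∀ n, UpperGradientOn V (v n) (g n)

theorem IsApproximation.mono {V W : Set X} {u : X → ℝ} {v : ℕ → X → ℝ} {g : ℕ → X → ℝ≥0∞}
    (h : IsApproximation μ V u v g) (hWV : W ⊆ V) : IsApproximation μ W u v g :=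
  ⟨fun n => (h.lipLoc n).mono hWV, h.tendsto.mono hWV, h.measurable,
    fun n => (h.upperGradientOn n).mono hWV fun _ _ => le_rfl⟩

theorem IsApproximation.totalVariation_le_liminf {V : Set X} {u : X → ℝ} {v : ℕ → X → ℝ}
    {g : ℕ → X → ℝ≥0∞} (h : IsApproximation μ V u v g) :
    totalVariation μ u V ≤ liminf (fun n => ∫⁻ x in V, g n x ∂μ) atTop :=
  iInf_le_of_le v <| iInf_le_of_le g <| iInf_le_of_le h.lipLoc <| iInf_le_of_le h.tendsto <|
    iInf_le_of_le (fun n => (h.upperGradientOn n).isWeakUpperGradient (h.measurable n)) le_rfl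

theorem IsApproximation.totalVariation_le {V : Set X} {u : X → ℝ} {v : ℕ → X → ℝ}
    {g : ℕ → X → ℝ≥0∞} (h : IsApproximation μ V u v g) {c : ℝ≥0∞}
    (hc : ∀ n, ∫⁻ x in V, g n x ∂μ ≤ c) : totalVariation μ u V ≤ c :=
  h.totalVariation_le_liminf.trans <|
    (liminf_le_liminf (Eventually.of_forall hc)).trans (liminf_const c).le

theorem exists_isApproximation [BorelSpace X] {V : Set X} {u : X → ℝ} {c : ℝ≥0∞}
    (h : totalVariation μ u V < c) :
    ∃ v g, IsApproximation μ V u v g ∧ ∀ n, ∫⁻ x in V, g n x ∂μ ≤ c := by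
  simp only [totalVariation, iInf_lt_iff] at h
  obtain ⟨v, g, hv, hvu, hg, hlt⟩ := h
  obtain ⟨φ, hφ, hφlt⟩ := extraction_of_frequently_atTop (frequently_lt_of_liminf_lt
    (by isBoundedDefault) hlt)
  -- The gap between the energy and `c` pays for the passage to genuine upper gradients.
  have := fun n => (hg (φ n)).exists_upperGradientOn
    (tsub_pos_of_lt (hφlt n)).ne'
  choose g' hg'm hg'u hg'i using this
  refine ⟨fun n => v (φ n), g', ⟨fun n => hv _, fun O hO => (hvu O hO).comp hφ.tendsto_atTop,
    hg'm, hg'u⟩, fun n => (hg'i n).trans ?_⟩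
  rw [add_tsub_cancel_of_le (hφlt n).le]

theorem totalVariation_mono [BorelSpace X] {V W : Set X} (hWV : W ⊆ V)
    (u : X → ℝ) : totalVariation μ u W ≤ totalVariation μ u V := by
  refine le_of_forall_gt fun c hc => ?_
  obtain ⟨d, hd, hdc⟩ := exists_between hc
  obtain ⟨v, g, h, hle⟩ := exists_isApproximation hd
  refine ((h.mono hWV).totalVariation_le fun n => ?_).trans_lt hdc
  exact (lintegral_mono_set hWV).trans (hle n)

theorem totalVariation_empty (u : X → ℝ) : totalVariation μ u ∅ = 0 := by
  refine le_antisymm ?_ bot_le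
  refine IsApproximation.totalVariation_le (v := fun _ _ => 0) (g := fun _ _ => 0) (u := u)
    ⟨fun n => LocallyLipschitzOn.lipLoc (by simp), fun O hO => ?_, fun n => measurable_const,
      fun n a b c hab _ hc => (hc (left_mem_Icc.2 hab)).elim⟩ (by simp)
  have : O = ∅ := subset_empty_iff.1 (subset_closure.trans hO.2.2)
  simp [this]

/-- One approximating sequence on `V` serves for both disjoint pieces, and liminf is superadditive.
-/
theorem totalVariation_add_le [BorelSpace X] {A B V : Set X} (hA : IsOpen A)
    (hAV : A ⊆ V) (hBV : B ⊆ V) (hAB : Disjoint A B) (u : X → ℝ) :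
    totalVariation μ u A + totalVariation μ u B ≤ totalVariation μ u V := by
  refine le_of_forall_gt fun c hc => ?_
  obtain ⟨d, hd, hdc⟩ := exists_between hc
  obtain ⟨v, g, h, hle⟩ := exists_isApproximation hd
  refine lt_of_le_of_lt ?_ hdc
  refine (add_le_add (h.mono hAV).totalVariation_le_liminf
    (h.mono hBV).totalVariation_le_liminf).trans ?_
  refine (liminf_add_liminf_le _ _).trans ?_
  refine (liminf_le_liminf (Eventually.of_forall fun n => ?_)).trans (liminf_const d).le
  rw [add_comm, ← lintegral_union hA.measurableSet hAB.symm]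
  exact (lintegral_mono_set (union_subset hBV hAV)).trans (hle n)

end TotalVariation

/-! ### Gluing locally Lipschitz functions and their upper gradients -/

section Gluing
variable {X : Type*} [MetricSpace X]

theorem locallyLipschitzOn_of_local {V : Set X} {v : X → ℝ}
    (h : ∀ x ∈ V, ∃ O, IsOpen O ∧ x ∈ O ∧ LocallyLipschitzOn O v) : LocallyLipschitzOn V v := by
  intro x hx
  obtain ⟨O, hO, hxO, hv⟩ := h x hx
  obtain ⟨K, t, ht, hK⟩ := hv hxO
  rw [hO.nhdsWithin_eq hxO] at ht
  exact ⟨K, t, mem_nhdsWithin_of_mem_nhds ht, hK⟩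

theorem _root_.LocallyLipschitzOn.congr_of_eqOn {V : Set X} {u v : X → ℝ}
    (hu : LocallyLipschitzOn V u) (h : EqOn u v V) : LocallyLipschitzOn V v := by
  intro x hx
  obtain ⟨K, t, ht, hK⟩ := hu hx
  refine ⟨K, t ∩ V, inter_mem ht self_mem_nhdsWithin, fun y hy z hz => ?_⟩
  rw [← h hy.2, ← h hz.2]
  exact hK hy.1 hz.1

theorem _root_.LocallyLipschitzOn.lipschitz_mul {V : Set X} {w ζ : X → ℝ} {L : ℝ≥0}
    (hw : LocallyLipschitzOn V w) (hζ : LipschitzWith L ζ) (h0 : ∀ x, |ζ x| ≤ 1) :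
    LocallyLipschitzOn V (fun x => ζ x * w x) := by
  intro x hx
  obtain ⟨K, t, ht, hK⟩ := hw hx
  have hb : {y | |w y| < |w x| + 1} ∈ 𝓝[V] x :=
    (hw.continuousOn x hx).abs.eventually (gt_mem_nhds (lt_add_one _))
  refine ⟨K + L * (|w x| + 1).toNNReal, t ∩ {y | |w y| < |w x| + 1}, inter_mem ht hb, ?_⟩
  refine LipschitzOnWith.of_dist_le_mul fun y hy z hz => ?_
  have e1 := hK.dist_le_mul y hy.1 z hz.1
  have e2 := hζ.dist_le_mul y z
  have e3 : |w z| ≤ |w x| + 1 := le_of_lt hz.2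
  rw [NNReal.coe_add, NNReal.coe_mul, Real.coe_toNNReal _ (by positivity)]
  rw [Real.dist_eq] at *
  calc |ζ y * w y - ζ z * w z| = |ζ y * (w y - w z) + (ζ y - ζ z) * w z| := by ring_nf
    _ ≤ |ζ y| * |w y - w z| + |ζ y - ζ z| * |w z| := by
      rw [← abs_mul, ← abs_mul]; exact abs_add_le _ _
    _ ≤ 1 * (K * dist y z) + L * dist y z * (|w x| + 1) := by
      gcongr; exact h0 y
    _ = _ := by ring

theorem _root_.LocallyLipschitzOn.convex_comb {V : Set X} {w w' ζ : X → ℝ} {L : ℝ≥0}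
    (hw : LocallyLipschitzOn V w) (hw' : LocallyLipschitzOn V w') (hζ : LipschitzWith L ζ)
    (h0 : ∀ x, 0 ≤ ζ x) (h1 : ∀ x, ζ x ≤ 1) :
    LocallyLipschitzOn V (fun x => ζ x * w x + (1 - ζ x) * w' x) := by
  have := ((hw.lipschitz_mul hζ fun x => abs_le.2 ⟨by linarith [h0 x], h1 x⟩).add
    (hw'.lipschitz_mul (ζ := fun x => 1 - ζ x) (L := L) ?_ ?_))
  · exact this
  · refine LipschitzWith.of_dist_le_mul fun x y => ?_
    have := hζ.dist_le_mul x y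
    rw [Real.dist_eq] at *
    rw [← abs_neg]; ring_nf at *; exact this
  · exact fun x => abs_le.2 ⟨by linarith [h1 x], by linarith [h0 x]⟩

theorem compactlyInside_of_subset {O Z V : Set X} (hO : IsOpen O) (hZ : IsCompact Z)
    (hOZ : O ⊆ Z) (hZV : Z ⊆ V) : CompactlyInside O V :=
  have h : closure O ⊆ Z := closure_minimal hOZ hZ.isClosed
  ⟨hO, hZ.of_isClosed_subset isClosed_closure h, h.trans hZV⟩

theorem CompactlyInside.subset {O V : Set X} (h : CompactlyInside O V) : O ⊆ V :=
  subset_closure.trans h.2.2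

theorem CompactlyInside.union {O O' V : Set X} (h : CompactlyInside O V)
    (h' : CompactlyInside O' V) : CompactlyInside (O ∪ O') V := by
  refine ⟨h.1.union h'.1, ?_, ?_⟩ <;> rw [closure_union]
  · exact h.2.1.union h'.2.1
  · exact union_subset h.2.2 h'.2.2

/-- The two plateaux matter: a convex combination with weight `ζ` agrees with one of its terms on
the open set `Y` and with the other off the compact set `Z`, so gluing errors live only in between.
-/
theorem exists_cutoff [ProperSpace X] {K V : Set X} (hK : IsCompact K) (hV : IsOpen V)
    (hKV : K ⊆ V) :
    ∃ (ζ : X → ℝ) (L : ℝ≥0) (Y Z : Set X), LipschitzWith L ζ ∧ (∀ x, 0 ≤ ζ x) ∧ (∀ x, ζ x ≤ 1) ∧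
      IsOpen Y ∧ K ⊆ Y ∧ Y ⊆ Z ∧ IsCompact Z ∧ Z ⊆ V ∧ (∀ x ∈ Y, ζ x = 1) ∧
      ∀ x ∉ Z, ζ x = 0 := by
  obtain ⟨δ, hδ, hδV⟩ := hK.exists_cthickening_subset_open hV hKV
  have hδ2 : 0 < δ / 2 := half_pos hδ
  refine ⟨fun x => thickenedIndicator hδ2 (Metric.cthickening (δ / 2) K) x, _,
    Metric.thickening (δ / 2) K, Metric.cthickening δ K,
    fun x y => lipschitzWith_thickenedIndicator hδ2 (Metric.cthickening (δ / 2) K) x y,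
    fun x => NNReal.coe_nonneg _, fun x => thickenedIndicator_le_one _ _ _,
    Metric.isOpen_thickening, Metric.self_subset_thickening hδ2 K,
    (Metric.thickening_subset_cthickening _ _).trans (Metric.cthickening_mono (by linarith) _),
    hK.cthickening, hδV, fun x hx => ?_, fun x hx => ?_⟩
  · simp only
    rw [thickenedIndicator_one hδ2 _ (Metric.thickening_subset_cthickening _ _ hx)]; rfl
  · simp only
    rw [thickenedIndicator_zero hδ2]
    · rfl
    · intro h
      refine hx ?_
      have := Metric.cthickening_cthickening_subset hδ2.le hδ2.le K
        (Metric.thickening_subset_cthickening _ _ h)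
      rwa [add_halves] at this

theorem exists_compactlyInside [ProperSpace X] {K V : Set X} (hK : IsCompact K) (hV : IsOpen V)
    (hKV : K ⊆ V) : ∃ O, K ⊆ O ∧ CompactlyInside O V := by
  obtain ⟨_, _, Y, Z, -, -, -, hY, hKY, hYZ, hZ, hZV, -⟩ := exists_cutoff hK hV hKV
  exact ⟨Y, hKY, compactlyInside_of_subset hY hZ hYZ hZV⟩

theorem enorm_convex_comb_sub_le {z a b u : ℝ} (h0 : 0 ≤ z) (h1 : z ≤ 1) :
    ‖z * a + (1 - z) * b - u‖ₑ ≤ ‖a - u‖ₑ + ‖b - u‖ₑ := by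
  have : z * a + (1 - z) * b - u = z * (a - u) + (1 - z) * (b - u) := by ring
  rw [this]
  refine (enorm_add_le _ _).trans ?_
  rw [enorm_mul, enorm_mul]
  have e1 : ‖z‖ₑ ≤ 1 := by
    rw [Real.enorm_of_nonneg h0]; exact ENNReal.ofReal_le_one.2 h1
  have e2 : ‖1 - z‖ₑ ≤ 1 := by
    rw [Real.enorm_of_nonneg (by linarith)]; exact ENNReal.ofReal_le_one.2 (by linarith)
  exact add_le_add (mul_le_of_le_one_left' e1) (mul_le_of_le_one_left' e2)

theorem enorm_sub_le_add_sub (a b u : ℝ) : ‖a - b‖ₑ ≤ ‖a - u‖ₑ + ‖b - u‖ₑ := by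
  have : a - b = (a - u) - (b - u) := by ring
  rw [this]; exact enorm_sub_le

/-- Gluing of two functions along a transition region. -/
theorem exists_gluing_pair [ProperSpace X] {V₁ V₂ W : Set X} (h₁ : IsOpen V₁) (h₂ : IsOpen V₂)
    (hW : IsCompact (closure W)) (hWV : closure W ⊆ V₁ ∪ V₂) :
    ∃ (C₁ C₂ : Set X) (L : ℝ≥0), CompactlyInside C₁ V₁ ∧ CompactlyInside C₂ V₂ ∧
      ∀ (u w₁ w₂ : X → ℝ) (g : X → ℝ≥0∞), LocallyLipschitzOn V₁ w₁ → LocallyLipschitzOn V₂ w₂ →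
        UpperGradientOn V₁ w₁ g → UpperGradientOn V₂ w₂ g →
        ∃ v : X → ℝ, LocallyLipschitzOn W v ∧
          (∀ x ∈ W, ‖v x - u x‖ₑ ≤ C₁.indicator (fun x => ‖w₁ x - u x‖ₑ) x
            + C₂.indicator (fun x => ‖w₂ x - u x‖ₑ) x) ∧
          UpperGradientOn W v (fun x => g x + L * (C₁.indicator (fun x => ‖w₁ x - u x‖ₑ) x
            + C₂.indicator (fun x => ‖w₂ x - u x‖ₑ) x)) := by
  -- The sets and the constant are fixed before the functions, so that in applications the `L¹`
  -- errors can be made small relative to `L`.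
  obtain ⟨ζ, L, Y, Z, hζ, h0, h1, hY, hKY, hYZ, hZ, hZV, hone, hzero⟩ :=
    exists_cutoff (hW.diff h₂) h₁ (fun x hx => (hWV hx.1).resolve_right hx.2)
  obtain ⟨C₁, hZC, hC₁⟩ := exists_compactlyInside hZ h₁ hZV
  obtain ⟨C₂, hWC, hC₂⟩ := exists_compactlyInside (hW.diff hY) h₂
    (fun x hx => by_contra fun h => hx.2 (hKY ⟨hx.1, h⟩))
  refine ⟨C₁, C₂, L, hC₁, hC₂, fun u w₁ w₂ g l₁ l₂ g₁ g₂ => ?_⟩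
  have e1 : EqOn w₁ (fun x => ζ x * w₁ x + (1 - ζ x) * w₂ x) Y := fun x hx => by
    simp [hone x hx]
  have e2 : EqOn w₂ (fun x => ζ x * w₁ x + (1 - ζ x) * w₂ x) (Zᶜ ∩ C₂) := fun x hx => by
    simp [hzero x hx.1]
  have hY₁ : Y ⊆ V₁ := hYZ.trans hZV
  have hZ₂ : Zᶜ ∩ C₂ ⊆ V₂ := inter_subset_right.trans hC₂.subset
  have hB₁ : C₁ ∩ C₂ ⊆ V₁ := inter_subset_left.trans hC₁.subset
  have hB₂ : C₁ ∩ C₂ ⊆ V₂ := inter_subset_right.trans hC₂.subset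
  -- Three open regions: only `w₁` is used on the first, only `w₂` on the second, and both are
  -- available on the third.
  have cover : ∀ x ∈ W, x ∈ Y ∨ x ∈ Zᶜ ∩ C₂ ∨ x ∈ C₁ ∩ C₂ := fun x hx => by
    by_cases hxY : x ∈ Y
    · exact Or.inl hxY
    · have : x ∈ C₂ := hWC ⟨subset_closure hx, hxY⟩
      by_cases hxZ : x ∈ Z
      · exact Or.inr (Or.inr ⟨hZC hxZ, this⟩)
      · exact Or.inr (Or.inl ⟨hxZ, this⟩)
  refine ⟨fun x => ζ x * w₁ x + (1 - ζ x) * w₂ x, ?_, ?_, ?_⟩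
  · refine locallyLipschitzOn_of_local fun x hx => ?_
    rcases cover x hx with h | h | h
    · exact ⟨_, hY, h, (l₁.mono hY₁).congr_of_eqOn e1⟩
    · exact ⟨_, hZ.isClosed.isOpen_compl.inter hC₂.1, h, (l₂.mono hZ₂).congr_of_eqOn e2⟩
    · exact ⟨_, hC₁.1.inter hC₂.1, h, (l₁.mono hB₁).convex_comb (l₂.mono hB₂) hζ h0 h1⟩
  · intro x hx
    rcases cover x hx with h | h | h
    · simp only [← e1 h, indicator_of_mem (hZC (hYZ h))]; exact le_self_add
    · simp only [← e2 h, indicator_of_mem h.2]; exact le_add_self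
    · simp only [indicator_of_mem h.1, indicator_of_mem h.2]
      exact enorm_convex_comb_sub_le (h0 x) (h1 x)
  · refine UpperGradientOn.of_local fun x hx => ?_
    rcases cover x hx with h | h | h
    · exact ⟨_, hY, h, (g₁.congr_of_subset hY₁ e1).mono le_rfl fun _ _ => le_self_add⟩
    · exact ⟨_, hZ.isClosed.isOpen_compl.inter hC₂.1, h,
        (g₂.congr_of_subset hZ₂ e2).mono le_rfl fun _ _ => le_self_add⟩
    · refine ⟨_, hC₁.1.inter hC₂.1, h, ((g₁.mono hB₁ fun _ _ => le_rfl).convex_comb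
        (g₂.mono hB₂ fun _ _ => le_rfl) (l₁.continuousOn.mono hB₁) (l₂.continuousOn.mono hB₂)
        hζ h0 h1).mono le_rfl fun y hy => ?_⟩
      simp only [indicator_of_mem hy.1, indicator_of_mem hy.2]
      gcongr
      exact enorm_sub_le_add_sub _ _ _

/-- The annular regions of an exhaustion. -/
def annulus (V : ℕ → Set X) : ℕ → Set X
  | 0 => V 1
  | k + 1 => V (k + 2) \ closure (V k)

theorem isOpen_annulus {V : ℕ → Set X} (hV : ∀ k, IsOpen (V k)) : ∀ k, IsOpen (annulus V k)
  | 0 => hV 1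
  | k + 1 => (hV (k + 2)).sdiff isClosed_closure

theorem annulus_subset (V : ℕ → Set X) : ∀ k, annulus V k ⊆ V (k + 1)
  | 0 => le_rfl
  | _ + 1 => sdiff_subset

/-- The function `w k` turns into `w (k + 1)` inside a layer `N k` lying in `V (k + 1) \ closure (V
k)`. The layers are disjoint, so at most two functions meet at a point. Since `C` and `α` depend on
the exhaustion alone, the `w k` can be chosen afterwards, close enough to `u` on `C k` to beat `α
k`. -/
theorem exists_gluing [ProperSpace X] {V : ℕ → Set X} (hVo : ∀ k, IsOpen (V k))
    (hVc : ∀ k, IsCompact (closure (V k))) (hVs : ∀ k, closure (V k) ⊆ V (k + 1)) :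
    ∃ (C : ℕ → Set X) (α : ℕ → ℝ≥0), (∀ k, CompactlyInside (C k) (annulus V k)) ∧
      ∀ (u : X → ℝ) (w : ℕ → X → ℝ) (g : X → ℝ≥0∞),
        (∀ k, LocallyLipschitzOn (annulus V k) (w k)) →
        (∀ k, UpperGradientOn (annulus V k) (w k) g) →
        ∃ v : X → ℝ, LocallyLipschitzOn (⋃ k, V k) v ∧ EqOn v (w 0) (V 0) ∧
          (∀ x ∈ ⋃ k, V k, ‖v x - u x‖ₑ ≤
            ∑' k, (C k).indicator (fun x => ‖w k x - u x‖ₑ) x) ∧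
          UpperGradientOn (⋃ k, V k) v (fun x => g x +
            ∑' k, α k * (C k).indicator (fun x => ‖w k x - u x‖ₑ) x) := by
  have hmono : Monotone V := monotone_nat_of_le_succ fun k => subset_closure.trans (hVs k)
  choose ζ L Y Z hζ h0 h1 hY hKY hYZ hZ hZV hone hzero using
    fun k => exists_cutoff (hVc k) (hVo (k + 1)) (hVs k)
  have hN : ∀ k, ∃ O, Z k \ Y k ⊆ O ∧ CompactlyInside O (V (k + 1) \ closure (V k)) := fun k =>
    exists_compactlyInside ((hZ k).diff (hY k)) ((hVo (k + 1)).sdiff isClosed_closure)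
      fun x hx => ⟨hZV k hx.1, fun h => hx.2 (hKY k h)⟩
  choose N hZN hN using hN
  -- `P k` is the region where `w k` is used alone.
  set P : ℕ → Set X := fun k => Nat.casesOn k (Y 0) fun k => Y (k + 1) \ Z k with hP
  have hPo : ∀ k, IsOpen (P k) := fun k => by
    cases k with
    | zero => exact hY 0
    | succ k => exact (hY (k + 1)).sdiff (hZ k).isClosed
  set C : ℕ → Set X := fun k => Nat.casesOn k (P 0 ∪ N 0) fun k => P (k + 1) ∪ N (k + 1) ∪ N k
    with hC
  have hPC : ∀ k, P k ⊆ C k := fun k => by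
    cases k with
    | zero => exact subset_union_left
    | succ k => exact subset_union_left.trans subset_union_left
  have hNC : ∀ k, N k ⊆ C k := fun k => by
    cases k with
    | zero => exact subset_union_right
    | succ k => exact subset_union_right.trans subset_union_left
  have hNC' : ∀ k, N k ⊆ C (k + 1) := fun k => subset_union_right
  have hCD : ∀ k, CompactlyInside (C k) (annulus V k) := by
    rintro (_ | k)
    · exact (compactlyInside_of_subset (hY 0) (hZ 0) (hYZ 0) (hZV 0)).union
        ((hN 0).mono sdiff_subset)
    · refine ((compactlyInside_of_subset (V := annulus V (k + 1)) (hPo (k + 1)) ((hZ (k + 1)).diff (hY k)) ?_ ?_).union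
        ((hN (k + 1)).mono ?_)).union ((hN k).mono ?_)
      · exact fun x hx => ⟨hYZ _ hx.1, fun h => hx.2 (hYZ _ h)⟩
      · exact fun x hx => ⟨hZV _ hx.1, fun h => hx.2 (hKY _ h)⟩
      · exact fun x hx => ⟨hx.1, fun h => hx.2 (subset_closure (hVs _ h))⟩
      · exact fun x hx => ⟨hmono (Nat.le_succ _) hx.1, hx.2⟩
  set α : ℕ → ℝ≥0 := fun k => Nat.casesOn k (L 0) fun k => L (k + 1) + L k with hα
  have hLα : ∀ k, L k ≤ α k := by
    rintro (_ | k)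
    · exact le_rfl
    · exact le_self_add
  have hLα' : ∀ k, L k ≤ α (k + 1) := fun k => le_add_self
  refine ⟨C, α, hCD, fun u w g hwl hwg => ?_⟩
  -- The index selects which interpolation formula is read at a point. On `P (k + 1)` it may be `k`
  -- or `k + 1`, but both formulas then give `w (k + 1)`, because `ζ k = 0` and `ζ (k + 1) = 1`
  -- there.
  set idx : X → ℕ := fun x => sInf {k | x ∈ V (k + 1)} with hidx
  have idx_eq : ∀ x k, x ∈ V (k + 1) → (∀ j < k, x ∉ V (j + 1)) → idx x = k := fun x k hx hj =>
    le_antisymm (Nat.sInf_le hx) (le_of_not_gt fun h =>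
      hj _ h (Nat.sInf_mem (s := {k | x ∈ V (k + 1)}) ⟨k, hx⟩))
  set f : ℕ → X → ℝ := fun k x => ζ k x * w k x + (1 - ζ k x) * w (k + 1) x with hf
  set v : X → ℝ := fun x => f (idx x) x with hv
  have hvN : ∀ k, EqOn (f k) v (N k) := fun k x hx => by
    have hx' := (hN k).subset hx
    have : idx x = k := idx_eq x k hx'.1 fun j hj h =>
      hx'.2 (subset_closure (hmono (Nat.succ_le_of_lt hj) h))
    simp only [hv, this]
  have hvP : ∀ k, EqOn (w k) v (P k) := fun k x hx => by
    cases k with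
    | zero =>
      have : idx x = 0 := idx_eq x 0 (hZV 0 (hYZ 0 hx)) (by simp)
      simp only [hv, this, hf, hone 0 x hx]; ring
    | succ k =>
      have hxk : x ∉ V k := fun h => hx.2 (hYZ k (hKY k (subset_closure h)))
      by_cases hxV : x ∈ V (k + 1)
      · have : idx x = k := idx_eq x k hxV fun j hj h => hxk (hmono (Nat.succ_le_of_lt hj) h)
        simp only [hv, this, hf, hzero k x hx.2]; ring
      · have : idx x = k + 1 := idx_eq x _ (hZV _ (hYZ _ hx.1)) fun j hj h =>
          hxV (hmono (Nat.succ_le_of_lt hj) h)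
        simp only [hv, this, hf, hone _ x hx.1]; ring
  -- Take the least `k` with `x ∈ Y k`: either `x` lies in the preceding transition layer, or it is
  -- already past it.
  have cover : ∀ x ∈ ⋃ k, V k, ∃ k, x ∈ P k ∨ x ∈ N k := fun x hx => by
    classical
    obtain ⟨k₀, hk₀⟩ := mem_iUnion.1 hx
    have hex : ∃ k, x ∈ Y k := ⟨k₀, hKY _ (subset_closure hk₀)⟩
    obtain ⟨k, hk, hmin⟩ : ∃ k, x ∈ Y k ∧ ∀ j < k, x ∉ Y j :=
      ⟨Nat.find hex, Nat.find_spec hex, fun j hj => Nat.find_min hex hj⟩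
    cases k with
    | zero => exact ⟨0, Or.inl hk⟩
    | succ k =>
      by_cases hxZ : x ∈ Z k
      · exact ⟨k, Or.inr (hZN k ⟨hxZ, hmin k k.lt_succ_self⟩)⟩
      · exact ⟨k + 1, Or.inl ⟨hk, hxZ⟩⟩
  have hPD : ∀ k, P k ⊆ annulus V k := fun k => (hPC k).trans (hCD k).subset
  have hND : ∀ k, N k ⊆ annulus V k := fun k => (hNC k).trans (hCD k).subset
  have hND' : ∀ k, N k ⊆ annulus V (k + 1) := fun k => (hNC' k).trans (hCD (k + 1)).subset
  refine ⟨v, ?_, ?_, ?_, ?_⟩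
  · refine locallyLipschitzOn_of_local fun x hx => ?_
    obtain ⟨k, h | h⟩ := cover x hx
    · exact ⟨_, hPo k, h, ((hwl k).mono (hPD k)).congr_of_eqOn (hvP k)⟩
    · exact ⟨_, (hN k).1, h, (((hwl k).mono (hND k)).convex_comb ((hwl (k + 1)).mono (hND' k))
        (hζ k) (h0 k) (h1 k)).congr_of_eqOn (hvN k)⟩
  · exact fun x hx => (hvP 0 (hKY 0 (subset_closure hx))).symm
  · intro x hx
    obtain ⟨k, h | h⟩ := cover x hx
    · rw [← hvP k h]
      refine le_trans ?_ (ENNReal.le_tsum k)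
      rw [indicator_of_mem (hPC k h)]
    · rw [← hvN k h]
      refine le_trans ?_ (ENNReal.sum_le_tsum {k, k + 1})
      rw [Finset.sum_pair (by simp), indicator_of_mem (hNC k h), indicator_of_mem (hNC' k h)]
      exact enorm_convex_comb_sub_le (h0 k x) (h1 k x)
  · refine UpperGradientOn.of_local fun x hx => ?_
    obtain ⟨k, h | h⟩ := cover x hx
    · exact ⟨_, hPo k, h, ((hwg k).congr_of_subset (hPD k) (hvP k)).mono le_rfl
        fun _ _ => le_self_add⟩
    · refine ⟨_, (hN k).1, h, ((((hwg k).mono (hND k) fun _ _ => le_rfl).convex_comb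
        ((hwg (k + 1)).mono (hND' k) fun _ _ => le_rfl) ((hwl k).continuousOn.mono (hND k))
        ((hwl (k + 1)).continuousOn.mono (hND' k)) (hζ k) (h0 k) (h1 k)).congr (hvN k)).mono
        le_rfl fun y hy => ?_⟩
      gcongr
      refine le_trans ?_ (ENNReal.sum_le_tsum {k, k + 1})
      rw [Finset.sum_pair (by simp), indicator_of_mem (hNC k hy), indicator_of_mem (hNC' k hy)]
      calc (L k : ℝ≥0∞) * ‖w k y - w (k + 1) y‖ₑ
          ≤ L k * (‖w k y - u y‖ₑ + ‖w (k + 1) y - u y‖ₑ) := by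
            gcongr; exact enorm_sub_le_add_sub _ _ _
        _ ≤ _ := by
            rw [mul_add]
            gcongr
            · exact hLα k
            · exact hLα' k

end Gluing

/-! ### The perimeter is a Borel measure -/

section Perimeter
variable {X : Type*} [MetricSpace X]

theorem exists_exhaustion [ProperSpace X] [Nonempty X] {V : Set X} (hV : IsOpen V) :
    ∃ W : ℕ → Set X, (∀ k, IsOpen (W k)) ∧ (∀ k, IsCompact (closure (W k))) ∧
      (∀ k, closure (W k) ⊆ W (k + 1)) ∧ ⋃ k, W k = V := by
  obtain ⟨x₀⟩ := ‹Nonempty X›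
  have hd : Continuous fun x => Metric.infEDist x Vᶜ := Metric.continuous_infEDist
  have hsub : ∀ k : ℕ, closure {x | dist x x₀ < k ∧ ((k : ℝ≥0∞) + 1)⁻¹ < Metric.infEDist x Vᶜ} ⊆
      {x | dist x x₀ ≤ k ∧ ((k : ℝ≥0∞) + 1)⁻¹ ≤ Metric.infEDist x Vᶜ} := fun k =>
    closure_minimal (fun x hx => ⟨hx.1.le, hx.2.le⟩)
      ((Metric.isClosed_closedBall (x := x₀) (ε := k)).inter (isClosed_le continuous_const hd))
  refine ⟨fun k => {x | dist x x₀ < k ∧ ((k : ℝ≥0∞) + 1)⁻¹ < Metric.infEDist x Vᶜ},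
    fun k => (Metric.isOpen_ball (x := x₀) (ε := k)).inter (isOpen_lt continuous_const hd),
    fun k => (isCompact_closedBall x₀ k).of_isClosed_subset isClosed_closure
      fun x hx => (hsub k hx).1, fun k x hx => ?_, ?_⟩
  · have := hsub k hx
    refine ⟨this.1.trans_lt (by push_cast; linarith), lt_of_lt_of_le ?_ this.2⟩
    refine ENNReal.inv_lt_inv.2 ?_
    norm_cast
    omega
  · refine Subset.antisymm (iUnion_subset fun k x hx => ?_) fun x hx => ?_
    · by_contra h
      have : Metric.infEDist x Vᶜ = 0 := Metric.infEDist_zero_of_mem h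
      simp [this] at hx
    · have hpos : Metric.infEDist x Vᶜ ≠ 0 := fun h => by
        rw [← Metric.mem_closure_iff_infEDist_zero, hV.isClosed_compl.closure_eq] at h
        exact h hx
      obtain ⟨n, hn⟩ := ENNReal.exists_inv_nat_lt hpos
      obtain ⟨m, hm⟩ := exists_nat_gt (dist x x₀)
      refine mem_iUnion.2 ⟨max n m, hm.trans_le (by simp), lt_of_le_of_lt ?_ hn⟩
      refine ENNReal.inv_le_inv.2 ?_
      norm_cast
      exact (le_max_left n m).trans (Nat.le_succ _)

theorem exists_subset_of_isCompact {W : ℕ → Set X} (hW : ∀ k, IsOpen (W k)) (hm : Monotone W)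
    {K : Set X} (hK : IsCompact K) (hKW : K ⊆ ⋃ k, W k) : ∃ k, K ⊆ W k :=
  hK.elim_directed_cover W hW hKW hm.directed_le

variable [MeasurableSpace X] {μ : Measure X}

theorem measurable_indicator_enorm_sub [BorelSpace X] {C : Set X} {w u : X → ℝ}
    (hC : MeasurableSet C) (hw : ContinuousOn w C) (hu : Measurable u) :
    Measurable (C.indicator fun x => ‖w x - u x‖ₑ) := by
  have h : Measurable (C.indicator w) := by
    classical
    rw [← piecewise_eq_indicator]
    exact hw.measurable_piecewise continuousOn_const hC
  have : (C.indicator fun x => ‖w x - u x‖ₑ) = C.indicator fun x => ‖C.indicator w x - u x‖ₑ := by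
    ext x
    by_cases hx : x ∈ C <;> simp [hx]
  rw [this]
  exact (h.sub hu).enorm.indicator hC

/-- Annuli whose indices have the same parity are disjoint, so superadditivity bounds each of the
two subseries by `M`. -/
theorem sum_totalVariation_annulus_le [BorelSpace X] {V : ℕ → Set X} (hVo : ∀ k, IsOpen (V k))
    (hVs : ∀ k, closure (V k) ⊆ V (k + 1)) {u : X → ℝ} {M : ℝ≥0∞}
    (hM : ∀ k, totalVariation μ u (V k) ≤ M) :
    ∑' k, totalVariation μ u (annulus V k) ≤ M + M := by
  have hs : ∀ k, V k ⊆ V (k + 1) := fun k => subset_closure.trans (hVs k)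
  have hstep : ∀ k, totalVariation μ u (V k) + totalVariation μ u (annulus V (k + 1)) ≤
      totalVariation μ u (V (k + 2)) := fun k =>
    totalVariation_add_le (hVo k) ((hs k).trans (hs (k + 1))) sdiff_subset
      (disjoint_left.2 fun x hx hx' => hx'.2 (subset_closure hx)) u
  have hodd : ∀ n, ∑ i ∈ Finset.range n, totalVariation μ u (annulus V (2 * i + 1)) ≤
      totalVariation μ u (V (2 * n)) := fun n => by
    induction n with
    | zero => simp
    | succ n ih =>
      rw [Finset.sum_range_succ]
      exact (add_le_add ih le_rfl).trans (hstep (2 * n))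
  have heven : ∀ n, ∑ i ∈ Finset.range (n + 1), totalVariation μ u (annulus V (2 * i)) ≤
      totalVariation μ u (V (2 * n + 1)) := fun n => by
    induction n with
    | zero => simp [annulus]
    | succ n ih =>
      rw [Finset.sum_range_succ]
      exact (add_le_add ih le_rfl).trans (hstep (2 * n + 1))
  rw [← tsum_even_add_odd ENNReal.summable ENNReal.summable]
  refine add_le_add ?_ ?_
  · rw [ENNReal.tsum_eq_iSup_nat' (tendsto_add_atTop_nat 1)]
    exact iSup_le fun n => (heven n).trans (hM _)
  · rw [ENNReal.tsum_eq_iSup_nat]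
    exact iSup_le fun n => (hodd n).trans (hM _)

/-- Inner regularity of the total variation along an exhaustion. -/
theorem totalVariation_iUnion_le_of_exhaustion [BorelSpace X] [ProperSpace X] {V : ℕ → Set X}
    (hVo : ∀ k, IsOpen (V k)) (hVc : ∀ k, IsCompact (closure (V k)))
    (hVs : ∀ k, closure (V k) ⊆ V (k + 1)) {u : X → ℝ} (hu : Measurable u) {M : ℝ≥0∞}
    (hM : ∀ k, totalVariation μ u (V k) ≤ M) : totalVariation μ u (⋃ k, V k) ≤ M := by
  rcases eq_or_ne M ⊤ with rfl | hMtop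
  · exact le_top
  refine ENNReal.le_of_forall_pos_le_add fun ε' hε' _ => ?_
  obtain ⟨ε, hε, hεε'⟩ : ∃ ε : ℝ≥0, 0 < ε ∧ (ε : ℝ≥0∞) + ε + ε ≤ ε' := by
    refine ⟨ε' / 3, by positivity, ?_⟩
    norm_cast
    rw [← NNReal.coe_le_coe]; push_cast; linarith
  refine le_trans ?_ (add_le_add le_rfl hεε')
  have hε0 : (ε : ℝ≥0∞) ≠ 0 := by exact_mod_cast hε.ne'
  have hfin : ∑' k, totalVariation μ u (annulus V k) ≠ ⊤ :=
    ((sum_totalVariation_annulus_le hVo hVs hM).trans_lt (by simp [hMtop.lt_top])).ne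
  -- Starting the exhaustion at a late index makes all annuli but the first contribute less than `ε`
  -- in total; the first one is a set `V (1 + m)` and contributes at most `M`.
  obtain ⟨m, hm⟩ := ((ENNReal.tendsto_sum_nat_add _ hfin).eventually
    (gt_mem_nhds (pos_iff_ne_zero.2 hε0))).exists
  set V' : ℕ → Set X := fun k => V (k + m) with hV'
  have hV'o : ∀ k, IsOpen (V' k) := fun k => hVo _
  have hV's : ∀ k, closure (V' k) ⊆ V' (k + 1) := fun k => by
    have := hVs (k + m)
    rwa [show k + m + 1 = k + 1 + m by ring] at this
  have hmono : Monotone V := monotone_nat_of_le_succ fun k => subset_closure.trans (hVs k)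
  have hUnion : ⋃ k, V' k = ⋃ k, V k := Subset.antisymm
    (iUnion_subset fun k => subset_iUnion V _)
    (iUnion_subset fun k => (hmono (Nat.le_add_right k m)).trans (subset_iUnion V' k))
  have hT : ∑' k, totalVariation μ u (annulus V' k) ≤ M + ε := by
    rw [tsum_eq_zero_add' ENNReal.summable]
    refine add_le_add (hM (1 + m)) (le_trans ?_ hm.le)
    refine le_trans (le_of_eq ?_) (ENNReal.tsum_comp_le_tsum_of_injective
      (f := fun k : ℕ => k + 1) (add_left_injective 1) _)
    refine tsum_congr fun k => ?_
    have h1 : annulus V (k + 1 + m) = annulus V' (k + 1) := by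
      rw [show k + 1 + m = (k + m) + 1 by ring]
      simp only [annulus, hV']
      rw [show k + 2 + m = k + m + 2 by ring]
    rw [h1]
  have hTfin : ∀ k, totalVariation μ u (annulus V' k) ≠ ⊤ := fun k =>
    ((ENNReal.le_tsum k).trans_lt (hT.trans_lt (by simp [hMtop.lt_top]))).ne
  obtain ⟨δ, hδ, hδsum⟩ := ENNReal.exists_pos_sum_of_countable' hε0 ℕ
  obtain ⟨C, α, hC, hglue⟩ := exists_gluing hV'o (fun k => hVc _) hV's
  have happ := fun k => exists_isApproximation (μ := μ) (V := annulus V' k) (u := u)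
    (ENNReal.lt_add_right (hTfin k) (hδ k).ne')
  choose v g hvg hg using happ
  -- Dividing by `α k + 1` beats the gluing constant (the `+ 1` prevents division by zero), and
  -- dividing by `N + 1` makes the glued functions converge as `N → ∞`.
  have hpick : ∀ N k : ℕ, ∃ n, ∫⁻ x in C k, ‖v k n x - u x‖ₑ ∂μ ≤
      δ k / (α k + 1) / (N + 1) := fun N k => by
    have hpos : 0 < δ k / (α k + 1) / (N + 1) :=
      ENNReal.div_pos (ENNReal.div_pos (hδ k).ne' (by finiteness)).ne' (by finiteness)
    exact (((hvg k).tendsto (C k) (hC k)).eventually (ge_mem_nhds hpos)).exists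
  choose n hn using hpick
  have hwl : ∀ N k, LocallyLipschitzOn (annulus V' k) (v k (n N k)) := fun N k =>
    ((hvg k).lipLoc _).locallyLipschitzOn (isOpen_annulus hV'o k)
  have hglued := fun N => hglue u (fun k => v k (n N k))
    (fun x => ∑' k, (annulus V' k).indicator (g k (n N k)) x) (hwl N)
    (fun k => ((hvg k).upperGradientOn _).mono le_rfl fun x hx => by
      refine le_trans ?_ (ENNReal.le_tsum k)
      rw [indicator_of_mem hx])
  choose z hzl _ hzu hzg using hglued
  have hCm : ∀ N k, Measurable ((C k).indicator fun x => ‖v k (n N k) x - u x‖ₑ) := fun N k =>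
    measurable_indicator_enorm_sub (hC k).1.measurableSet
      ((hwl N k).continuousOn.mono (hC k).subset) hu
  have hgm : ∀ N k, Measurable ((annulus V' k).indicator (g k (n N k))) := fun N k =>
    ((hvg k).measurable _).indicator (isOpen_annulus hV'o k).measurableSet
  have hCi : ∀ N k, ∫⁻ x, (C k).indicator (fun x => ‖v k (n N k) x - u x‖ₑ) x ∂μ ≤
      δ k / (α k + 1) / (N + 1) := fun N k => by
    rw [lintegral_indicator (hC k).1.measurableSet]; exact hn N k
  rw [← hUnion]
  refine IsApproximation.totalVariation_le (v := z) (g := fun N x =>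
    ∑' k, (annulus V' k).indicator (g k (n N k)) x +
      ∑' k, α k * (C k).indicator (fun x => ‖v k (n N k) x - u x‖ₑ) x)
    ⟨fun N => (hzl N).lipLoc, fun O hO => ?_,
      fun N => (Measurable.tsum (hgm N)).add
        (Measurable.tsum fun k => (hCm N k).const_mul _), hzg⟩ fun N => ?_
  · have hb : ∀ N : ℕ, ∫⁻ x in O, ‖z N x - u x‖ₑ ∂μ ≤ ε / (N + 1 : ℕ) := fun N => by
      calc ∫⁻ x in O, ‖z N x - u x‖ₑ ∂μ
          ≤ ∫⁻ x in O, ∑' k, (C k).indicator (fun x => ‖v k (n N k) x - u x‖ₑ) x ∂μ :=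
            setLIntegral_mono' hO.1.measurableSet fun x hx => hzu N x (hO.subset hx)
        _ ≤ ∫⁻ x, ∑' k, (C k).indicator (fun x => ‖v k (n N k) x - u x‖ₑ) x ∂μ :=
            setLIntegral_le_lintegral _ _
        _ = ∑' k, ∫⁻ x, (C k).indicator (fun x => ‖v k (n N k) x - u x‖ₑ) x ∂μ :=
            lintegral_tsum fun k => (hCm N k).aemeasurable
        _ ≤ ∑' k, δ k * (N + 1 : ℝ≥0∞)⁻¹ := ENNReal.tsum_le_tsum fun k => by
            refine (hCi N k).trans ?_
            rw [← div_eq_mul_inv]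
            gcongr
            exact ENNReal.div_le_of_le_mul (le_mul_of_one_le_right' le_add_self)
        _ ≤ ε / (N + 1 : ℕ) := by
            rw [ENNReal.tsum_mul_right, div_eq_mul_inv]
            push_cast
            gcongr
    refine tendsto_of_tendsto_of_tendsto_of_le_of_le tendsto_const_nhds ?_ (fun _ => bot_le) hb
    have := ENNReal.Tendsto.const_div (a := (ε : ℝ≥0∞)) ENNReal.tendsto_nat_nhds_top
      (Or.inr ENNReal.coe_ne_top)
    rw [ENNReal.div_top] at this
    exact this.comp (tendsto_add_atTop_nat 1)
  · refine (setLIntegral_le_lintegral _ _).trans ?_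
    rw [lintegral_add_left (Measurable.tsum (hgm N)), lintegral_tsum fun k => (hgm N k).aemeasurable,
      lintegral_tsum fun k => ((hCm N k).const_mul _).aemeasurable]
    calc _ ≤ ∑' k, (totalVariation μ u (annulus V' k) + δ k) + ∑' k, δ k := by
          refine add_le_add (ENNReal.tsum_le_tsum fun k => ?_) (ENNReal.tsum_le_tsum fun k => ?_)
          · rw [lintegral_indicator (isOpen_annulus hV'o k).measurableSet]
            exact hg k _
          · rw [lintegral_const_mul _ (hCm N k)]
            calc α k * ∫⁻ x, (C k).indicator (fun x => ‖v k (n N k) x - u x‖ₑ) x ∂μ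
                ≤ (α k + 1) * (δ k / (α k + 1)) := by
                  gcongr
                  · exact le_self_add
                  · exact (hCi N k).trans
                      (ENNReal.div_le_of_le_mul (le_mul_of_one_le_right' le_add_self))
              _ = δ k := ENNReal.mul_div_cancel (by simp) (by finiteness)
      _ ≤ M + (ε + ε + ε) := by
          rw [ENNReal.tsum_add]
          calc _ ≤ M + ε + ε + ε := by gcongr
            _ = _ := by ring

/-- Approximating sequences on `V₁` and `V₂` are glued. Compactness of `closure W` provides a single
cutoff with constant `L`, and the error, `L` times an `L¹` distance on `C₁` and `C₂`, tends to zero.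
-/
theorem totalVariation_le_add_of_compactlyInside [BorelSpace X] [ProperSpace X] {V₁ V₂ W : Set X}
    (h₁ : IsOpen V₁) (h₂ : IsOpen V₂) (hW : CompactlyInside W (V₁ ∪ V₂)) {u : X → ℝ}
    (hu : Measurable u) :
    totalVariation μ u W ≤ totalVariation μ u V₁ + totalVariation μ u V₂ := by
  by_cases htop : totalVariation μ u V₁ = ⊤ ∨ totalVariation μ u V₂ = ⊤
  · rcases htop with h | h <;> simp [h]
  push Not at htop
  refine ENNReal.le_of_forall_pos_le_add fun ε' hε' _ => ?_
  obtain ⟨ε, hε, hεε'⟩ : ∃ ε : ℝ≥0, 0 < ε ∧ (ε : ℝ≥0∞) + ε ≤ ε' := by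
    refine ⟨ε' / 2, by positivity, ?_⟩
    norm_cast
    rw [add_halves]
  have hε0 : (ε : ℝ≥0∞) ≠ 0 := by exact_mod_cast hε.ne'
  obtain ⟨v₁, g₁, a₁, b₁⟩ := exists_isApproximation (ENNReal.lt_add_right htop.1 hε0)
  obtain ⟨v₂, g₂, a₂, b₂⟩ := exists_isApproximation (ENNReal.lt_add_right htop.2 hε0)
  obtain ⟨C₁, C₂, L, hC₁, hC₂, hglue⟩ := exists_gluing_pair h₁ h₂ hW.2.1 hW.2.2
  have l₁ := fun n => (a₁.lipLoc n).locallyLipschitzOn h₁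
  have l₂ := fun n => (a₂.lipLoc n).locallyLipschitzOn h₂
  have hglued := fun n => hglue u (v₁ n) (v₂ n)
    (fun x => V₁.indicator (g₁ n) x + V₂.indicator (g₂ n) x) (l₁ n) (l₂ n)
    ((a₁.upperGradientOn n).mono le_rfl fun x hx => by
      rw [indicator_of_mem hx]; exact le_self_add)
    ((a₂.upperGradientOn n).mono le_rfl fun x hx => by
      rw [indicator_of_mem hx]; exact le_add_self)
  choose z hzl hzu hzg using hglued
  have m₁ : ∀ n, Measurable (C₁.indicator fun x => ‖v₁ n x - u x‖ₑ) := fun n =>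
    measurable_indicator_enorm_sub hC₁.1.measurableSet
      ((l₁ n).continuousOn.mono hC₁.subset) hu
  have m₂ : ∀ n, Measurable (C₂.indicator fun x => ‖v₂ n x - u x‖ₑ) := fun n =>
    measurable_indicator_enorm_sub hC₂.1.measurableSet
      ((l₂ n).continuousOn.mono hC₂.subset) hu
  have hint : ∀ n, ∫⁻ x, (C₁.indicator (fun x => ‖v₁ n x - u x‖ₑ) x +
      C₂.indicator (fun x => ‖v₂ n x - u x‖ₑ) x) ∂μ =
      ∫⁻ x in C₁, ‖v₁ n x - u x‖ₑ ∂μ + ∫⁻ x in C₂, ‖v₂ n x - u x‖ₑ ∂μ := fun n => by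
    rw [lintegral_add_left (m₁ n), lintegral_indicator hC₁.1.measurableSet,
      lintegral_indicator hC₂.1.measurableSet]
  have herr : Tendsto (fun n => ∫⁻ x, (C₁.indicator (fun x => ‖v₁ n x - u x‖ₑ) x +
      C₂.indicator (fun x => ‖v₂ n x - u x‖ₑ) x) ∂μ) atTop (𝓝 0) := by
    simp only [hint]
    simpa using (a₁.tendsto C₁ hC₁).add (a₂.tendsto C₂ hC₂)
  have m₁₂ : ∀ n, Measurable fun x => C₁.indicator (fun x => ‖v₁ n x - u x‖ₑ) x +
      C₂.indicator (fun x => ‖v₂ n x - u x‖ₑ) x := fun n => (m₁ n).add (m₂ n)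
  have gm : ∀ n, Measurable fun x => V₁.indicator (g₁ n) x + V₂.indicator (g₂ n) x := fun n =>
    ((a₁.measurable n).indicator h₁.measurableSet).add
      ((a₂.measurable n).indicator h₂.measurableSet)
  have happ : IsApproximation μ W u z (fun n x => V₁.indicator (g₁ n) x + V₂.indicator (g₂ n) x +
      L * (C₁.indicator (fun x => ‖v₁ n x - u x‖ₑ) x +
        C₂.indicator (fun x => ‖v₂ n x - u x‖ₑ) x)) :=
    ⟨fun n => (hzl n).lipLoc, fun O hO =>
      tendsto_of_tendsto_of_tendsto_of_le_of_le tendsto_const_nhds herr (fun _ => bot_le) fun n =>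
        (setLIntegral_mono' hO.1.measurableSet fun x hx => hzu n x (hO.subset hx)).trans
          (setLIntegral_le_lintegral _ _),
      fun n => (gm n).add ((m₁₂ n).const_mul _), hzg⟩
  refine happ.totalVariation_le_liminf.trans ?_
  have hle : ∀ n, ∫⁻ x in W, (V₁.indicator (g₁ n) x + V₂.indicator (g₂ n) x +
      L * (C₁.indicator (fun x => ‖v₁ n x - u x‖ₑ) x +
        C₂.indicator (fun x => ‖v₂ n x - u x‖ₑ) x)) ∂μ ≤
      (totalVariation μ u V₁ + ε) + (totalVariation μ u V₂ + ε) +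
        L * ∫⁻ x, (C₁.indicator (fun x => ‖v₁ n x - u x‖ₑ) x +
          C₂.indicator (fun x => ‖v₂ n x - u x‖ₑ) x) ∂μ := fun n => by
    refine (setLIntegral_le_lintegral _ _).trans ?_
    rw [lintegral_add_left (gm n), lintegral_const_mul _ (m₁₂ n),
      lintegral_add_left ((a₁.measurable n).indicator h₁.measurableSet),
      lintegral_indicator h₁.measurableSet, lintegral_indicator h₂.measurableSet]
    gcongr
    · exact b₁ n
    · exact b₂ n
  have hlim := (ENNReal.Tendsto.const_mul (a := (L : ℝ≥0∞)) herr
    (Or.inr ENNReal.coe_ne_top)).const_add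
      ((totalVariation μ u V₁ + ε) + (totalVariation μ u V₂ + ε))
  rw [mul_zero, add_zero] at hlim
  refine (liminf_le_liminf (Eventually.of_forall hle)).trans (hlim.liminf_eq.le.trans ?_)
  calc _ = totalVariation μ u V₁ + totalVariation μ u V₂ + (ε + ε) := by ring
    _ ≤ _ := by gcongr

theorem totalVariation_le_of_compactlyInside [BorelSpace X] [ProperSpace X] [Nonempty X]
    {V : Set X} (hV : IsOpen V) {u : X → ℝ} (hu : Measurable u) {M : ℝ≥0∞}
    (hM : ∀ W, CompactlyInside W V → totalVariation μ u W ≤ M) : totalVariation μ u V ≤ M := by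
  obtain ⟨W, hWo, hWc, hWs, rfl⟩ := exists_exhaustion hV
  exact totalVariation_iUnion_le_of_exhaustion hWo hWc hWs hu fun k =>
    hM _ ⟨hWo k, hWc k, (hWs k).trans (subset_iUnion W _)⟩

theorem totalVariation_union_le [BorelSpace X] [ProperSpace X] [Nonempty X] {V₁ V₂ : Set X}
    (h₁ : IsOpen V₁) (h₂ : IsOpen V₂) {u : X → ℝ} (hu : Measurable u) :
    totalVariation μ u (V₁ ∪ V₂) ≤ totalVariation μ u V₁ + totalVariation μ u V₂ :=
  totalVariation_le_of_compactlyInside (h₁.union h₂) hu fun _ hW =>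
    totalVariation_le_add_of_compactlyInside h₁ h₂ hW hu

theorem totalVariation_biUnion_finset_le [BorelSpace X] [ProperSpace X] [Nonempty X]
    {V : ℕ → Set X} (hV : ∀ i, IsOpen (V i)) {u : X → ℝ} (hu : Measurable u) (s : Finset ℕ) :
    totalVariation μ u (⋃ i ∈ s, V i) ≤ ∑ i ∈ s, totalVariation μ u (V i) := by
  classical
  induction s using Finset.induction_on with
  | empty => simp [totalVariation_empty]
  | insert i s his ih =>
    rw [Finset.set_biUnion_insert, Finset.sum_insert his]
    exact (totalVariation_union_le (hV i) (isOpen_biUnion fun i _ => hV i) hu).trans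
      (add_le_add le_rfl ih)

/-- On a compactly contained open set finitely many of the `V i` suffice; inner regularity then
passes to the whole union. -/
theorem totalVariation_iUnion_le [BorelSpace X] [ProperSpace X] [Nonempty X]
    {V : ℕ → Set X} (hV : ∀ i, IsOpen (V i)) {u : X → ℝ} (hu : Measurable u) :
    totalVariation μ u (⋃ i, V i) ≤ ∑' i, totalVariation μ u (V i) := by
  refine totalVariation_le_of_compactlyInside (isOpen_iUnion hV) hu fun W hW => ?_
  obtain ⟨s, hs⟩ := hW.2.1.elim_finite_subcover V hV hW.2.2
  exact (totalVariation_mono (subset_closure.trans hs) u).trans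
    ((totalVariation_biUnion_finset_le hV hu s).trans (ENNReal.sum_le_tsum s))

theorem perimeter_of_isOpen [BorelSpace X] {U V : Set X} (hV : IsOpen V) :
    perimeter μ U V = totalVariation μ (U.indicator fun _ => (1 : ℝ)) V :=
  le_antisymm (iInf_le_of_le V (iInf_le_of_le hV (iInf_le_of_le le_rfl le_rfl)))
    (le_iInf fun _ => le_iInf fun _ => le_iInf fun h => totalVariation_mono h _)

theorem perimeter_mono {U A B : Set X} (h : A ⊆ B) : perimeter μ U A ≤ perimeter μ U B :=
  le_iInf fun V => le_iInf fun hV => le_iInf fun hBV =>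
    iInf_le_of_le V (iInf_le_of_le hV (iInf_le_of_le (h.trans hBV) le_rfl))

theorem exists_isOpen_totalVariation_lt {U A : Set X} {c : ℝ≥0∞} (h : perimeter μ U A < c) :
    ∃ V, IsOpen V ∧ A ⊆ V ∧ totalVariation μ (U.indicator fun _ => (1 : ℝ)) V < c := by
  simp only [perimeter, iInf_lt_iff] at h
  obtain ⟨V, hV, hAV, hlt⟩ := h
  exact ⟨V, hV, hAV, hlt⟩

theorem perimeter_iUnion_le [BorelSpace X] [ProperSpace X] [Nonempty X] {U : Set X}
    (hU : MeasurableSet U) (A : ℕ → Set X) :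
    perimeter μ U (⋃ i, A i) ≤ ∑' i, perimeter μ U (A i) := by
  refine ENNReal.le_of_forall_pos_le_add fun ε hε hfin => ?_
  obtain ⟨δ, hδ, hδsum⟩ := ENNReal.exists_pos_sum_of_countable'
    (ε := (ε : ℝ≥0∞)) (by exact_mod_cast hε.ne') ℕ
  have hA : ∀ i, perimeter μ U (A i) ≠ ⊤ := fun i => ((ENNReal.le_tsum i).trans_lt hfin).ne
  choose V hV hAV hlt using fun i =>
    exists_isOpen_totalVariation_lt (ENNReal.lt_add_right (hA i) (hδ i).ne')
  calc perimeter μ U (⋃ i, A i) ≤ perimeter μ U (⋃ i, V i) := perimeter_mono (iUnion_mono hAV)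
    _ = totalVariation μ _ (⋃ i, V i) := perimeter_of_isOpen (isOpen_iUnion hV)
    _ ≤ ∑' i, totalVariation μ _ (V i) :=
        totalVariation_iUnion_le hV (measurable_const.indicator hU)
    _ ≤ ∑' i, (perimeter μ U (A i) + δ i) := ENNReal.tsum_le_tsum fun i => (hlt i).le
    _ ≤ _ := by rw [ENNReal.tsum_add]; gcongr

theorem perimeter_add_le_of_areSeparated [BorelSpace X] {U A B : Set X}
    (h : Metric.AreSeparated A B) :
    perimeter μ U A + perimeter μ U B ≤ perimeter μ U (A ∪ B) := by
  obtain ⟨r, hr, hAB⟩ := h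
  -- With `2 δ ≤ r` the open `δ`-neighbourhoods of `A` and `B` are disjoint, so superadditivity on
  -- open sets applies.
  obtain ⟨δ, hδ, hδr⟩ : ∃ δ : ℝ, 0 < δ ∧ ENNReal.ofReal (δ + δ) ≤ r := by
    rcases eq_or_ne r ⊤ with rfl | hrt
    · exact ⟨1, one_pos, le_top⟩
    · refine ⟨r.toReal / 2, half_pos (ENNReal.toReal_pos hr hrt), ?_⟩
      rw [add_halves, ENNReal.ofReal_toReal hrt]
  refine le_iInf fun V => le_iInf fun hV => le_iInf fun hABV => ?_
  have hdisj : Disjoint (V ∩ Metric.thickening δ A) (V ∩ Metric.thickening δ B) := by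
    refine disjoint_left.2 fun x hx hx' => ?_
    obtain ⟨a, ha, hxa⟩ := Metric.mem_thickening_iff.1 hx.2
    obtain ⟨b, hb, hxb⟩ := Metric.mem_thickening_iff.1 hx'.2
    have h1 := hδr.trans (hAB a ha b hb)
    rw [edist_dist, ENNReal.ofReal_le_ofReal_iff dist_nonneg] at h1
    have := dist_triangle_left a b x
    linarith
  have hA : IsOpen (V ∩ Metric.thickening δ A) := hV.inter Metric.isOpen_thickening
  have hB : IsOpen (V ∩ Metric.thickening δ B) := hV.inter Metric.isOpen_thickening
  calc perimeter μ U A + perimeter μ U B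
      ≤ perimeter μ U (V ∩ Metric.thickening δ A) + perimeter μ U (V ∩ Metric.thickening δ B) :=
        add_le_add
          (perimeter_mono fun x hx => ⟨hABV (Or.inl hx), Metric.self_subset_thickening hδ A hx⟩)
          (perimeter_mono fun x hx => ⟨hABV (Or.inr hx), Metric.self_subset_thickening hδ B hx⟩)
    _ ≤ _ := by
        rw [perimeter_of_isOpen hA, perimeter_of_isOpen hB]
        exact totalVariation_add_le hA inter_subset_left inter_subset_left hdisj _

/-- The perimeter of a Borel set is a Borel measure. -/
theorem exists_perimeterMeasure [BorelSpace X] [ProperSpace X] [Nonempty X] {U : Set X}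
    (hU : MeasurableSet U) (Ω : Set X) :
    ∃ ν : Measure X, ∀ A : Set X, MeasurableSet A → ν A = perimeter μ U (Ω ∩ A) := by
  let m : OuterMeasure X :=
    { measureOf := fun A => perimeter μ U (Ω ∩ A)
      empty := by
        rw [inter_empty, perimeter_of_isOpen isOpen_empty, totalVariation_empty]
      mono := fun h => perimeter_mono (inter_subset_inter_right Ω h)
      iUnion_nat := fun A _ => by
        rw [inter_iUnion]; exact perimeter_iUnion_le hU _ }
  -- Additivity on separated sets makes Borel sets Carathéodory measurable.
  have hm : m.IsMetric := fun A B hAB => by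
    refine le_antisymm (measure_union_le A B) ?_
    have : perimeter μ U (Ω ∩ A) + perimeter μ U (Ω ∩ B) ≤ perimeter μ U (Ω ∩ A ∪ Ω ∩ B) := by
      refine perimeter_add_le_of_areSeparated ?_
      obtain ⟨r, hr, h⟩ := hAB
      exact ⟨r, hr, fun x hx y hy => h x hx.2 y hy.2⟩
    rw [← inter_union_distrib_left] at this
    exact this
  exact ⟨m.toMeasure hm.le_caratheodory, fun A hA => toMeasure_apply m _ hA⟩

end Perimeter

/-! ### The coarea inequality -/

section Coarea

/-- Let `s'` be the first time at which `h` takes the value `q`, and `s` the last time before `s'`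
with value `p`. By the intermediate value theorem `h` cannot leave `[p, q]` in between. -/
theorem exists_crossing {h : ℝ → ℝ} {a b p q : ℝ} (hab : a ≤ b) (hc : ContinuousOn h (Icc a b))
    (hp : h a ≤ p) (hpq : p ≤ q) (hq : q ≤ h b) :
    ∃ s s', a ≤ s ∧ s ≤ s' ∧ s' ≤ b ∧ h s = p ∧ h s' = q ∧ ∀ r ∈ Icc s s', h r ∈ Icc p q := by
  have hcomp : ∀ {c d y : ℝ}, c ∈ Icc a b → d ∈ Icc a b →
      IsCompact (Icc c d ∩ h ⁻¹' {y}) := fun {c d y} hc' hd' =>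
    isCompact_Icc.of_isClosed_subset
      ((hc.mono (Icc_subset_Icc hc'.1 hd'.2)).preimage_isClosed_of_isClosed isClosed_Icc
        isClosed_singleton) inter_subset_left
  have ha : a ∈ Icc a b := left_mem_Icc.2 hab
  have hb : b ∈ Icc a b := right_mem_Icc.2 hab
  obtain ⟨x, hx, hxq⟩ := intermediate_value_Icc hab hc ⟨hp.trans hpq, hq⟩
  obtain ⟨s', ⟨hs', hs'q⟩, hmin⟩ := (hcomp (y := q) ha hb).exists_isLeast ⟨x, hx, hxq⟩
  rw [mem_preimage, mem_singleton_iff] at hs'q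
  have hc' : ContinuousOn h (Icc a s') := hc.mono (Icc_subset_Icc le_rfl hs'.2)
  obtain ⟨y, hy, hyp⟩ := intermediate_value_Icc hs'.1 hc' ⟨hp, hpq.trans hs'q.ge⟩
  obtain ⟨s, ⟨hs, hsp⟩, hmax⟩ := (hcomp (y := p) ha hs').exists_isGreatest ⟨y, hy, hyp⟩
  rw [mem_preimage, mem_singleton_iff] at hsp
  refine ⟨s, s', hs.1, hs.2, hs'.2, hsp, hs'q, fun r hr => ⟨?_, ?_⟩⟩
  · by_contra! hlt
    obtain ⟨z, hz, hzp⟩ := intermediate_value_Icc hr.2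
      (hc'.mono (Icc_subset_Icc (hs.1.trans hr.1) le_rfl)) ⟨hlt.le, hpq.trans hs'q.ge⟩
    have h1 : z ≤ s := hmax ⟨⟨hs.1.trans (hr.1.trans hz.1), hz.2⟩, hzp⟩
    have h2 : r = s := le_antisymm (hz.1.trans h1) hr.1
    rw [h2] at hlt; linarith
  · by_contra! hlt
    have har : a ≤ r := hs.1.trans hr.1
    obtain ⟨z, hz, hzq⟩ := intermediate_value_Icc har
      (hc'.mono (Icc_subset_Icc le_rfl hr.2)) ⟨hp.trans hpq, hlt.le⟩
    have h1 : s' ≤ z := hmin ⟨⟨hz.1, hz.2.trans (hr.2.trans hs'.2)⟩, hzq⟩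
    have h2 : r = s' := le_antisymm hr.2 (h1.trans hz.2)
    rw [h2] at hlt; linarith

/-- The truncation of `v` at the levels `t - 1 / m` and `t`. -/
noncomputable def levelCutoff {X : Type*} (v : X → ℝ) (t m : ℝ) (x : X) : ℝ :=
  max 0 (min 1 (m * (t - v x)))

theorem abs_max_min_sub_le {t m p q : ℝ} (hm : 0 < m) (hpq : p ≤ q) :
    |max 0 (min 1 (m * (t - p))) - max 0 (min 1 (m * (t - q)))| ≤ m * (q - p) := by
  have h1 : |max 0 (min 1 (m * (t - p))) - max 0 (min 1 (m * (t - q)))| ≤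
      |min 1 (m * (t - p)) - min 1 (m * (t - q))| := by
    simpa using abs_max_sub_max_le_max 0 (min 1 (m * (t - p))) 0 (min 1 (m * (t - q)))
  have h2 : |min 1 (m * (t - p)) - min 1 (m * (t - q))| ≤ |m * (t - p) - m * (t - q)| := by
    simpa using abs_min_sub_min_le_max 1 (m * (t - p)) 1 (m * (t - q))
  refine h1.trans (h2.trans (le_of_eq ?_))
  rw [← mul_sub, abs_mul, abs_of_pos hm, abs_of_nonneg] 
  · ring
  · linarith

variable {X : Type*} [MetricSpace X]

/-- Only one crossing of the slab matters: the cutoff depends only on the value of `v` clamped to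
`[t - 1/m, t]`, and between the clamped endpoint values `exists_crossing` finds a subinterval along
which `v` stays in the slab. The integral of `G` there bounds the whole increment. -/
theorem UpperGradientOn.levelCutoff {V : Set X} {v : X → ℝ} {G : X → ℝ≥0∞}
    (h : UpperGradientOn V v G) (hv : ContinuousOn v V) {t m : ℝ} (hm : 0 < m) :
    UpperGradientOn V (levelCutoff v t m)
      (fun x => ENNReal.ofReal m * (V ∩ {x | t - m⁻¹ ≤ v x ∧ v x ≤ t}).indicator G x) := by
  intro a b c hab hc hcV
  have hcont : ContinuousOn (fun s => v (c s)) (Icc a b) := hv.comp hc.continuousOn hcV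
  have hAB : t - m⁻¹ < t := by have := inv_pos.2 hm; linarith
  have hmm : m * m⁻¹ = 1 := mul_inv_cancel₀ hm.ne'
  set S := V ∩ {x | t - m⁻¹ ≤ v x ∧ v x ≤ t} with hS
  have piece : ∀ s s' p q, a ≤ s → s ≤ s' → s' ≤ b → p ≤ q → t - m⁻¹ ≤ p → q ≤ t →
      edist (v (c s)) (v (c s')) = ENNReal.ofReal (q - p) →
      (∀ r ∈ Icc s s', v (c r) ∈ Icc p q) →
      ENNReal.ofReal (m * (q - p)) ≤
        ∫⁻ r in Icc a b, ENNReal.ofReal m * S.indicator G (c r) := by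
    intro s s' p q has hss hsb hpq hAp hqB hed hr
    have hsub : Icc s s' ⊆ Icc a b := Icc_subset_Icc has hsb
    rw [lintegral_const_mul' _ _ ENNReal.ofReal_ne_top, ENNReal.ofReal_mul hm.le, ← hed]
    gcongr
    refine (h hss (hc.mono hsub) (hcV.mono_left hsub)).trans ?_
    refine le_trans ?_ (lintegral_mono_set hsub)
    refine setLIntegral_mono' measurableSet_Icc fun r hr' => ?_
    rw [indicator_of_mem]
    exact ⟨hcV (hsub hr'), hAp.trans (hr r hr').1, (hr r hr').2.trans hqB⟩
  have clampT : ∀ r, max 0 (min 1 (m * (t - r))) =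
      max 0 (min 1 (m * (t - max (t - m⁻¹) (min t r)))) := fun r => by
    rcases le_total r t with h1 | h1
    · rw [min_eq_right h1]
      rcases le_total (t - m⁻¹) r with h2 | h2
      · rw [max_eq_right h2]
      · rw [max_eq_left h2]
        have : 1 ≤ m * (t - r) := by
          rw [← hmm]; exact mul_le_mul_of_nonneg_left (by linarith) hm.le
        rw [min_eq_left this, min_eq_left]
        rw [sub_sub_cancel, hmm]
    · rw [min_eq_left h1, max_eq_right hAB.le, sub_self, mul_zero]
      have : m * (t - r) ≤ 0 := mul_nonpos_of_nonneg_of_nonpos hm.le (by linarith)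
      rw [max_eq_left ((min_le_right _ _).trans this), max_eq_left (min_le_right _ _)]
  set P := max (t - m⁻¹) (min t (v (c a))) with hP
  set Q := max (t - m⁻¹) (min t (v (c b))) with hQ
  have hPA : t - m⁻¹ ≤ P := le_max_left _ _
  have hQA : t - m⁻¹ ≤ Q := le_max_left _ _
  have hPB : P ≤ t := max_le hAB.le (min_le_left _ _)
  have hQB : Q ≤ t := max_le hAB.le (min_le_left _ _)
  have hT : edist (MetricBV.levelCutoff v t m (c a)) (MetricBV.levelCutoff v t m (c b)) =
      ENNReal.ofReal |max 0 (min 1 (m * (t - P))) - max 0 (min 1 (m * (t - Q)))| := by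
    rw [edist_dist, Real.dist_eq, MetricBV.levelCutoff, MetricBV.levelCutoff, clampT, clampT (v (c b))]
  rw [hT]
  rcases lt_trichotomy P Q with hlt | heq | hlt
  -- As the clamped values satisfy `P < Q`, clamping can only have raised the initial value and
  -- lowered the final one.
  · have h1 : v (c a) ≤ P := by
      by_contra! hcon
      have : t ≤ P ∨ P = v (c a) := by
        rcases le_total t (v (c a)) with h | h
        · left; rw [hP, min_eq_left h]; exact le_max_right _ _
        · exfalso; rw [hP, min_eq_right h] at hcon; exact absurd (le_max_right _ _) (not_le.2 hcon)
      rcases this with h | h <;> linarith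
    have h2 : Q ≤ v (c b) := by
      by_contra! hcon
      have h3 : min t (v (c b)) < Q := (min_le_right _ _).trans_lt hcon
      have h4 : Q = t - m⁻¹ := by
        rcases max_choice (t - m⁻¹) (min t (v (c b))) with h | h
        · exact h
        · rw [← hQ] at h; linarith
      linarith
    obtain ⟨s, s', h3, h4, h5, h6, h7, h8⟩ := exists_crossing hab hcont h1 hlt.le h2
    refine (ENNReal.ofReal_le_ofReal (abs_max_min_sub_le hm hlt.le)).trans
      (piece s s' P Q h3 h4 h5 hlt.le hPA hQB ?_ h8)
    rw [h6, h7, edist_comm, edist_dist, Real.dist_eq, abs_of_nonneg (by linarith)]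
  · rw [heq]; simp
  · have h1 : v (c b) ≤ Q := by
      by_contra! hcon
      have : t ≤ Q ∨ Q = v (c b) := by
        rcases le_total t (v (c b)) with h | h
        · left; rw [hQ, min_eq_left h]; exact le_max_right _ _
        · exfalso; rw [hQ, min_eq_right h] at hcon; exact absurd (le_max_right _ _) (not_le.2 hcon)
      rcases this with h | h <;> linarith
    have h2 : P ≤ v (c a) := by
      by_contra! hcon
      have h3 : min t (v (c a)) < P := (min_le_right _ _).trans_lt hcon
      have h4 : P = t - m⁻¹ := by
        rcases max_choice (t - m⁻¹) (min t (v (c a))) with h | h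
        · exact h
        · rw [← hP] at h; linarith
      linarith
    -- A descending crossing is an ascending one for `-v`.
    obtain ⟨s, s', h3, h4, h5, h6, h7, h8⟩ := exists_crossing (h := fun s => -v (c s)) hab hcont.neg
      (neg_le_neg h2) (neg_le_neg hlt.le) (neg_le_neg h1)
    rw [abs_sub_comm]
    refine (ENNReal.ofReal_le_ofReal (abs_max_min_sub_le hm hlt.le)).trans
      (piece s s' Q P h3 h4 h5 hlt.le hQA hPB ?_ fun r hr => ?_)
    · rw [neg_inj.1 h6, neg_inj.1 h7, edist_dist, Real.dist_eq, abs_of_nonneg (by linarith)]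
    · have := h8 r hr
      exact ⟨by linarith [this.2], by linarith [this.1]⟩

variable [MeasurableSpace X] [BorelSpace X] {μ : Measure X}

/-- Layer-cake formula: superlevel sets of a lower semicontinuous function are open, and Fatou's
lemma in the level handles the liminf. Truncation at `N` makes the function real-valued. -/
theorem lintegral_le_liminf_of_forall_isOpen {ν : Measure X} {lam : ℕ → Measure X}
    (h : ∀ V, IsOpen V → ν V ≤ liminf (fun n => lam n V) atTop) {f : X → ℝ≥0∞}
    (hf : LowerSemicontinuous f) : ∫⁻ x, f x ∂ν ≤ liminf (fun n => ∫⁻ x, f x ∂lam n) atTop := by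
  have hfm := hf.measurable
  have htrunc : ∀ N : ℕ, ∫⁻ x, min (f x) N ∂ν ≤ liminf (fun n => ∫⁻ x, f x ∂lam n) atTop := by
    intro N
    set F : X → ℝ := fun x => (min (f x) N).toReal with hF
    have hFm : Measurable F := (hfm.min measurable_const).ennreal_toReal
    have hfin : ∀ x, min (f x) N ≠ ⊤ := fun x => ((min_le_right _ _).trans_lt (by simp)).ne
    have hof : ∀ x, ENNReal.ofReal (F x) = min (f x) N := fun x => ENNReal.ofReal_toReal (hfin x)
    have hcake : ∀ κ : Measure X, ∫⁻ x, min (f x) N ∂κ = ∫⁻ s in Ioi (0 : ℝ), κ {x | s < F x} :=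
      fun κ => by
        rw [← lintegral_eq_lintegral_meas_lt κ (Eventually.of_forall fun x => ENNReal.toReal_nonneg)
          hFm.aemeasurable]
        exact lintegral_congr fun x => (hof x).symm
    have hopen : ∀ s ∈ Ioi (0 : ℝ), IsOpen {x | s < F x} := fun s hs => by
      have : {x | s < F x} = {x | ENNReal.ofReal s < f x} ∩ {_x | ENNReal.ofReal s < N} := by
        ext x
        simp only [mem_ofPred_eq, mem_inter_iff, hF]
        rw [← lt_min_iff, ENNReal.ofReal_lt_iff_lt_toReal (le_of_lt hs) (hfin x)]
      rw [this]
      exact (hf.isOpen_preimage _).inter isOpen_const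
    rw [hcake]
    calc ∫⁻ s in Ioi (0 : ℝ), ν {x | s < F x}
        ≤ ∫⁻ s in Ioi (0 : ℝ), liminf (fun n => lam n {x | s < F x}) atTop :=
          setLIntegral_mono' measurableSet_Ioi fun s hs => h _ (hopen s hs)
      _ ≤ liminf (fun n => ∫⁻ s in Ioi (0 : ℝ), lam n {x | s < F x}) atTop :=
          lintegral_liminf_le fun n => Antitone.measurable fun s s' hss =>
            measure_mono fun x hx => lt_of_le_of_lt hss hx
      _ ≤ _ := by
          simp only [← hcake]
          exact liminf_le_liminf (Eventually.of_forall fun n =>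
            lintegral_mono fun x => min_le_left _ _)
  have hsup : ∀ x, f x = ⨆ N : ℕ, min (f x) N := fun x => by
    rw [← inf_iSup_eq]
    simp [ENNReal.iSup_natCast]
  calc ∫⁻ x, f x ∂ν = ∫⁻ x, ⨆ N : ℕ, min (f x) N ∂ν := lintegral_congr hsup
    _ = ⨆ N : ℕ, ∫⁻ x, min (f x) N ∂ν :=
        lintegral_iSup (fun N => hfm.min measurable_const) fun M N hMN x =>
          min_le_min le_rfl (by exact_mod_cast hMN)
    _ ≤ _ := iSup_le htrunc

theorem measurable_indicator_of_continuousOn {Ω : Set X} (hΩ : MeasurableSet Ω) {v : X → ℝ}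
    (hv : ContinuousOn v Ω) : Measurable (Ω.indicator v) := by
  classical
  rw [← piecewise_eq_indicator]
  exact hv.measurable_piecewise continuousOn_const hΩ

theorem _root_.ContinuousOn.measurableSet_inter_preimage {Ω : Set X} {v : X → ℝ}
    (hv : ContinuousOn v Ω) (hΩ : MeasurableSet Ω) {I : Set ℝ} (hI : MeasurableSet I) :
    MeasurableSet (Ω ∩ v ⁻¹' I) := by
  have : Ω ∩ v ⁻¹' I = Ω ∩ Ω.indicator v ⁻¹' I := by
    ext x
    refine and_congr_right fun hx => ?_
    rw [mem_preimage, mem_preimage, indicator_of_mem hx]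
  rw [this]
  exact hΩ.inter (measurable_indicator_of_continuousOn hΩ hv hI)

/-- The cutoffs take values in `[0, 1]` and are eventually equal to the indicator at each point of
`Ω`, so dominated convergence gives the `L¹` limit. -/
theorem isApproximation_levelCutoff [ProperSpace X] [IsLocallyFiniteMeasure μ] {Ω : Set X}
    (hΩ : IsOpen Ω)
    {v : X → ℝ} (hv : LocallyLipschitzOn Ω v) {G : X → ℝ≥0∞} (hG : Measurable G)
    (hvG : UpperGradientOn Ω v G) (t : ℝ) :
    IsApproximation μ Ω ((Ω ∩ {x | v x < t}).indicator fun _ => 1)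
      (fun n => levelCutoff v t (n + 1)) (fun n x => ENNReal.ofReal (n + 1) *
        (Ω ∩ {x | t - (n + 1 : ℝ)⁻¹ ≤ v x ∧ v x ≤ t}).indicator G x) := by
  have hm : ∀ n : ℕ, (0 : ℝ) < n + 1 := fun n => by positivity
  have hc : ∀ n : ℕ, ContinuousOn (levelCutoff v t (n + 1)) Ω := fun n => by
    have := hv.continuousOn
    unfold levelCutoff
    fun_prop
  have hU : IsOpen (Ω ∩ {x | v x < t}) := hv.continuousOn.isOpen_inter_preimage hΩ isOpen_Iio
  refine ⟨fun n => ?_, fun O hO => ?_, fun n => ?_, fun n => hvG.levelCutoff hv.continuousOn (hm n)⟩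
  · refine LocallyLipschitzOn.lipLoc fun x hx => ?_
    obtain ⟨K, s, hs, hK⟩ := hv hx
    refine ⟨(n + 1) * K, s, hs, LipschitzOnWith.of_dist_le_mul fun y hy z hz => ?_⟩
    have h1 := hK.dist_le_mul y hy z hz
    push_cast
    rw [mul_assoc]
    refine le_trans ?_ (mul_le_mul_of_nonneg_left h1 (hm n).le)
    rw [Real.dist_eq, Real.dist_eq]
    unfold levelCutoff
    rcases le_total (v y) (v z) with h | h
    · rw [abs_sub_comm (v y), abs_of_nonneg (sub_nonneg.2 h)]
      exact abs_max_min_sub_le (hm n) h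
    · rw [abs_of_nonneg (sub_nonneg.2 h), abs_sub_comm]
      exact abs_max_min_sub_le (hm n) h
  · have hfin : ∫⁻ _ in O, (1 : ℝ≥0∞) ∂μ ≠ ⊤ := by
      rw [setLIntegral_one]
      exact ((measure_mono subset_closure).trans_lt hO.2.1.measure_lt_top).ne
    have hOΩ : O ⊆ Ω := hO.subset
    have hmeas : ∀ n : ℕ, AEMeasurable (fun x => ‖levelCutoff v t (n + 1) x -
        (Ω ∩ {x | v x < t}).indicator (fun _ => (1 : ℝ)) x‖ₑ) (μ.restrict O) := fun n =>
      ((((hc n).mono hOΩ).aemeasurable hO.1.measurableSet).sub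
        (measurable_const.indicator hU.measurableSet).aemeasurable).enorm
    have := tendsto_lintegral_of_dominated_convergence' (μ := μ.restrict O) (f := fun _ => 0)
      (fun _ => 1) hmeas (fun n => ?_) hfin ?_
    · simpa using this
    · filter_upwards [ae_restrict_mem hO.1.measurableSet] with x hx
      rw [Real.enorm_eq_ofReal_abs]
      refine ENNReal.ofReal_le_one.2 (abs_le.2 ?_)
      have h1 : 0 ≤ levelCutoff v t (n + 1) x := le_max_left _ _
      have h2 : levelCutoff v t (n + 1) x ≤ 1 := max_le zero_le_one (min_le_left _ _)
      by_cases hxt : x ∈ Ω ∩ {x | v x < t}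
      · rw [indicator_of_mem hxt]; constructor <;> linarith
      · rw [indicator_of_notMem hxt]; constructor <;> linarith
    · filter_upwards [ae_restrict_mem hO.1.measurableSet] with x hx
      refine tendsto_const_nhds.congr' ?_
      by_cases hxt : v x < t
      · obtain ⟨N, hN⟩ := exists_nat_gt (t - v x)⁻¹
        filter_upwards [eventually_ge_atTop N] with n hn
        have hmem : x ∈ Ω ∩ {x | v x < t} := ⟨hOΩ hx, hxt⟩
        have hone : levelCutoff v t (n + 1) x = 1 := by
          rw [levelCutoff, min_eq_left, max_eq_right zero_le_one]
          have h3 : 0 < t - v x := sub_pos.2 hxt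
          have h4 : (t - v x)⁻¹ ≤ n + 1 := hN.le.trans (by
            have : (N : ℝ) ≤ n := by exact_mod_cast hn
            linarith)
          calc 1 = (t - v x)⁻¹ * (t - v x) := (inv_mul_cancel₀ h3.ne').symm
            _ ≤ _ := mul_le_mul_of_nonneg_right h4 h3.le
        rw [hone, indicator_of_mem hmem, sub_self, enorm_zero]
      · refine Eventually.of_forall fun n => ?_
        have hmem : x ∉ Ω ∩ {x | v x < t} := fun h => hxt h.2
        have hzero : levelCutoff v t (n + 1) x = 0 := by
          rw [levelCutoff, max_eq_left]
          exact (min_le_right _ _).trans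
            (mul_nonpos_of_nonneg_of_nonpos (hm n).le (by linarith))
        simp only [hzero, indicator_of_notMem hmem, sub_self, enorm_zero]
  · refine (hG.indicator ?_).const_mul _
    exact hv.continuousOn.measurableSet_inter_preimage hΩ.measurableSet measurableSet_Icc

/-- The coarea inequality, integrated against a function that is admissible for the perimeter
measures of the sets separating `E` from `F`. -/
theorem ofReal_le_lintegral_of_separating [ProperSpace X] [Nonempty X] [IsLocallyFiniteMeasure μ]
    {Ω E F : Set X} (hΩ : IsOpen Ω) (hEΩ : E ⊆ Ω) (hFΩ : F ⊆ Ω) {v : X → ℝ}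
    (hv : LocallyLipschitzOn Ω v) {G : X → ℝ≥0∞} (hG : Measurable G) (hvG : UpperGradientOn Ω v G)
    {s : ℝ} (hE : ∀ x ∈ E, v x ≤ 0) (hF : ∀ x ∈ F, s ≤ v x) {ρ f : X → ℝ≥0∞}
    (hρ : ∀ ν ∈ separatingPerimeters μ E F Ω, 1 ≤ ∫⁻ x, ρ x ∂ν) (hf : LowerSemicontinuous f)
    (hρf : ∀ x, ρ x ≤ f x) {δ : ℝ≥0} (hδ : 0 < δ) (hδf : ∀ x, δ ≤ f x) :
    ENNReal.ofReal s ≤ ∫⁻ x in Ω, G x * f x ∂μ := by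
  set U : ℝ → Set X := fun t => Ω ∩ {x | v x < t} with hUdef
  set S : ℕ → ℝ → Set X := fun n t => Ω ∩ {x | t - (n + 1 : ℝ)⁻¹ ≤ v x ∧ v x ≤ t} with hS
  set D : ℕ → ℝ → X → ℝ≥0∞ := fun n t x => ENNReal.ofReal (n + 1) * (S n t).indicator G x with hD
  have hfm : Measurable f := hf.measurable
  have happ : ∀ t, IsApproximation μ Ω ((U t).indicator fun _ => 1)
      (fun n => levelCutoff v t (n + 1)) (fun n => D n t) :=
    fun t => isApproximation_levelCutoff hΩ hv hG hvG t
  have hUo : ∀ t, IsOpen (U t) := fun t => hv.continuousOn.isOpen_inter_preimage hΩ isOpen_Iio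
  have hUo' : ∀ t, IsOpen (Ω ∩ {x | t < v x}) := fun t =>
    hv.continuousOn.isOpen_inter_preimage hΩ isOpen_Ioi
  have hint : ∀ n t, ∫⁻ x, f x ∂(μ.withDensity (D n t)) = ∫⁻ x, D n t x * f x ∂μ := fun n t =>
    lintegral_withDensity_eq_lintegral_mul _ ((happ t).measurable n) hfm
  have hlevel : ∀ t ∈ Ioo 0 s, 1 ≤ liminf (fun n => ∫⁻ x, D n t x * f x ∂μ) atTop := by
    intro t ht
    by_contra! hlt
    have hfreq := frequently_lt_of_liminf_lt (by isBoundedDefault) hlt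
    -- The lower bound `δ ≤ f` turns a liminf below `1` of the weighted energies into finite
    -- perimeter, so that `U t` belongs to the family on which `ρ` is tested.
    have hTV : totalVariation μ ((U t).indicator fun _ => 1) Ω < ⊤ := by
      refine lt_of_le_of_lt (b := (δ : ℝ≥0∞)⁻¹) ?_
        (ENNReal.inv_lt_top.2 (by exact_mod_cast hδ))
      refine (happ t).totalVariation_le_liminf.trans (liminf_le_of_frequently_le' ?_)
      refine hfreq.mono fun n hn => ?_
      rw [← one_div, ENNReal.le_div_iff_mul_le (Or.inl (by exact_mod_cast hδ.ne'))
        (Or.inl ENNReal.coe_ne_top)]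
      refine le_trans ?_ hn.le
      rw [← lintegral_mul_const' _ _ ENNReal.coe_ne_top]
      exact (setLIntegral_le_lintegral _ _).trans (lintegral_mono fun x => by gcongr; exact hδf x)
    obtain ⟨ν, hν⟩ := exists_perimeterMeasure (μ := μ) (hUo t).measurableSet Ω
    have hmem : ν ∈ separatingPerimeters μ E F Ω := by
      refine ⟨U t, ⟨(hUo t).measurableSet.nullMeasurableSet, hTV⟩, ?_, ?_, hν⟩
      · rw [(hUo t).interior_eq]
        exact fun x hx => ⟨hEΩ hx, (hE x hx).trans_lt ht.1⟩
      · refine Subset.trans ?_ (interior_maximal ?_ (hUo' t))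
        · exact fun x hx => ⟨hFΩ hx, ht.2.trans_le (hF x hx)⟩
        · intro x hx hx'
          have h1 : t < v x := hx.2
          have h2 : v x < t := hx'.2
          exact lt_asymm h1 h2
    have hle := lintegral_le_liminf_of_forall_isOpen (ν := ν)
      (lam := fun n => μ.withDensity (D n t)) (fun V hV => ?_) hf
    · simp only [hint] at hle
      exact absurd ((hρ ν hmem).trans ((lintegral_mono hρf).trans hle)) (not_le.2 hlt)
    · rw [hν V hV.measurableSet, perimeter_of_isOpen (hΩ.inter hV)]
      refine ((happ t).mono inter_subset_left).totalVariation_le_liminf.trans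
        (liminf_le_liminf (Eventually.of_forall fun n => ?_))
      rw [withDensity_apply _ hV.measurableSet]
      exact lintegral_mono_set inter_subset_right
  -- The slabs as one set of pairs (level, point), for Tonelli; `v` is extended by zero to be Borel
  -- on `X`.
  set A : ℕ → Set (ℝ × X) := fun n => {z | z.2 ∈ Ω ∧ z.1 - (n + 1 : ℝ)⁻¹ ≤ Ω.indicator v z.2 ∧
    Ω.indicator v z.2 ≤ z.1} with hA
  set B : ℕ → ℝ × X → ℝ≥0∞ := fun n =>
    (A n).indicator fun z => ENNReal.ofReal (n + 1) * (G z.2 * f z.2) with hB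
  have hBm : ∀ n, Measurable (B n) := fun n => by
    have h2 : Measurable fun z : ℝ × X => Ω.indicator v z.2 :=
      (measurable_indicator_of_continuousOn hΩ.measurableSet hv.continuousOn).comp measurable_snd
    refine (((hG.comp measurable_snd).mul (hfm.comp measurable_snd)).const_mul _).indicator ?_
    exact (measurable_snd hΩ.measurableSet).inter
      ((measurableSet_le (measurable_fst.sub_const _) h2).inter
        (measurableSet_le h2 measurable_fst))
  have hDB : ∀ n t x, D n t x * f x = B n (t, x) := fun n t x => by
    by_cases hx : x ∈ S n t
    · have h1 : t - (n + 1 : ℝ)⁻¹ ≤ v x ∧ v x ≤ t := hx.2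
      have : (t, x) ∈ A n := ⟨hx.1, by simpa only [indicator_of_mem hx.1] using h1⟩
      simp only [hD, hB, indicator_of_mem this, indicator_of_mem hx, mul_assoc]
    · have : (t, x) ∉ A n := fun h => hx ⟨h.1, by
        have h1 : t - (n + 1 : ℝ)⁻¹ ≤ Ω.indicator v x ∧ Ω.indicator v x ≤ t := h.2
        rw [indicator_of_mem h.1] at h1
        exact h1⟩
      simp only [hD, hB, indicator_of_notMem this, indicator_of_notMem hx, mul_zero, zero_mul]
  simp only [hDB] at hlevel
  -- For fixed `x` the admissible levels form an interval of length `1 / (n + 1)`, which cancels the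
  -- factor `n + 1`.
  have hkey : ∀ n, ∫⁻ t in Ioo 0 s, ∫⁻ x, B n (t, x) ∂μ ≤ ∫⁻ x in Ω, G x * f x ∂μ := by
    intro n
    rw [lintegral_lintegral_swap (f := fun t x => B n (t, x)) (hBm n).aemeasurable, ← lintegral_indicator hΩ.measurableSet]
    refine lintegral_mono fun x => ?_
    by_cases hx : x ∈ Ω
    · rw [indicator_of_mem hx]
      calc ∫⁻ t in Ioo 0 s, B n (t, x)
          ≤ ∫⁻ t, (Icc (v x) (v x + (n + 1 : ℝ)⁻¹)).indicator
              (fun _ => ENNReal.ofReal (n + 1) * (G x * f x)) t := by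
            refine (setLIntegral_le_lintegral _ _).trans (lintegral_mono fun t => ?_)
            by_cases ht : (t, x) ∈ A n
            · have h2 : t - (n + 1 : ℝ)⁻¹ ≤ Ω.indicator v x ∧ Ω.indicator v x ≤ t := ht.2
              rw [indicator_of_mem hx] at h2
              have h3 : t ∈ Icc (v x) (v x + (n + 1 : ℝ)⁻¹) := ⟨h2.2, by linarith [h2.1]⟩
              simp only [hB, indicator_of_mem ht, indicator_of_mem h3, le_refl]
            · simp only [hB, indicator_of_notMem ht]; exact bot_le
        _ = G x * f x := by
            rw [lintegral_indicator_const measurableSet_Icc, Real.volume_Icc, add_sub_cancel_left,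
              mul_right_comm, ← ENNReal.ofReal_mul (by positivity),
              mul_inv_cancel₀ (by positivity), ENNReal.ofReal_one, one_mul]
    · rw [indicator_of_notMem hx]
      refine le_of_eq (lintegral_eq_zero_of_ae_eq_zero (Eventually.of_forall fun t => ?_))
      exact indicator_of_notMem (fun h => hx h.1) _
  calc ENNReal.ofReal s = ∫⁻ _ in Ioo 0 s, 1 := by
        rw [setLIntegral_one, Real.volume_Ioo, sub_zero]
    _ ≤ ∫⁻ t in Ioo 0 s, liminf (fun n => ∫⁻ x, B n (t, x) ∂μ) atTop :=
        setLIntegral_mono' measurableSet_Ioo hlevel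
    _ ≤ liminf (fun n => ∫⁻ t in Ioo 0 s, ∫⁻ x, B n (t, x) ∂μ) atTop :=
        lintegral_liminf_le fun n => (hBm n).lintegral_prod_right'
    _ ≤ _ := (liminf_le_liminf (Eventually.of_forall hkey)).trans (liminf_const _).le

end Coarea

/-! ### Coarse paths and their potentials -/

section Paths
variable {X : Type*} [MetricSpace X]

/-- A bounded lower regularization of `ρ` at scale `1 / (n + 1)`. -/
noncomputable def lowReg (ρ : X → ℝ≥0∞) (n : ℕ) (x : X) : ℝ≥0∞ :=
  min n (⨅ y ∈ Metric.ball x (1 / (n + 1 : ℝ)), ρ y)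

theorem lowReg_le_natCast (ρ : X → ℝ≥0∞) (n : ℕ) (x : X) : lowReg ρ n x ≤ n := min_le_left _ _

theorem lowReg_le {ρ : X → ℝ≥0∞} {n : ℕ} {x y : X} (h : dist y x < 1 / (n + 1 : ℝ)) :
    lowReg ρ n x ≤ ρ y := (min_le_right _ _).trans (iInf₂_le y h)

theorem lowReg_le_lowReg {ρ : X → ℝ≥0∞} {m n : ℕ} {x y : X} (hmn : m ≤ n)
    (h : dist y x + 1 / (n + 1 : ℝ) ≤ 1 / (m + 1 : ℝ)) : lowReg ρ m x ≤ lowReg ρ n y := by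
  refine min_le_min (by exact_mod_cast hmn) (le_iInf₂ fun z hz => iInf₂_le z ?_)
  rw [Metric.mem_ball] at *
  linarith [dist_triangle z y x]

theorem lowReg_mono {ρ : X → ℝ≥0∞} {m n : ℕ} (hmn : m ≤ n) (x : X) :
    lowReg ρ m x ≤ lowReg ρ n x :=
  lowReg_le_lowReg hmn (by rw [dist_self, zero_add]; exact Nat.one_div_le_one_div hmn)

theorem le_lowReg {ρ : X → ℝ≥0∞} {δ : ℝ≥0∞} (hδ : ∀ x, δ ≤ ρ x) {n : ℕ} (hn : δ ≤ n) (x : X) :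
    δ ≤ lowReg ρ n x := le_min hn (le_iInf₂ fun y _ => hδ y)

theorem le_iSup_lowReg {ρ : X → ℝ≥0∞} (hρ : LowerSemicontinuous ρ) (x : X) :
    ρ x ≤ ⨆ n, lowReg ρ n x := by
  refine le_of_forall_lt fun a ha => ?_
  obtain ⟨b, hab, hb⟩ := exists_between ha
  obtain ⟨r, hr, hball⟩ := Metric.eventually_nhds_iff_ball.1 (hρ x b hb)
  obtain ⟨k, hk⟩ := exists_nat_one_div_lt hr
  obtain ⟨m, hm⟩ := ENNReal.exists_nat_gt (hb.trans_le le_top).ne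
  refine hab.trans_le (le_iSup_of_le (max k m) (le_min ?_ (le_iInf₂ fun y hy => ?_)))
  · exact hm.le.trans (by exact_mod_cast le_max_right k m)
  · refine (hball y (Metric.ball_subset_ball ?_ hy)).le
    exact (Nat.one_div_le_one_div (le_max_left k m)).trans hk.le

theorem measurable_lowReg [MeasurableSpace X] [BorelSpace X] (ρ : X → ℝ≥0∞) (n : ℕ) :
    Measurable (lowReg ρ n) := by
  refine measurable_const.min (UpperSemicontinuous.measurable ?_)
  rw [upperSemicontinuous_iff_isOpen_preimage]
  intro a
  have : (fun x => ⨅ y ∈ Metric.ball x (1 / (n + 1 : ℝ)), ρ y) ⁻¹' Iio a =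
      ⋃ y ∈ {y | ρ y < a}, Metric.ball y (1 / (n + 1 : ℝ)) := by
    ext x
    simp only [mem_preimage, mem_Iio, iInf_lt_iff, mem_iUnion, exists_prop, Metric.mem_ball]
    exact ⟨fun ⟨y, h1, h2⟩ => ⟨y, h2, by rwa [dist_comm]⟩,
      fun ⟨y, h1, h2⟩ => ⟨y, by rwa [dist_comm], h1⟩⟩
  rw [this]
  exact isOpen_biUnion fun y _ => Metric.isOpen_ball

/-- A path in `K` that is `1`-Lipschitz up to an additive error. -/
structure IsCoarsePath (K : Set X) (ε T : ℝ) (c : ℝ → X) : Prop where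
  nonneg : 0 ≤ T
  mem : ∀ s ∈ Icc 0 T, c s ∈ K
  dist_le : ∀ s ∈ Icc 0 T, ∀ s' ∈ Icc 0 T, dist (c s) (c s') ≤ |s - s'| + ε

/-- The least cost of a coarse path in `K` from `E` to `x`. -/
noncomputable def pathCost (ρ : X → ℝ≥0∞) (E K : Set X) (n : ℕ) (x : X) : ℝ≥0∞ :=
  ⨅ (T : ℝ) (c : ℝ → X) (_ : IsCoarsePath K (1 / (n + 1)) T c) (_ : c 0 ∈ E) (_ : c T = x),
    ∫⁻ s in Ico 0 T, lowReg ρ n (c s)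

theorem exists_path_of_pathCost_lt {ρ : X → ℝ≥0∞} {E K : Set X} {n : ℕ} {x : X} {a : ℝ≥0∞}
    (h : pathCost ρ E K n x < a) : ∃ T c, IsCoarsePath K (1 / (n + 1)) T c ∧ c 0 ∈ E ∧ c T = x ∧
      ∫⁻ s in Ico 0 T, lowReg ρ n (c s) < a := by
  simp only [pathCost, iInf_lt_iff] at h
  obtain ⟨T, c, h1, h2, h3, h4⟩ := h
  exact ⟨T, c, h1, h2, h3, h4⟩

theorem pathCost_le {ρ : X → ℝ≥0∞} {E K : Set X} {n : ℕ} {T : ℝ} {c : ℝ → X}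
    (h : IsCoarsePath K (1 / (n + 1)) T c) (h0 : c 0 ∈ E) :
    pathCost ρ E K n (c T) ≤ ∫⁻ s in Ico 0 T, lowReg ρ n (c s) :=
  iInf_le_of_le T <| iInf_le_of_le c <| iInf_le_of_le h <| iInf_le_of_le h0 <|
    iInf_le_of_le rfl le_rfl

theorem le_pathCost {ρ : X → ℝ≥0∞} {E K : Set X} {n : ℕ} {x : X} {a : ℝ≥0∞}
    (h : ∀ T c, IsCoarsePath K (1 / (n + 1)) T c → c 0 ∈ E → c T = x →
      a ≤ ∫⁻ s in Ico 0 T, lowReg ρ n (c s)) : a ≤ pathCost ρ E K n x :=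
  le_iInf fun T => le_iInf fun c => le_iInf fun h1 => le_iInf fun h2 => le_iInf fun h3 =>
    h T c h1 h2 h3

theorem IsCoarsePath.mono {K K' : Set X} {ε ε' T : ℝ} {c : ℝ → X} (h : IsCoarsePath K ε T c)
    (hK : K ⊆ K') (hε : ε ≤ ε') : IsCoarsePath K' ε' T c :=
  ⟨h.nonneg, fun s hs => hK (h.mem s hs), fun s hs s' hs' =>
    (h.dist_le s hs s' hs').trans (by linarith)⟩

theorem pathCost_mono {ρ : X → ℝ≥0∞} {E K : Set X} {m n : ℕ} (hmn : m ≤ n) (x : X) :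
    pathCost ρ E K m x ≤ pathCost ρ E K n x :=
  le_pathCost fun _ _ hc h0 hT => by
    rw [← hT]
    exact (pathCost_le (hc.mono le_rfl (Nat.one_div_le_one_div hmn)) h0).trans
      (lintegral_mono fun s => lowReg_mono hmn _)

theorem pathCost_anti {ρ : X → ℝ≥0∞} {E K K' : Set X} (hK : K ⊆ K') (n : ℕ) (x : X) :
    pathCost ρ E K' n x ≤ pathCost ρ E K n x :=
  le_pathCost fun _ _ hc h0 hT => by
    rw [← hT]
    exact pathCost_le (hc.mono hK le_rfl) h0

theorem pathCost_eq_zero {ρ : X → ℝ≥0∞} {E K : Set X} {n : ℕ} {x : X} (hE : x ∈ E) (hK : x ∈ K) :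
    pathCost ρ E K n x = 0 := by
  refine le_antisymm ?_ bot_le
  have h : IsCoarsePath K (1 / (n + 1)) 0 (fun _ => x) :=
    ⟨le_rfl, fun _ _ => hK, fun s _ s' _ => by rw [dist_self]; positivity⟩
  simpa using pathCost_le (ρ := ρ) h hE

theorem pathCost_eq_top {ρ : X → ℝ≥0∞} {E K : Set X} {n : ℕ} {x : X} (hK : x ∉ K) :
    pathCost ρ E K n x = ⊤ :=
  top_le_iff.1 <| le_pathCost fun T _ hc _ hT =>
    (hK (hT ▸ hc.mem T (right_mem_Icc.2 hc.nonneg))).elim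

/-- A path ending at `x` is prolonged by waiting at `x` for time `dist x y` and jumping to `y` at
the last instant. The jump fits into the allowed additive error, and it is free because the cost is
an integral over a half-open interval; waiting costs `lowReg ρ n x * dist x y`. -/
theorem pathCost_le_add {ρ : X → ℝ≥0∞} {E K : Set X} {n : ℕ} {x y : X} (hx : x ∈ K) (hy : y ∈ K)
    (hxy : dist x y ≤ 1 / (n + 1)) :
    pathCost ρ E K n y ≤ pathCost ρ E K n x + lowReg ρ n x * edist x y := by
  rw [← tsub_le_iff_right]
  refine le_pathCost fun T c hc h0 hT => ?_
  rw [tsub_le_iff_right]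
  set d := dist x y with hd
  have hd0 : 0 ≤ d := dist_nonneg
  have hT0 := hc.nonneg
  set c' : ℝ → X := fun s => if s ≤ T then c s else if s < T + d then x else y with hc'
  have e1 : ∀ s, s ≤ T → c' s = c s := fun s hs => by simp only [hc', if_pos hs]
  have e2 : ∀ s, T ≤ s → s < T + d → c' s = x := fun s hs hs' => by
    rcases hs.eq_or_lt with rfl | h
    · rw [e1 _ le_rfl, hT]
    · simp only [hc', if_neg (not_le.2 h), if_pos hs']
  have e3 : c' (T + d) = y := by
    rcases hd0.eq_or_lt with h | h
    · rw [← h, add_zero, e1 _ le_rfl, hT]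
      exact dist_eq_zero.1 (hd ▸ h.symm)
    · simp only [hc', if_neg (not_le.2 (lt_add_of_pos_right T h)), lt_irrefl, if_false]
  have hTmem : T ∈ Icc 0 T := right_mem_Icc.2 hT0
  have hη : (0 : ℝ) ≤ 1 / (n + 1) := by positivity
  have key : ∀ s ∈ Icc 0 (T + d), ∀ s' ∈ Icc 0 (T + d), s ≤ s' →
      dist (c' s) (c' s') ≤ |s - s'| + 1 / (n + 1) := by
    intro s hs s' hs' hss
    rw [abs_sub_comm, abs_of_nonneg (sub_nonneg.2 hss)]
    rcases le_or_gt s' T with h1 | h1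
    · rw [e1 _ h1, e1 _ (hss.trans h1)]
      have := hc.dist_le s ⟨hs.1, hss.trans h1⟩ s' ⟨hs'.1, h1⟩
      rwa [abs_sub_comm, abs_of_nonneg (sub_nonneg.2 hss)] at this
    · rcases le_or_gt s T with h2 | h2
      · have h3 := hc.dist_le s ⟨hs.1, h2⟩ T hTmem
        rw [abs_sub_comm, abs_of_nonneg (sub_nonneg.2 h2), hT] at h3
        rw [e1 _ h2]
        rcases hs'.2.lt_or_eq with h4 | h4
        · rw [e2 _ h1.le h4]; linarith
        · rw [h4, e3]
          have := dist_triangle (c s) x y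
          linarith
      · rcases hs'.2.lt_or_eq with h4 | h4
        · rw [e2 _ h1.le h4, e2 _ h2.le (hss.trans_lt h4), dist_self]
          linarith
        · rcases hs.2.lt_or_eq with h5 | h5
          · rw [h4, e3, e2 _ h2.le h5]; linarith
          · rw [h4, h5, dist_self]; linarith
  have hpath : IsCoarsePath K (1 / (n + 1)) (T + d) c' := by
    refine ⟨by positivity, fun s hs => ?_, fun s hs s' hs' => ?_⟩
    · rcases le_or_gt s T with h1 | h1
      · rw [e1 _ h1]; exact hc.mem s ⟨hs.1, h1⟩
      · rcases hs.2.lt_or_eq with h4 | h4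
        · rw [e2 _ h1.le h4]; exact hx
        · rw [h4, e3]; exact hy
    · rcases le_total s s' with h | h
      · exact key s hs s' hs' h
      · rw [dist_comm, abs_sub_comm]; exact key s' hs' s hs h
  have hcost := pathCost_le (ρ := ρ) hpath (E := E) (by rwa [e1 0 hT0])
  rw [e3] at hcost
  refine hcost.trans ?_
  have hdis : Disjoint (Ico 0 T) (Ico T (T + d)) :=
    disjoint_left.2 fun s hs hs' => absurd hs.2 (not_lt.2 hs'.1)
  rw [← Ico_union_Ico_eq_Ico hT0 (le_add_of_nonneg_right hd0),
    lintegral_union measurableSet_Ico hdis]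
  gcongr ?_ + ?_
  · exact (setLIntegral_congr_fun measurableSet_Ico fun s hs => by simp only [e1 s hs.2.le]).le
  · refine le_of_eq ?_
    rw [setLIntegral_congr_fun (g := fun _ => lowReg ρ n x) measurableSet_Ico
      fun s hs => by simp only [e2 s hs.1 hs.2]]
    rw [setLIntegral_const, Real.volume_Ico, add_sub_cancel_left, edist_dist]

/-- The truncated path cost, as a real function. -/
noncomputable def potential (ρ : X → ℝ≥0∞) (E K : Set X) (n : ℕ) (x : X) : ℝ :=
  (min 1 (pathCost ρ E K n x)).toReal

theorem min_one_ne_top (a : ℝ≥0∞) : min 1 a ≠ ⊤ := ((min_le_left _ _).trans_lt ENNReal.one_lt_top).ne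

theorem potential_nonneg (ρ : X → ℝ≥0∞) (E K : Set X) (n : ℕ) (x : X) :
    0 ≤ potential ρ E K n x := ENNReal.toReal_nonneg

theorem potential_le_one (ρ : X → ℝ≥0∞) (E K : Set X) (n : ℕ) (x : X) :
    potential ρ E K n x ≤ 1 := ENNReal.toReal_le_of_le_ofReal zero_le_one (by simp)

theorem potential_mono {ρ : X → ℝ≥0∞} {E K : Set X} {m n : ℕ} (hmn : m ≤ n) (x : X) :
    potential ρ E K m x ≤ potential ρ E K n x :=
  ENNReal.toReal_mono (min_one_ne_top _) (min_le_min le_rfl (pathCost_mono hmn x))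

theorem potential_anti {ρ : X → ℝ≥0∞} {E K K' : Set X} (hK : K ⊆ K') (n : ℕ) (x : X) :
    potential ρ E K' n x ≤ potential ρ E K n x :=
  ENNReal.toReal_mono (min_one_ne_top _) (min_le_min le_rfl (pathCost_anti hK n x))

theorem potential_eq_zero {ρ : X → ℝ≥0∞} {E K : Set X} {n : ℕ} {x : X} (hE : x ∈ E) (hK : x ∈ K) :
    potential ρ E K n x = 0 := by simp [potential, pathCost_eq_zero hE hK]

theorem edist_toReal_le {p q a : ℝ≥0∞} (hp : p ≠ ⊤) (hq : q ≠ ⊤) (h1 : p ≤ q + a) (h2 : q ≤ p + a) :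
    edist p.toReal q.toReal ≤ a := by
  rcases eq_or_ne a ⊤ with rfl | ha
  · exact le_top
  rw [edist_dist, Real.dist_eq]
  refine ENNReal.ofReal_le_of_le_toReal ?_
  have h1' := ENNReal.toReal_mono (by finiteness) h1
  have h2' := ENNReal.toReal_mono (by finiteness) h2
  rw [ENNReal.toReal_add hq ha] at h1'
  rw [ENNReal.toReal_add hp ha] at h2'
  exact abs_sub_le_iff.2 ⟨by linarith, by linarith⟩

theorem edist_potential_le {ρ : X → ℝ≥0∞} {E K : Set X} {n : ℕ} {x y : X} (hx : x ∈ K) (hy : y ∈ K)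
    (hxy : dist x y ≤ 1 / (n + 1)) :
    edist (potential ρ E K n x) (potential ρ E K n y) ≤
      max (lowReg ρ n x) (lowReg ρ n y) * edist x y := by
  have hmin : ∀ p q a : ℝ≥0∞, p ≤ q + a → min 1 p ≤ min 1 q + a := fun p q a h => by
    rw [min_add]
    exact le_min ((min_le_left _ _).trans le_self_add) ((min_le_right _ _).trans h)
  refine edist_toReal_le (min_one_ne_top _) (min_one_ne_top _) (hmin _ _ _ ?_) (hmin _ _ _ ?_)
  · refine (pathCost_le_add hy hx (by rwa [dist_comm])).trans ?_
    rw [edist_comm]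
    gcongr
    exact le_max_right _ _
  · refine (pathCost_le_add hx hy hxy).trans ?_
    gcongr
    exact le_max_left _ _

theorem lipschitzOnWith_potential (ρ : X → ℝ≥0∞) (E K : Set X) (n : ℕ) :
    LipschitzOnWith (n + 1) (potential ρ E K n) K := by
  intro x hx y hy
  rcases le_or_gt (dist x y) (1 / (n + 1)) with h | h
  · refine (edist_potential_le hx hy h).trans ?_
    gcongr
    refine (max_le (lowReg_le_natCast _ _ _) (lowReg_le_natCast _ _ _)).trans ?_
    push_cast
    exact le_self_add
  · have h1 : edist (potential ρ E K n x) (potential ρ E K n y) ≤ 1 := by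
      rw [edist_dist, Real.dist_eq]
      refine ENNReal.ofReal_le_one.2 (abs_sub_le_iff.2 ⟨?_, ?_⟩) <;>
        linarith [potential_nonneg ρ E K n x, potential_le_one ρ E K n x,
          potential_nonneg ρ E K n y, potential_le_one ρ E K n y]
    refine h1.trans ?_
    rw [div_lt_iff₀ (by positivity)] at h
    rw [edist_dist, ← ENNReal.ofReal_coe_nnreal, ← ENNReal.ofReal_mul (by positivity),
      ENNReal.one_le_ofReal]
    push_cast
    linarith

/-- On a time interval shorter than `1 / (n + 1)` a `1`-Lipschitz path stays in the balls over which
`lowReg ρ n` at its endpoints is an infimum. Hence these endpoint values lie below `ρ` all along the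
piece. -/
theorem upperGradientOn_potential (ρ : X → ℝ≥0∞) (E K : Set X) (n : ℕ) :
    UpperGradientOn K (potential ρ E K n) ρ := by
  intro a b c hab hc hK
  have hη : (0 : ℝ) < 1 / (n + 1) := by positivity
  refine edist_le_setLIntegral_of_local (h := fun s => potential ρ E K n (c s)) hab fun t _ =>
    ⟨1 / (n + 1) / 2, half_pos hη, fun s s' hss hs hs' h1 h2 => ?_⟩
  rw [abs_lt] at h1 h2
  have hsub : Icc s s' ⊆ Icc a b := Icc_subset_Icc hs.1 hs'.2
  have hd : ∀ r ∈ Icc a b, ∀ r' ∈ Icc a b, dist (c r) (c r') ≤ |r - r'| := fun r hr r' hr' => by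
    simpa [Real.dist_eq] using hc.dist_le_mul r hr r' hr'
  have hdss : dist (c s) (c s') ≤ s' - s := by
    have := hd s hs s' hs'
    rwa [abs_sub_comm, abs_of_nonneg (sub_nonneg.2 hss)] at this
  refine (edist_potential_le (hK hs) (hK hs') (by linarith)).trans ?_
  calc max (lowReg ρ n (c s)) (lowReg ρ n (c s')) * edist (c s) (c s')
      ≤ max (lowReg ρ n (c s)) (lowReg ρ n (c s')) * ENNReal.ofReal (s' - s) := by
        gcongr
        rw [edist_dist]
        exact ENNReal.ofReal_le_ofReal hdss
    _ = ∫⁻ _ in Icc s s', max (lowReg ρ n (c s)) (lowReg ρ n (c s')) := by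
        rw [setLIntegral_const, Real.volume_Icc]
    _ ≤ _ := by
        refine setLIntegral_mono' measurableSet_Icc fun r hr => max_le ?_ ?_
        · refine lowReg_le ((hd r (hsub hr) s hs).trans_lt ?_)
          rw [abs_of_nonneg (sub_nonneg.2 hr.1)]
          linarith [hr.2]
        · refine lowReg_le ((hd r (hsub hr) s' hs').trans_lt ?_)
          rw [abs_sub_comm, abs_of_nonneg (sub_nonneg.2 hr.2)]
          linarith [hr.1]

variable [MeasurableSpace X] [BorelSpace X]

theorem measurable_potential (ρ : X → ℝ≥0∞) (E : Set X) {K : Set X} (hK : IsClosed K) (n : ℕ) :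
    Measurable (potential ρ E K n) := by
  classical
  have : potential ρ E K n = K.piecewise (potential ρ E K n) (fun _ => 1) := by
    ext x
    by_cases hx : x ∈ K
    · rw [piecewise_eq_of_mem _ _ _ hx]
    · rw [piecewise_eq_of_notMem _ _ _ hx]
      simp [potential, pathCost_eq_top hx]
  rw [this]
  exact (lipschitzOnWith_potential ρ E K n).continuousOn.measurable_piecewise continuousOn_const
    hK.measurableSet

/-- Coarse paths of bounded cost in a compact set subconverge to Lipschitz paths, and the cost is
lower semicontinuous. -/
theorem exists_lipschitz_path_of_coarsePaths {ρ : X → ℝ≥0∞} (hρ : LowerSemicontinuous ρ) {δ : ℝ≥0}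
    (hδ : 0 < δ) (hδρ : ∀ x, δ ≤ ρ x) {E F K : Set X} (hE : IsClosed E) (hF : IsClosed F)
    (hK : IsCompact K) {a : ℝ≥0∞} (ha : a ≠ ⊤) {T : ℕ → ℝ} {c : ℕ → ℝ → X}
    (hc : ∀ n : ℕ, IsCoarsePath K (1 / (n + 1)) (T n) (c n)) (hcE : ∀ n, c n 0 ∈ E)
    (hcF : ∀ n, c n (T n) ∈ F) (hca : ∀ n, ∫⁻ s in Ico 0 (T n), lowReg ρ n (c n s) ≤ a) :
    ∃ (S : ℝ) (γ : ℝ → X), 0 ≤ S ∧ LipschitzWith 1 γ ∧ (∀ s, γ s ∈ K) ∧ γ 0 ∈ E ∧ γ S ∈ F ∧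
      ∫⁻ s in Icc 0 S, ρ (γ s) ≤ a := by
  -- Along an ultrafilter the paths, with values in the compact set `K`, converge at all times
  -- simultaneously, without extracting subsequences.
  set 𝒰 : Ultrafilter ℕ := Ultrafilter.of atTop with h𝒰
  have h𝒰le : (𝒰 : Filter ℕ) ≤ atTop := Ultrafilter.of_le atTop
  have hη : Tendsto (fun n : ℕ => 1 / ((n : ℝ) + 1)) 𝒰 (𝓝 0) :=
    tendsto_one_div_add_atTop_nhds_zero_nat.mono_left h𝒰le
  set R : ℝ := (a / δ).toReal with hR
  have haδ : a / δ ≠ ⊤ := ENNReal.div_ne_top ha (by exact_mod_cast hδ.ne')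
  -- For `n ≥ δ` the regularized cost density is at least `δ`, so a bound on the cost bounds the
  -- duration.
  have hTR : ∀ᶠ n in (𝒰 : Filter ℕ), T n ∈ Icc 0 R := by
    obtain ⟨N, hN⟩ := exists_nat_ge δ
    filter_upwards [h𝒰le (eventually_ge_atTop N)] with n hn
    refine ⟨(hc n).nonneg, ?_⟩
    have h1 : δ * ENNReal.ofReal (T n) ≤ a := by
      refine le_trans (le_of_eq ?_) ((setLIntegral_mono' (μ := volume) measurableSet_Ico
        (f := fun _ => (δ : ℝ≥0∞)) fun s _ => le_lowReg hδρ (n := n) ?_ (c n s)).trans (hca n))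
      · rw [setLIntegral_const, Real.volume_Ico, sub_zero]
      · have : δ ≤ (n : ℝ≥0) := hN.trans (by exact_mod_cast hn)
        exact_mod_cast this
    rw [hR, ← ENNReal.ofReal_le_iff_le_toReal haδ, ENNReal.le_div_iff_mul_le
      (Or.inl (by exact_mod_cast hδ.ne')) (Or.inl ENNReal.coe_ne_top), mul_comm]
    exact h1
  obtain ⟨S, hS, hTS⟩ := (isCompact_Icc (a := (0 : ℝ)) (b := R)).ultrafilter_le_nhds
    (𝒰.map T) (le_principal_iff.2 hTR)
  have hTS' : Tendsto T 𝒰 (𝓝 S) := hTS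
  set p : ℕ → ℝ → ℝ := fun n s => max 0 (min s (T n)) with hp
  have hpmem : ∀ n s, p n s ∈ Icc 0 (T n) := fun n s =>
    ⟨le_max_left _ _, max_le (hc n).nonneg (min_le_right _ _)⟩
  have hpdist : ∀ n s s', |p n s - p n s'| ≤ |s - s'| := fun n s s' => by
    have h1 := abs_max_sub_max_le_max 0 (min s (T n)) 0 (min s' (T n))
    have h2 := abs_min_sub_min_le_max s (T n) s' (T n)
    simp only [sub_self, abs_zero, abs_nonneg, sup_of_le_right, sup_of_le_left] at h1 h2
    exact h1.trans h2
  set c' : ℕ → ℝ → X := fun n s => c n (p n s) with hc'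
  have hc'dist : ∀ n s s', dist (c' n s) (c' n s') ≤ |s - s'| + 1 / ((n : ℝ) + 1) := fun n s s' =>
    ((hc n).dist_le _ (hpmem n s) _ (hpmem n s')).trans (by linarith [hpdist n s s'])
  have hlim : ∀ s, ∃ x ∈ K, Tendsto (fun n => c' n s) 𝒰 (𝓝 x) := fun s => by
    obtain ⟨x, hx, hx'⟩ := hK.ultrafilter_le_nhds (𝒰.map fun n => c' n s)
      (le_principal_iff.2 (Eventually.of_forall (f := (𝒰 : Filter ℕ))
        fun n => (hc n).mem _ (hpmem n s)))
    exact ⟨x, hx, hx'⟩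
  choose γ hγK hγ using hlim
  have hγdist : ∀ s s', dist (γ s) (γ s') ≤ |s - s'| := fun s s' => by
    have h1 := (hγ s).dist (hγ s')
    have h2 := hη.const_add |s - s'|
    rw [add_zero] at h2
    exact le_of_tendsto_of_tendsto h1 h2 (Eventually.of_forall fun n => hc'dist n s s')
  have hγL : LipschitzWith 1 γ := LipschitzWith.of_dist_le_mul fun s s' => by
    simpa [Real.dist_eq] using hγdist s s'
  have hγ0 : γ 0 ∈ E := hE.mem_of_tendsto (hγ 0) (Eventually.of_forall fun n => by
    have : p n 0 = 0 := by simp only [hp, min_eq_left (hc n).nonneg, max_self]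
    simp only [hc', this]; exact hcE n)
  have hγS : γ S ∈ F := by
    have h1 : Tendsto (fun n => dist (c' n S) (c n (T n))) 𝒰 (𝓝 0) := by
      have h2 : Tendsto (fun n => |S - T n| + 1 / ((n : ℝ) + 1)) 𝒰 (𝓝 0) := by
        simpa using ((tendsto_const_nhds (x := S)).sub hTS').abs.add hη
      refine tendsto_of_tendsto_of_tendsto_of_le_of_le tendsto_const_nhds h2
        (fun n => dist_nonneg) fun n => ?_
      have h3 := hc'dist n S (T n)
      have : p n (T n) = T n := by simp only [hp, min_self, max_eq_right (hc n).nonneg]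
      simp only [hc', this] at h3 ⊢
      exact h3
    exact hF.mem_of_tendsto ((tendsto_iff_of_dist h1).1 (hγ S)) (Eventually.of_forall hcF)
  refine ⟨S, γ, hS.1, hγL, hγK, hγ0, hγS, ?_⟩
  -- Equicontinuity up to the vanishing error `1 / (n + 1)` upgrades pointwise to uniform
  -- convergence on `[0, R]`.
  have hunif : ∀ α > 0, ∀ᶠ n in (𝒰 : Filter ℕ), ∀ s ∈ Icc 0 R, dist (c' n s) (γ s) < α := by
    intro α hα
    obtain ⟨t, -, htf, ht⟩ := (isCompact_Icc (a := (0 : ℝ)) (b := R)).finite_cover_balls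
      (e := α / 4) (by positivity)
    have h1 : ∀ᶠ n in (𝒰 : Filter ℕ), ∀ r ∈ t, dist (c' n r) (γ r) < α / 4 :=
      (eventually_all_finite htf).2 fun r _ =>
        (tendsto_iff_dist_tendsto_zero.1 (hγ r)).eventually (gt_mem_nhds (by positivity))
    filter_upwards [h1, hη.eventually (gt_mem_nhds (show (0 : ℝ) < α / 4 by positivity))]
      with n hn hn' s hs
    obtain ⟨r, hr, hsr⟩ := mem_iUnion₂.1 (ht hs)
    rw [Metric.mem_ball, Real.dist_eq] at hsr
    have d1 := hc'dist n s r
    have d2 := hn r hr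
    have d3 := hγdist r s
    rw [abs_sub_comm] at d3
    linarith [dist_triangle4 (c' n s) (c' n r) (γ r) (γ s)]
  -- The scale `i` is frozen: for late `n` the ball of radius `1 / (i + 1)` about `γ s` contains the
  -- smaller ball about the coarse path, so the frozen density lies below the running one. Cutting
  -- at `S - 1 / (i + 1)` keeps `s` below `T n`.
  set f : ℕ → ℝ → ℝ≥0∞ := fun i =>
    (Ico 0 (S - 1 / ((i : ℝ) + 1))).indicator fun s => lowReg ρ i (γ s) with hf
  have hfm : ∀ i, Measurable (f i) := fun i =>
    ((measurable_lowReg ρ i).comp hγL.continuous.measurable).indicator measurableSet_Ico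
  have hfi : ∀ i, ∫⁻ s, f i s ≤ a := by
    intro i
    have hi : (0 : ℝ) < 1 / (i + 1) := by positivity
    have hge : ∀ᶠ n in (𝒰 : Filter ℕ), i ≤ n := h𝒰le (eventually_ge_atTop i)
    obtain ⟨n, h1, h2, h3, h4⟩ := ((hunif _ (half_pos hi)).and
      ((hη.eventually (gt_mem_nhds (half_pos hi))).and
        (hge.and
          (hTS'.eventually (lt_mem_nhds (sub_lt_self S hi)))))).exists
    rw [lintegral_indicator measurableSet_Ico]
    refine le_trans ?_ (hca n)
    refine le_trans ?_ (lintegral_mono_set (Ico_subset_Ico_right h4.le))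
    refine setLIntegral_mono' measurableSet_Ico fun s hs => ?_
    have hsT : s ≤ T n := hs.2.le.trans h4.le
    have hps : p n s = s := by simp only [hp, min_eq_left hsT, max_eq_right hs.1]
    have h5 := h1 s ⟨hs.1, by linarith [hs.2, hS.2]⟩
    simp only [hc', hps] at h5
    exact lowReg_le_lowReg h3 (by linarith)
  have hfmono : Monotone f := fun i j hij s => by
    simp only [hf]
    by_cases hs : s ∈ Ico 0 (S - 1 / ((i : ℝ) + 1))
    · have hs' : s ∈ Ico 0 (S - 1 / ((j : ℝ) + 1)) :=
        ⟨hs.1, hs.2.trans_le (by linarith [Nat.one_div_le_one_div (α := ℝ) hij])⟩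
      rw [indicator_of_mem hs, indicator_of_mem hs']
      exact lowReg_mono hij _
    · rw [indicator_of_notMem hs]; exact bot_le
  calc ∫⁻ s in Icc 0 S, ρ (γ s) = ∫⁻ s in Ico 0 S, ρ (γ s) :=
        setLIntegral_congr Ico_ae_eq_Icc.symm
    _ ≤ ∫⁻ s in Ico 0 S, ⨆ i, f i s := by
        refine setLIntegral_mono' measurableSet_Ico fun s hs => ?_
        refine (le_iSup_lowReg hρ (γ s)).trans (iSup_le fun i => ?_)
        obtain ⟨k, hk⟩ := exists_nat_one_div_lt (sub_pos.2 hs.2)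
        refine le_iSup_of_le (max i k) ?_
        have hs' : s ∈ Ico 0 (S - 1 / (((max i k : ℕ) : ℝ) + 1)) :=
          ⟨hs.1, by linarith [Nat.one_div_le_one_div (α := ℝ) (le_max_right i k)]⟩
        simp only [hf]
        rw [indicator_of_mem hs']
        exact lowReg_mono (le_max_left i k) _
    _ ≤ ∫⁻ s, ⨆ i, f i s := setLIntegral_le_lintegral _ _
    _ = ⨆ i, ∫⁻ s, f i s := lintegral_iSup hfm hfmono
    _ ≤ a := iSup_le hfi

/-- The potential is uniformly close to `1` on `F` if `ρ` is admissible for the Lipschitz paths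
in `K` that join `E` and `F`. -/
theorem exists_le_potential {ρ : X → ℝ≥0∞} (hρ : LowerSemicontinuous ρ) {δ : ℝ≥0}
    (hδ : 0 < δ) (hδρ : ∀ x, δ ≤ ρ x) {E F K : Set X} (hE : IsClosed E) (hF : IsClosed F)
    (hK : IsCompact K)
    (hadm : ∀ (S : ℝ) (γ : ℝ → X), 0 ≤ S → LipschitzWith 1 γ → (∀ s, γ s ∈ K) → γ 0 ∈ E →
      γ S ∈ F → 1 ≤ ∫⁻ s in Icc 0 S, ρ (γ s)) {s : ℝ} (hs : s < 1) :
    ∃ N, ∀ n ≥ N, ∀ x ∈ F, s ≤ potential ρ E K n x := by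
  suffices h : ∃ n, ∀ x ∈ F, s ≤ potential ρ E K n x by
    obtain ⟨N, hN⟩ := h
    exact ⟨N, fun n hn x hx => (hN x hx).trans (potential_mono hn x)⟩
  -- Otherwise every scale `n` has a coarse path from `E` to `F` of cost below `s`; their limit path
  -- has cost less than `1`.
  by_contra! hcon
  choose x hxF hx using hcon
  have hs1 : ENNReal.ofReal s < 1 := ENNReal.ofReal_lt_one.2 hs
  have hlt : ∀ n, pathCost ρ E K n (x n) < ENNReal.ofReal s := fun n => by
    have h1 : min 1 (pathCost ρ E K n (x n)) < ENNReal.ofReal s :=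
      (ENNReal.lt_ofReal_iff_toReal_lt (min_one_ne_top _)).2 (hx n)
    rcases min_lt_iff.1 h1 with h | h
    · exact absurd h (not_lt.2 hs1.le)
    · exact h
  choose T c hc hcE hcx hca using fun n => exists_path_of_pathCost_lt (hlt n)
  obtain ⟨S, γ, h1, h2, h3, h4, h5, h6⟩ := exists_lipschitz_path_of_coarsePaths hρ hδ hδρ hE hF hK
    ENNReal.ofReal_ne_top hc hcE (fun n => by rw [hcx n]; exact hxF n) fun n => (hca n).le
  exact absurd (hadm S γ h1 h2 h3 h4 h5) (not_le.2 (h6.trans_lt hs1))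

end Paths

/-! ### The product of two admissible functions has integral at least one -/

section Duality

theorem one_le_lintegral_of_joiningCurves {X : Type*} [MetricSpace X] {E F K Ω : Set X} (hEΩ : E ⊆ Ω) (hFΩ : F ⊆ Ω)
    (hKΩ : K ⊆ Ω) {ρ : X → ℝ≥0∞}
    (hadm : ∀ γ ∈ joiningCurves E F Ω, γ.Rectifiable → 1 ≤ γ.integral ρ) (S : ℝ) (γ : ℝ → X)
    (hS : 0 ≤ S) (hγ : LipschitzWith 1 γ) (hγK : ∀ s, γ s ∈ K) (h0 : γ 0 ∈ E) (h1 : γ S ∈ F) :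
    1 ≤ ∫⁻ s in Icc 0 S, ρ (γ s) := by
  have hl : LipschitzOnWith 1 γ (Icc 0 S) := hγ.lipschitzOnWith
  refine (hadm (lipCurve hS hl) ⟨fun t _ => hKΩ (hγK t), Or.inl ⟨⟨h0, hEΩ h0⟩, h1, hFΩ h1⟩⟩
    (rectifiable_lipCurve hS hl)).trans (integral_lipCurve_le hS hl ρ)

theorem enorm_sub_le_one {a b : ℝ} (ha0 : 0 ≤ a) (ha1 : a ≤ 1) (hb0 : 0 ≤ b) (hb1 : b ≤ 1) :
    ‖a - b‖ₑ ≤ 1 := by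
  rw [Real.enorm_eq_ofReal_abs]
  exact ENNReal.ofReal_le_one.2 (abs_le.2 ⟨by linarith, by linarith⟩)

theorem tendsto_lintegral_enorm_sub {X : Type*} [MeasurableSpace X] {m : Measure X}
    [IsFiniteMeasure m] {h : ℕ → X → ℝ} {u : X → ℝ}
    (hm : ∀ n, Measurable (h n)) (hu : Measurable u) (h0 : ∀ n x, 0 ≤ h n x)
    (h1 : ∀ n x, h n x ≤ 1) (hlim : ∀ x, Tendsto (fun n => h n x) atTop (𝓝 (u x))) :
    Tendsto (fun n => ∫⁻ x, ‖h n x - u x‖ₑ ∂m) atTop (𝓝 0) := by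
  have := tendsto_lintegral_of_dominated_convergence (μ := m) (f := fun _ => 0)
    (F := fun n x => ‖h n x - u x‖ₑ) (fun _ => 1) (fun n => ((hm n).sub hu).enorm)
    (fun n => Eventually.of_forall fun x => enorm_sub_le_one (h0 n x) (h1 n x)
      (ge_of_tendsto (hlim x) (Eventually.of_forall fun n => h0 n x))
      (le_of_tendsto (hlim x) (Eventually.of_forall fun n => h1 n x)))
    (by simp) (Eventually.of_forall fun x => by
      have h2 : Tendsto (fun n => h n x - u x) atTop (𝓝 0) := by
        simpa using (hlim x).sub_const (u x)
      simpa using h2.enorm)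
  simpa using this

/-- Potentials on larger and larger compact subsets of `Ω` are glued to a locally Lipschitz function
on `Ω`, to which the coarea inequality is applied. All errors are measured in `f μ` on `Ω`, the
measure appearing in the conclusion. -/
theorem one_le_lintegral_mul {X : Type*} [MetricSpace X] [MeasurableSpace X] [BorelSpace X]
    [ProperSpace X] [Nonempty X] {μ : Measure X} [IsLocallyFiniteMeasure μ] {Ω E F : Set X} (hΩ : IsOpen Ω) (hE : IsCompact E) (hF : IsCompact F)
    (hEΩ : E ⊆ Ω) (hFΩ : F ⊆ Ω) {ρ f σ : X → ℝ≥0∞} {δ δ' : ℝ≥0} (hδ : 0 < δ) (hδ' : 0 < δ')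
    (hρ : LowerSemicontinuous ρ) (hf : LowerSemicontinuous f) (hδρ : ∀ x, δ ≤ ρ x)
    (hδf : ∀ x, δ' ≤ f x)
    (hadm : ∀ γ ∈ joiningCurves E F Ω, γ.Rectifiable → 1 ≤ γ.integral ρ)
    (hσ : ∀ ν ∈ separatingPerimeters μ E F Ω, 1 ≤ ∫⁻ x, σ x ∂ν) (hσf : ∀ x, σ x ≤ f x) :
    1 ≤ ∫⁻ x in Ω, ρ x * f x ∂μ := by
  rcases eq_or_ne (∫⁻ x in Ω, ρ x * f x ∂μ) ⊤ with htop | hfin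
  · rw [htop]; exact le_top
  have hfm : Measurable f := hf.measurable
  set m : Measure X := (μ.restrict Ω).withDensity f with hm
  have hmint : ∀ g : X → ℝ≥0∞, Measurable g → ∫⁻ x, g x ∂m = ∫⁻ x in Ω, g x * f x ∂μ :=
    fun g hg => by
      rw [hm, lintegral_withDensity_eq_lintegral_mul _ hfm hg]
      exact lintegral_congr fun x => mul_comm _ _
  -- Since `ρ ≥ δ`, the mass of `m` is at most `1 / δ` times the integral of `ρ f`. Finiteness
  -- allows dominated convergence for the potentials.
  have : IsFiniteMeasure m := by
    refine isFiniteMeasure_withDensity fun h => hfin ?_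
    refine top_le_iff.1 (le_trans ?_ (lintegral_mono (μ := μ.restrict Ω)
      (f := fun x => (δ : ℝ≥0∞) * f x) fun x => mul_le_mul' (hδρ x) le_rfl))
    rw [lintegral_const_mul _ hfm, h, ENNReal.mul_top (by exact_mod_cast hδ.ne')]
  obtain ⟨W, hWo, hWc, hWs, rfl⟩ := exists_exhaustion hΩ
  have hWm : Monotone W := monotone_nat_of_le_succ fun k => subset_closure.trans (hWs k)
  obtain ⟨k₀, hk₀⟩ := exists_subset_of_isCompact hWo hWm (hE.union hF) (union_subset hEΩ hFΩ)
  set V : ℕ → Set X := fun k => W (k + k₀) with hV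
  have hVo : ∀ k, IsOpen (V k) := fun k => hWo _
  have hVc : ∀ k, IsCompact (closure (V k)) := fun k => hWc _
  have hVs : ∀ k, closure (V k) ⊆ V (k + 1) := fun k => by
    have := hWs (k + k₀)
    rwa [show k + k₀ + 1 = k + 1 + k₀ by ring] at this
  have hVm : Monotone V := fun i j hij => hWm (by omega)
  have hUnion : ⋃ k, V k = ⋃ k, W k := Subset.antisymm
    (iUnion_subset fun k => subset_iUnion W _)
    (iUnion_subset fun k => (hWm (Nat.le_add_right k k₀)).trans (subset_iUnion V k))
  have hEV : E ⊆ V 0 := fun x hx => by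
    have : x ∈ W k₀ := hk₀ (Or.inl hx)
    simpa [hV] using this
  have hFV : F ⊆ V 0 := fun x hx => by
    have : x ∈ W k₀ := hk₀ (Or.inr hx)
    simpa [hV] using this
  set P : ℕ → ℕ → X → ℝ := fun j n => potential ρ E (closure (V j)) n with hP
  have hPm : ∀ j n, Measurable (P j n) := fun j n => measurable_potential ρ E isClosed_closure n
  have hP0 : ∀ j n x, 0 ≤ P j n x := fun j n x => potential_nonneg _ _ _ _ _
  have hP1 : ∀ j n x, P j n x ≤ 1 := fun j n x => potential_le_one _ _ _ _ _
  have hbdd : ∀ j x, BddAbove (range fun n => P j n x) := fun j x =>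
    ⟨1, by rintro _ ⟨n, rfl⟩; exact hP1 j n x⟩
  set Q : ℕ → X → ℝ := fun j x => ⨆ n, P j n x with hQ
  have hPQ : ∀ j x, Tendsto (fun n => P j n x) atTop (𝓝 (Q j x)) := fun j x =>
    tendsto_atTop_ciSup (fun a b hab => potential_mono hab x) (hbdd j x)
  have hQm : ∀ j, Measurable (Q j) := fun j =>
    measurable_of_tendsto_metrizable (hPm j) (tendsto_pi_nhds.2 (hPQ j))
  have hQ0 : ∀ j x, 0 ≤ Q j x := fun j x =>
    ge_of_tendsto (hPQ j x) (Eventually.of_forall fun n => hP0 j n x)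
  have hQ1 : ∀ j x, Q j x ≤ 1 := fun j x =>
    le_of_tendsto (hPQ j x) (Eventually.of_forall fun n => hP1 j n x)
  set u : X → ℝ := fun x => ⨅ j, Q j x with hu
  have hQu : ∀ x, Tendsto (fun j => Q j x) atTop (𝓝 (u x)) := fun x =>
    tendsto_atTop_ciInf (fun i j hij => ciSup_mono (hbdd i x) fun n =>
      potential_anti (closure_mono (hVm hij)) n x) ⟨0, by rintro _ ⟨j, rfl⟩; exact hQ0 j x⟩
  have hum : Measurable u := measurable_of_tendsto_metrizable hQm (tendsto_pi_nhds.2 hQu)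
  refine le_of_forall_lt fun a ha => ?_
  obtain ⟨s', has', hs'⟩ := exists_between ha
  refine has'.trans_le ?_
  set s : ℝ := s'.toReal with hs
  have hs'top : s' ≠ ⊤ := (hs'.trans ENNReal.one_lt_top).ne
  have hs1 : s < 1 := by
    have := (ENNReal.toReal_lt_toReal hs'top ENNReal.one_ne_top).2 hs'
    simpa using this
  rw [← ENNReal.ofReal_toReal hs'top]
  refine ENNReal.le_of_forall_pos_le_add fun ε hε _ => ?_
  obtain ⟨e, he, hesum⟩ := ENNReal.exists_pos_sum_of_countable'
    (ε := (ε : ℝ≥0∞)) (by exact_mod_cast hε.ne') ℕ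
  obtain ⟨C, α, hC, hglue⟩ := exists_gluing hVo hVc hVs
  -- First `j` brings `Q j` close to `u`, then `n`, depending on `j`, brings `P j n` close to `Q j`
  -- and makes it at least `s` on `F`. The condition `k + 1 ≤ j` puts the `k`-th annulus inside the
  -- set where the potential is Lipschitz.
  have hpick : ∀ k, ∃ j n, k + 1 ≤ j ∧ ∫⁻ x, ‖P j n x - u x‖ₑ ∂m ≤ e k / (α k + 1) ∧
      ∀ x ∈ F, s ≤ P j n x := fun k => by
    have hpos : 0 < e k / (α k + 1) / 2 :=
      ENNReal.div_pos (ENNReal.div_pos (he k).ne' (by finiteness)).ne' (by finiteness)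
    obtain ⟨j, hj1, hj2⟩ := (((tendsto_lintegral_enorm_sub (m := m) hQm hum hQ0 hQ1 hQu).eventually
      (ge_mem_nhds hpos)).and (eventually_ge_atTop (k + 1))).exists
    obtain ⟨N, hN⟩ := exists_le_potential hρ hδ hδρ hE.isClosed hF.isClosed (hVc j)
      (one_le_lintegral_of_joiningCurves hEΩ hFΩ
        ((hVs j).trans ((subset_iUnion V _).trans hUnion.subset)) hadm) hs1
    obtain ⟨n, hn1, hn2⟩ := (((tendsto_lintegral_enorm_sub (m := m) (hPm j) (hQm j) (hP0 j) (hP1 j)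
      (hPQ j)).eventually (ge_mem_nhds hpos)).and (eventually_ge_atTop N)).exists
    refine ⟨j, n, hj2, ?_, hN n hn2⟩
    calc ∫⁻ x, ‖P j n x - u x‖ₑ ∂m ≤ ∫⁻ x, (‖P j n x - Q j x‖ₑ + ‖Q j x - u x‖ₑ) ∂m :=
          lintegral_mono fun x => by
            have : P j n x - u x = (P j n x - Q j x) + (Q j x - u x) := by ring
            rw [this]; exact enorm_add_le _ _
      _ ≤ e k / (α k + 1) / 2 + e k / (α k + 1) / 2 := by
          have hm1 : Measurable fun x => ‖P j n x - Q j x‖ₑ := ((hPm j n).sub (hQm j)).enorm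
          rw [lintegral_add_left hm1]
          exact add_le_add hn1 hj1
      _ = _ := ENNReal.add_halves _
  choose j n hj hjn hjF using hpick
  have hsub : ∀ k, annulus V k ⊆ closure (V (j k)) := fun k =>
    (annulus_subset V k).trans ((hVm (hj k)).trans subset_closure)
  obtain ⟨v, hvl, hv0, -, hvg⟩ := hglue u (fun k => P (j k) (n k)) ρ
    (fun k x hx => ⟨_, _, self_mem_nhdsWithin,
      (lipschitzOnWith_potential ρ E _ (n k)).mono (hsub k)⟩)
    (fun k => (upperGradientOn_potential ρ E _ (n k)).mono (hsub k) fun _ _ => le_rfl)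
  have hCm : ∀ k, Measurable ((C k).indicator fun x => ‖P (j k) (n k) x - u x‖ₑ) := fun k =>
    ((hPm _ _).sub hum).enorm.indicator (hC k).1.measurableSet
  have hGm : Measurable fun x => ρ x +
      ∑' k, α k * (C k).indicator (fun x => ‖P (j k) (n k) x - u x‖ₑ) x :=
    hρ.measurable.add (Measurable.tsum fun k => (hCm k).const_mul _)
  rw [hUnion] at hvl hvg
  -- `E` and `F` lie in `V 0`, where the glued function is a single potential, so the boundary
  -- values survive the gluing.
  have hfinal := ofReal_le_lintegral_of_separating hΩ hEΩ hFΩ hvl hGm hvg (s := s)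
    (fun x hx => by
      rw [hv0 (hEV hx)]
      exact (potential_eq_zero hx (subset_closure (hVm (Nat.zero_le _) (hEV hx)))).le)
    (fun x hx => by
      rw [hv0 (hFV hx)]
      exact hjF 0 x hx) hσ hf hσf hδ' hδf
  refine hfinal.trans ?_
  rw [← hmint _ hGm, ← hmint _ hρ.measurable, lintegral_add_left hρ.measurable,
    lintegral_tsum fun k => ((hCm k).const_mul _).aemeasurable]
  gcongr
  refine (ENNReal.tsum_le_tsum fun k => ?_).trans hesum.le
  rw [lintegral_const_mul _ (hCm k)]
  calc α k * ∫⁻ x, (C k).indicator (fun x => ‖P (j k) (n k) x - u x‖ₑ) x ∂m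
      ≤ (α k + 1) * (e k / (α k + 1)) := by
        gcongr
        · exact le_self_add
        · exact (lintegral_mono (indicator_le_self _ _)).trans (hjn k)
    _ = e k := ENNReal.mul_div_cancel (by simp) (by finiteness)

end Duality

/-! ### Consequences of doubling, regularization of admissible functions, finite modulus -/

section Doubling
variable {X : Type*} [MetricSpace X] [MeasurableSpace X] {μ : Measure X}

theorem IsDoubling.measure_ball_lt_top (h : IsDoubling μ) (x : X) (r : ℝ) :
    μ (Metric.ball x r) < ⊤ := by
  obtain ⟨C, -, hC⟩ := h
  exact (measure_mono (Metric.ball_subset_ball (le_max_left r 1))).trans_lt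
    (hC x (max r 1) (lt_max_of_lt_right one_pos)).2.2

theorem IsDoubling.measure_ball_pos (h : IsDoubling μ) (x : X) {r : ℝ} (hr : 0 < r) :
    0 < μ (Metric.ball x r) := by
  obtain ⟨C, -, hC⟩ := h
  have := (hC x (r / 2) (half_pos hr)).1
  rwa [mul_div_cancel₀ r two_ne_zero] at this

theorem IsDoubling.isLocallyFiniteMeasure (h : IsDoubling μ) : IsLocallyFiniteMeasure μ :=
  ⟨fun x => ⟨Metric.ball x 1, Metric.ball_mem_nhds x one_pos, h.measure_ball_lt_top x 1⟩⟩

/-- An infinite separated sequence in a bounded ball would give infinitely many disjoint balls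
inside a ball of finite measure, while iterated doubling bounds their measures below by a fixed
positive number. -/
theorem IsDoubling.properSpace [BorelSpace X] [CompleteSpace X] (h : IsDoubling μ) : ProperSpace X := by
  have hdoub := h
  obtain ⟨C, -, hC⟩ := h
  refine ⟨fun x R => TotallyBounded.isCompact_of_isClosed ?_ Metric.isClosed_closedBall⟩
  refine Metric.totallyBounded_iff.2 fun ε hε => ?_
  by_contra! hcon
  obtain ⟨y, hy, hsep⟩ := exists_seq_of_forall_finset_exists
    (fun y => y ∈ Metric.closedBall x R) (fun y z => ε ≤ dist z y) fun t _ => by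
      obtain ⟨z, hz, hzt⟩ := not_subset.1 (hcon t t.finite_toSet)
      refine ⟨z, hz, fun w hw => le_of_not_gt fun hlt => hzt ?_⟩
      exact mem_iUnion₂.2 ⟨w, hw, hlt⟩
  set r := |R| + ε with hr
  have hr0 : 0 < r := by positivity
  -- After `k` doublings the ball of radius `ε / 2` about any `y n` covers `ball x r`.
  obtain ⟨k, hk⟩ := pow_unbounded_of_one_lt (2 * r / (ε / 2)) one_lt_two
  have hiter : ∀ (z : X) (i : ℕ), μ (Metric.ball z (2 ^ i * (ε / 2))) ≤
      ENNReal.ofReal C ^ i * μ (Metric.ball z (ε / 2)) := fun z i => by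
    induction i with
    | zero => simp
    | succ i ih =>
      have := (hC z (2 ^ i * (ε / 2)) (by positivity)).2.1
      rw [pow_succ', mul_assoc]
      refine this.trans ?_
      rw [pow_succ', mul_assoc]
      gcongr
  have hlow : ∀ n, μ (Metric.ball x r) / ENNReal.ofReal C ^ k ≤ μ (Metric.ball (y n) (ε / 2)) :=
    fun n => by
      refine ENNReal.div_le_of_le_mul' ((measure_mono ?_).trans (hiter (y n) k))
      refine Metric.ball_subset_ball' ?_
      rw [div_lt_iff₀ (by positivity)] at hk
      have h1 : dist (y n) x ≤ R := hy n
      rw [dist_comm]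
      linarith [le_abs_self R]
  have hsub : ⋃ n, Metric.ball (y n) (ε / 2) ⊆ Metric.ball x r := iUnion_subset fun n => by
    refine Metric.ball_subset_ball' ?_
    have h1 : dist (y n) x ≤ R := hy n
    linarith [le_abs_self R]
  have hdisj : Pairwise (Function.onFun Disjoint fun n => Metric.ball (y n) (ε / 2)) := by
    intro i j hij
    refine Metric.ball_disjoint_ball ?_
    rcases lt_or_gt_of_ne hij with h1 | h1
    · rw [dist_comm]; linarith [hsep i j h1]
    · linarith [hsep j i h1]
  have hsum := measure_mono (μ := μ) hsub
  rw [measure_iUnion hdisj fun n => Metric.isOpen_ball.measurableSet] at hsum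
  have htop : ∑' n, μ (Metric.ball (y n) (ε / 2)) = ⊤ := by
    refine top_le_iff.1 (le_trans (le_of_eq ?_) (ENNReal.tsum_le_tsum hlow))
    refine (ENNReal.tsum_const_eq_top_of_ne_zero ?_).symm
    exact (ENNReal.div_pos (hdoub.measure_ball_pos x hr0).ne' (by finiteness)).ne'
  exact absurd (htop ▸ hsum) (not_le.2 (hdoub.measure_ball_lt_top x r))

/-- Vitali–Carathéodory is applied to `max ρ δ ^ r` and the `r`-th root is taken. Half of `θ` pays
for `δ`, as `μ Ω` is finite, and half for lower semicontinuity. -/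
theorem exists_lowerSemicontinuous_rpow_lintegral_le [BorelSpace X] [ProperSpace X] [IsLocallyFiniteMeasure μ]
    {Ω : Set X} (hΩ : μ Ω ≠ ⊤) {r : ℝ} (hr : 0 < r) {ρ : X → ℝ≥0∞} (hρ : Measurable ρ)
    {θ : ℝ≥0∞} (hθ : θ ≠ 0) :
    ∃ (ρ' : X → ℝ≥0∞) (δ : ℝ≥0), 0 < δ ∧ LowerSemicontinuous ρ' ∧ (∀ x, ρ x ≤ ρ' x) ∧
      (∀ x, δ ≤ ρ' x) ∧ ∫⁻ x in Ω, ρ' x ^ r ∂μ ≤ ∫⁻ x, ρ x ^ r ∂μ + θ := by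
  have hθ2 : θ / 2 ≠ 0 := (ENNReal.half_pos hθ).ne'
  obtain ⟨δ, hδ, hδle⟩ : ∃ δ : ℝ≥0, 0 < δ ∧ (δ : ℝ≥0∞) ^ r * μ Ω ≤ θ / 2 := by
    have h1 : Tendsto (fun n : ℕ => (((n : ℝ≥0∞)⁻¹) ^ r) * μ Ω) atTop (𝓝 0) := by
      have h2 := ((ENNReal.continuous_rpow_const (y := r)).tendsto 0).comp
        ENNReal.tendsto_inv_nat_nhds_zero
      rw [ENNReal.zero_rpow_of_pos hr] at h2
      simpa using ENNReal.Tendsto.mul_const h2 (Or.inr hΩ)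
    obtain ⟨n, hn, hn0⟩ := ((h1.eventually (ge_mem_nhds (pos_iff_ne_zero.2 hθ2))).and
      (eventually_gt_atTop 0)).exists
    have hn0' : (n : ℝ≥0) ≠ 0 := by exact_mod_cast hn0.ne'
    refine ⟨(n : ℝ≥0)⁻¹, by positivity, ?_⟩
    rwa [ENNReal.coe_inv hn0', ENNReal.coe_natCast]
  obtain ⟨g, hg, hgl, hgi⟩ := exists_le_lowerSemicontinuous_lintegral_ge (μ.restrict Ω)
    (fun x => max (ρ x) δ ^ r) ((hρ.max measurable_const).pow_const r) hθ2
  have hroot : ∀ a : ℝ≥0∞, (a ^ r) ^ r⁻¹ = a := fun a => by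
    rw [← ENNReal.rpow_mul, mul_inv_cancel₀ hr.ne', ENNReal.rpow_one]
  have hle : ∀ x, max (ρ x) δ ≤ g x ^ r⁻¹ := fun x => by
    rw [← hroot (max (ρ x) δ)]
    exact ENNReal.rpow_le_rpow (hg x) (inv_nonneg.2 hr.le)
  refine ⟨fun x => g x ^ r⁻¹, δ, hδ,
    ENNReal.continuous_rpow_const.comp_lowerSemicontinuous hgl
      (ENNReal.monotone_rpow_of_nonneg (inv_nonneg.2 hr.le)),
    fun x => (le_max_left _ _).trans (hle x), fun x => (le_max_right _ _).trans (hle x), ?_⟩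
  have hroot' : ∀ a : ℝ≥0∞, (a ^ r⁻¹) ^ r = a := fun a => by
    rw [← ENNReal.rpow_mul, inv_mul_cancel₀ hr.ne', ENNReal.rpow_one]
  simp only [hroot']
  refine hgi.trans ?_
  calc ∫⁻ x in Ω, max (ρ x) δ ^ r ∂μ + θ / 2
      ≤ ∫⁻ x in Ω, (ρ x ^ r + (δ : ℝ≥0∞) ^ r) ∂μ + θ / 2 := by
        gcongr with x
        rcases le_total (ρ x) δ with h | h
        · rw [max_eq_right h]; exact le_add_self
        · rw [max_eq_left h]; exact le_self_add
    _ ≤ (∫⁻ x, ρ x ^ r ∂μ + θ / 2) + θ / 2 := by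
        rw [lintegral_add_right _ measurable_const, setLIntegral_const]
        gcongr
        exact Measure.restrict_le_self
    _ = _ := by rw [add_assoc, ENNReal.add_halves]

/-- `E` and `F` are at distance at least some `r > 0`, so the constant `1 / r` on `Ω` is admissible.
-/
theorem curveModulus_joiningCurves_lt_top {Ω E F : Set X} (hΩ : MeasurableSet Ω) (hμΩ : μ Ω ≠ ⊤)
    (hE : IsCompact E) (hF : IsCompact F) (hEF : Disjoint E F) {p : ℝ} (hp : 0 < p) :
    curveModulus μ p (joiningCurves E F Ω) < ⊤ := by
  obtain ⟨r, hr, hlt⟩ := Metric.exists_pos_forall_lt_edist hE hF.isClosed hEF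
  have hr0 : (r : ℝ≥0∞) ≠ 0 := by exact_mod_cast hr.ne'
  refine lt_of_le_of_lt (iInf_le_of_le (Ω.indicator fun _ => (r : ℝ≥0∞)⁻¹)
    (iInf_le_of_le (measurable_const.indicator hΩ) (iInf_le_of_le ?_ le_rfl))) ?_
  · rintro γ ⟨hγΩ, hγ⟩ hrect
    have hdist : (r : ℝ≥0∞) ≤ edist (γ.toFun γ.a) (γ.toFun γ.b) := by
      rcases hγ with h | h
      · exact (hlt _ h.1.1 _ h.2.1).le
      · rw [edist_comm]; exact (hlt _ h.2.1 _ h.1.1).le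
    have hL : (0 : ℝ) ≤ γ.length.toReal := ENNReal.toReal_nonneg
    have hlen : edist (γ.toFun γ.a) (γ.toFun γ.b) ≤ ENNReal.ofReal γ.length.toReal := by
      have := γ.lipschitzOnWith_arcLength hrect (left_mem_Icc.2 hL) (right_mem_Icc.2 hL)
      rwa [γ.arcLength_zero hrect, γ.arcLength_length hrect, ENNReal.coe_one, one_mul, edist_comm 0,
        edist_dist γ.length.toReal, dist_zero_right, Real.norm_of_nonneg hL] at this
    rw [Curve.integral, setLIntegral_congr_fun (g := fun _ => (r : ℝ≥0∞)⁻¹) measurableSet_Icc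
      fun s hs => indicator_of_mem (γ.mapsTo_arcLength hrect hγΩ hs) _, setLIntegral_const,
      Real.volume_Icc, sub_zero]
    calc (1 : ℝ≥0∞) = (r : ℝ≥0∞)⁻¹ * r := (ENNReal.inv_mul_cancel hr0 ENNReal.coe_ne_top).symm
      _ ≤ _ := by gcongr; exact hdist.trans hlen
  · have : ∀ x, Ω.indicator (fun _ => (r : ℝ≥0∞)⁻¹) x ^ p =
        Ω.indicator (fun _ => ((r : ℝ≥0∞)⁻¹) ^ p) x := fun x => by
      by_cases hx : x ∈ Ω <;> simp [hx, hp]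
    simp only [this]
    rw [lintegral_indicator_const hΩ]
    exact ENNReal.mul_lt_top (ENNReal.rpow_lt_top_of_nonneg hp.le (ENNReal.inv_ne_top.2 hr0))
      hμΩ.lt_top

end Doubling
end MetricBV

/-! ### The modulus inequality -/

theorem proposition4p2 {X : Type*} [MetricSpace X] [CompleteSpace X] [Nontrivial X]
    [MeasurableSpace X] [BorelSpace X] (μ : Measure X)
    (hμ : MetricBV.IsDoubling μ) (hP : MetricBV.SupportsPoincare μ)
    (p : ℝ) (hp : 1 < p)
    (Ω : Set X) (hΩo : IsOpen Ω) (hΩc : IsConnected Ω) (hΩb : Bornology.IsBounded Ω)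
    (E F : Set X) (hE : IsCompact E) (hF : IsCompact F) (hE0 : E.Nonempty) (hF0 : F.Nonempty)
    (hEΩ : E ⊆ Ω) (hFΩ : F ⊆ Ω) (hEF : Disjoint E F)
    (hfin : MetricBV.modulus μ (p / (p - 1)) (MetricBV.separatingPerimeters μ E F Ω) < ⊤) :
    1 ≤ MetricBV.modulus μ (p / (p - 1)) (MetricBV.separatingPerimeters μ E F Ω) ^ ((p - 1) / p) *
      MetricBV.curveModulus μ p (MetricBV.joiningCurves E F Ω) ^ (1 / p) := by
  have hproper : ProperSpace X := hμ.properSpace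
  have hloc : IsLocallyFiniteMeasure μ := hμ.isLocallyFiniteMeasure
  have hp0 : 0 < p := one_pos.trans hp
  have hq0 : 0 < p / (p - 1) := div_pos hp0 (sub_pos.2 hp)
  have hμΩ : μ Ω ≠ ⊤ := by
    obtain ⟨x⟩ := (inferInstance : Nonempty X)
    obtain ⟨r, hr⟩ := hΩb.subset_ball x
    exact ((measure_mono hr).trans_lt (hμ.measure_ball_lt_top x r)).ne
  set A := MetricBV.curveModulus μ p (MetricBV.joiningCurves E F Ω) with hA
  set B := MetricBV.modulus μ (p / (p - 1)) (MetricBV.separatingPerimeters μ E F Ω) with hB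
  have hAtop : A ≠ ⊤ :=
    (MetricBV.curveModulus_joiningCurves_lt_top hΩo.measurableSet hμΩ hE hF hEF hp0).ne
  -- One `1 / n` is the distance of an almost optimal admissible function from the infimum, the
  -- other is the cost of its regularization.
  have key : ∀ n : ℕ, 1 ≤ (B + (n : ℝ≥0∞)⁻¹ + (n : ℝ≥0∞)⁻¹) ^ ((p - 1) / p) *
      (A + (n : ℝ≥0∞)⁻¹ + (n : ℝ≥0∞)⁻¹) ^ (1 / p) := by
    intro n
    have hθ : (n : ℝ≥0∞)⁻¹ ≠ 0 := ENNReal.inv_ne_zero.2 (ENNReal.natCast_ne_top n)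
    have hA' : A < A + (n : ℝ≥0∞)⁻¹ := ENNReal.lt_add_right hAtop hθ
    have hB' : B < B + (n : ℝ≥0∞)⁻¹ := ENNReal.lt_add_right hfin.ne hθ
    rw [hA] at hA'
    rw [hB] at hB'
    simp only [MetricBV.curveModulus, iInf_lt_iff] at hA'
    simp only [MetricBV.modulus, iInf_lt_iff] at hB'
    obtain ⟨ρ, hρm, hρadm, hρi⟩ := hA'
    obtain ⟨σ, hσm, hσadm, hσi⟩ := hB'
    obtain ⟨ρ', δ, hδ, hρ'l, hρ', hδρ, hρ'i⟩ :=
      MetricBV.exists_lowerSemicontinuous_rpow_lintegral_le hμΩ hp0 hρm hθ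
    obtain ⟨σ', δ', hδ', hσ'l, hσ', hδσ, hσ'i⟩ :=
      MetricBV.exists_lowerSemicontinuous_rpow_lintegral_le hμΩ hq0 hσm hθ
    have hone := MetricBV.one_le_lintegral_mul hΩo hE hF hEΩ hFΩ hδ hδ' hρ'l hσ'l hδρ hδσ
      (fun γ hγ hrect => (hρadm γ hγ hrect).trans (lintegral_mono fun s => hρ' _)) hσadm hσ'
    have hconj : p.HolderConjugate (p / (p - 1)) := Real.HolderConjugate.conjExponent hp
    refine hone.trans ((ENNReal.lintegral_mul_le_Lp_mul_Lq (μ.restrict Ω) hconj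
      hρ'l.measurable.aemeasurable hσ'l.measurable.aemeasurable).trans ?_)
    rw [mul_comm, one_div_div]
    have hexp : 0 ≤ (p - 1) / p := div_nonneg (sub_nonneg.2 hp.le) hp0.le
    gcongr
    · exact hσ'i.trans (add_le_add hσi.le le_rfl)
    · exact hρ'i.trans (add_le_add hρi.le le_rfl)
  have hlim : ∀ a : ℝ≥0∞, Tendsto (fun n : ℕ => a + (n : ℝ≥0∞)⁻¹ + (n : ℝ≥0∞)⁻¹) atTop (𝓝 a) :=
    fun a => by
      simpa using (ENNReal.tendsto_inv_nat_nhds_zero.const_add a).add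
        ENNReal.tendsto_inv_nat_nhds_zero
  have hexp : 0 ≤ (p - 1) / p := div_nonneg (sub_nonneg.2 hp.le) hp0.le
  have hexp' : 0 ≤ 1 / p := by positivity
  -- Finiteness of both moduli makes the product continuous at the limit, excluding the form `0 ·
  -- ∞`.
  refine ge_of_tendsto' (ENNReal.Tendsto.mul ((ENNReal.continuous_rpow_const.tendsto B).comp (hlim B))
    (Or.inr (ENNReal.rpow_ne_top_of_nonneg hexp' hAtop))
    ((ENNReal.continuous_rpow_const.tendsto A).comp (hlim A))
    (Or.inr (ENNReal.rpow_ne_top_of_nonneg hexp hfin.ne))) key
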